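/- **Setting.** Let $a<b$, $\Omega=(a,b)$, $T>0$, $\alpha\ge 2$, let $k\ge 3$ and $m_0\ge 2$ be integers, and let $f\in C^k([0,\infty);\mathbb R)$; write $F(z)=f(|z|^2)z$ for $z\in\mathbb C$. For an integer $r$ let $H^r_s(\Omega)=\{\phi\in H^r(\Omega):\ \partial_x^{2q}\phi(a)=\partial_x^{2q}\phi(b)=0 \text{ for } 0\le 2q<r\}$ (traces), with norm $\|\phi\|_{H^r_s}=\big(\sum_{l\ge1}\mu_l^{2r}|\widehat\phi_l|^2\big)^{1/2}$, where $\mu_l=\frac{\pi l}{b-a}$ and $\widehat\phi_l=\frac{2}{b-a}\int_a^b\phi(x)\sin(\mu_l(x-a))\,dx$. Let $\psi_0:\Omega\to\mathbb C$ and $\omega^\varepsilon:\Omega\to\mathbb C$ ($0<\varepsilon\le1$) be given, and put $\psi_1^\varepsilon=i\big(\partial_{xx}\psi_0+F(\psi_0)\big)+\varepsilon^\alpha\omega^\varepsilon$. For every $\varepsilon\in(0,1]$ let $\psi=\psi^\varepsilon$ be a solution on $[0,T]$ of $$i\partial_t\psi-\varepsilon^2\partial_{tt}\psi+\partial_{xx}\psi+F(\psi)=0\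 \text{ in }\Omega,\qquad \psi|_{\partial\Omega}=0,\qquad \psi(\cdot,0)=\psi_0,\quad \partial_t\psi(\cdot,0)=\psi_1^\varepsilon,$$ and let $\psi^s$ be a solution on $[0,T]$ of $i\partial_t\psi^s+\partial_{xx}\psi^s+F(\psi^s)=0$, $\psi^s|_{\partial\Omega}=0$, $\psi^s(\cdot,0)=\psi_0$. Assume, with constants $c,C_*>0$ independent of $\varepsilon\in(0,1]$ and with $\alpha^*=\min\{\alpha,2\}$ ($=2$ here): (A) $\psi_0\in H^{m_0+2}_s(\Omega)$, $\omega^\varepsilon\in H^{m_0}_s(\Omega)$ and $c\le\|\omega^\varepsilon\|_{H^{m_0}_s}\le C_*$; (B) $\psi^\varepsilon$ and $\psi^s$ are bounded by $C_*$ in $L^\infty([0,T];L^\infty\cap H^{m_0}\cap H^1_0)$; $\partial_t\psi^\varepsilon$, $\partial_t\psi^s$ and $\partial_{tt}\psi^s$ are bounded by $C_*$ in $L^\infty([0,T];H^1)$; $\|\partial_{tt}\psi^\varepsilon\|_{L^\infty([0,T];H^1)}\le C_*\,\varepsilon^{\alpha^*-2}$; and $\|\psi^\varepsilon-\psi^s\|_{L^\infty([0,T];H^1)}\le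 C_*\varepsilon^2$. Put $M_1=\max\big\{\sup_{0<\varepsilon\le1}\|\psi^\varepsilon\|_{L^\infty([0,T]\times\Omega)},\ \|\psi^s\|_{L^\infty([0,T]\times\Omega)}\big\}$. **The scheme (EWI-SP).** Let $M\ge1$ be an integer, $h=(b-a)/M$, $x_j=a+jh$, $\tau>0$, $t_n=n\tau$. For $v=(v_0,\dots,v_M)\in\mathbb C^{M+1}$ put, for $1\le l\le M-1$, $\widetilde v_l=\frac2M\sum_{j=1}^{M-1}v_j\sin(jl\pi/M)$, and $(I_Mv)(x)=\sum_{l=1}^{M-1}\widetilde v_l\sin(\mu_l(x-a))$, $\|v\|_{l^\infty}=\max_{1\le j\le M-1}|v_j|$. Let $$\beta_l^\pm=\frac{1\pm\sqrt{1+4\varepsilon^2\mu_l^2}}{2\varepsilon^2},\quad \delta_l=\beta_l^+-\beta_l^-,\quad \sigma_l^\pm=e^{i\tau\beta_l^\pm/2}\,\mathrm{sinc}(\tau\beta_l^\pm/2),\quad \mathrm{sinc}(s)=\frac{\sin s}{s},\ \mathrm{sinc}(0)=1,$$ $$c_l^0=\frac{\beta_l^+e^{i\tau\beta_l^-}-\beta_l^-e^{i\tau\beta_l^+}}{\delta_l},\quad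 d_l^0=\tau e^{i\tau/(2\varepsilon^2)}\,\mathrm{sinc}(\tau\delta_l/2),\quad c_l=-e^{i\tau/\varepsilon^2},\quad d_l=2e^{i\tau/(2\varepsilon^2)}\cos(\tau\delta_l/2),$$ $$p_l=\frac{-i\tau}{\varepsilon^2\delta_l}(\sigma_l^+-\sigma_l^-),\quad q_l=\frac{\tau}{\varepsilon^2\delta_l}\Big(\frac{1-\sigma_l^+}{\beta_l^+}-\frac{1-\sigma_l^-}{\beta_l^-}\Big),$$ $$p_l^*=\frac{-i\tau e^{i\tau/\varepsilon^2}}{\varepsilon^2\delta_l}\big(\overline{\sigma_l^+}-\overline{\sigma_l^-}\big),\quad q_l^*=\frac{\tau e^{i\tau/\varepsilon^2}}{\varepsilon^2\delta_l}\Big(\frac{1-\sigma_l^+}{e^{i\tau\beta_l^+}\beta_l^+}-\frac{1-\sigma_l^-}{e^{i\tau\beta_l^-}\beta_l^-}\Big).$$ The numerical solution $\psi^n=(\psi^n_0,\dots,\psi^n_M)$, $n\ge0$, has $\psi^n_0=\psi^n_M=0$, $\psi^0_j=\psi_0(x_j)$ for $1\le j\le M-1$, and $\psi^{n+1}_j=\sum_{l=1}^{M-1}(\widetilde{\psi^{n+1}})_l\sin(jl\pi/M)$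 for $1\le j\le M-1$, where $$(\widetilde{\psi^1})_l=c_l^0(\widetilde{\psi^0})_l+d_l^0(\widetilde{\psi_1^\varepsilon})_l+p_l(\widetilde{F(\psi^0)})_l+q_l(\widetilde{D^0})_l,$$ $$(\widetilde{\psi^{n+1}})_l=c_l(\widetilde{\psi^{n-1}})_l+d_l(\widetilde{\psi^n})_l+p_l(\widetilde{F(\psi^n)})_l+q_l(\widetilde{D^n})_l-p_l^*(\widetilde{F(\psi^{n-1})})_l-q_l^*(\widetilde{D^{n-1}})_l\quad(n\ge1).$$ Here $\psi_1^\varepsilon$ also denotes the vector with entries $\psi_1^\varepsilon(x_j)$, and, entrywise, $D^0=G(\psi^0)\psi_1^\varepsilon+H(\psi^0)\overline{\psi_1^\varepsilon}$ with $G(z)=f(|z|^2)+f'(|z|^2)|z|^2$ and $H(z)=f'(|z|^2)z^2$, and $D^n=\frac1\tau\big(F(\psi^n)-F(\psi^{n-1})\big)$ for $n\ge1$. **Theorem 1 (well-prepared initial data).** Let $m=\min\{m_0,k\}$. There are constants $0<\tau_0\le1$, $0<h_0\le\pi$ and $C>0$, independent of $\varepsilon$, $\tau$, $h$ and $n$,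 such that for all $\varepsilon\in(0,1]$, all $0<h=(b-a)/M\le h_0$, all $0<\tau\le\tau_0$ and all integers $0\le n\le T/\tau$, $$\|\psi^\varepsilon(\cdot,t_n)-I_M\psi^n\|_{L^2(\Omega)}\le C(h^m+\tau^2),\qquad \|\partial_x(\psi^\varepsilon(\cdot,t_n)-I_M\psi^n)\|_{L^2(\Omega)}\le C(h^{m-1}+\tau^2),\qquad \|\psi^n\|_{l^\infty}\le M_1+1.$$ -/

import Mathlib

open Set MeasureTheory
open scoped ComplexConjugate

noncomputable section

namespace NLSW

/-! ### Sobolev spaces on a bounded interval -/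

/-- `g j`, `j ≤ m`, are the weak derivatives of order `j` of `u ∈ H^m(a,b)`.  In one space dimension
the elements of `H^m(a,b)` are, through their continuous representatives, the functions whose
derivatives of order `< m` are absolutely continuous on `[a,b]`, the derivative of order `m` being
square integrable; `g j` for `j < m` is the continuous representative, so `g j a` and `g j b` are
the traces of the `j`-th derivative. -/
structure WeakDerivs (a b : ℝ) (m : ℕ) (u : ℝ → ℂ) (g : ℕ → ℝ → ℂ) : Prop where
  zero : EqOn (g 0) u (Icc a b)
  succ : ∀ j < m, ∀ x ∈ Icc a b, g j x = g j a + ∫ y in a..x, g (j + 1) y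
  memLp : MemLp (g m) 2 (volume.restrict (Ioo a b))

/-- `u ∈ H^m(a,b)` with `‖u‖_{H^m} ≤ C`. -/
def HNormLe (a b : ℝ) (m : ℕ) (u : ℝ → ℂ) (C : ℝ) : Prop :=
  ∃ g, WeakDerivs a b m u g ∧
    √(∑ j ∈ Finset.range (m + 1), ∫ x in a..b, ‖g j x‖ ^ 2) ≤ C

/-- `u ∈ H_s^m(a,b)`: `u ∈ H^m(a,b)` and the traces of `∂_x^{2k} u` vanish for `0 ≤ 2k < m`. -/
def MemHs (a b : ℝ) (m : ℕ) (u : ℝ → ℂ) : Prop :=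
  ∃ g, WeakDerivs a b m u g ∧ ∀ k : ℕ, 2 * k < m → g (2 * k) a = 0 ∧ g (2 * k) b = 0

/-- The frequencies `μ_l = π l / (b - a)`. -/
def mu (a b : ℝ) (l : ℕ) : ℝ := Real.pi * l / (b - a)

/-- The sine coefficients of a function on `(a,b)`. -/
def sineCoeff (a b : ℝ) (u : ℝ → ℂ) (l : ℕ) : ℂ :=
  (2 / (b - a) : ℝ) * ∫ x in a..b, u x * (Real.sin (mu a b l * (x - a)) : ℂ)

/-- The norm of `H_s^m(a,b)`; the sum runs over the frequencies `l + 1 = 1, 2, …`. -/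
def hsNorm (a b : ℝ) (m : ℕ) (u : ℝ → ℂ) : ℝ :=
  √(∑' l : ℕ, mu a b (l + 1) ^ (2 * m) * ‖sineCoeff a b u (l + 1)‖ ^ 2)

/-! ### The equations.  Space-time functions are written `u t x`. -/

/-- `v` is the (weak) time derivative of `u` on `[0,T]`.  It is used for functions `v` with values
in `H^1(a,b)`, where point evaluation commutes with the integral in time. -/
def IsTimeDeriv (a b T : ℝ) (u v : ℝ → ℝ → ℂ) : Prop :=
  ∀ x ∈ Icc a b, IntervalIntegrable (fun s => v s x) volume 0 T ∧
    ∀ t ∈ Icc 0 T, u t x = u 0 x + ∫ s in (0 : ℝ)..t, v s x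

/-- The nonlinearity `f(|z|²) z`. -/
def nonlin (f : ℝ → ℝ) (z : ℂ) : ℂ := (f (‖z‖ ^ 2) : ℂ) * z

/-- `u`, with time derivatives `ut` and `utt`, solves on `[0,T]` the equation
`i u_t - ε² u_tt + u_xx + f(|u|²) u = 0` in `(a,b)` with homogeneous Dirichlet conditions and
initial data `u(0) = u₀`, `u_t(0) = u₁`. -/
structure IsNLSWSolution (f : ℝ → ℝ) (a b T ε : ℝ) (u₀ u₁ : ℝ → ℂ) (u ut utt : ℝ → ℝ → ℂ) :
    Prop where
  deriv_one : IsTimeDeriv a b T u ut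
  deriv_two : IsTimeDeriv a b T ut utt
  equation : ∀ᵐ t ∂(volume.restrict (Ioo 0 T)), ∃ g, WeakDerivs a b 2 (u t) g ∧
    ∀ᵐ x ∂(volume.restrict (Ioo a b)),
      Complex.I * ut t x - (ε : ℂ) ^ 2 * utt t x + g 2 x + nonlin f (u t x) = 0
  initial_value : ∀ x ∈ Ioo a b, u 0 x = u₀ x
  initial_velocity : ∀ x ∈ Ioo a b, ut 0 x = u₁ x
  dirichlet : ∀ t ∈ Icc 0 T, u t a = 0 ∧ u t b = 0

/-- `u`, with time derivatives `ut` and `utt`, solves on `[0,T]` the equation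
`i u_t + u_xx + f(|u|²) u = 0` in `(a,b)` with homogeneous Dirichlet conditions and `u(0) = u₀`. -/
structure IsNLSSolution (f : ℝ → ℝ) (a b T : ℝ) (u₀ : ℝ → ℂ) (u ut utt : ℝ → ℝ → ℂ) :
    Prop where
  deriv_one : IsTimeDeriv a b T u ut
  deriv_two : IsTimeDeriv a b T ut utt
  equation : ∀ᵐ t ∂(volume.restrict (Ioo 0 T)), ∃ g, WeakDerivs a b 2 (u t) g ∧
    ∀ᵐ x ∂(volume.restrict (Ioo a b)),
      Complex.I * ut t x + g 2 x + nonlin f (u t x) = 0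
  initial_value : ∀ x ∈ Ioo a b, u 0 x = u₀ x
  dirichlet : ∀ t ∈ Icc 0 T, u t a = 0 ∧ u t b = 0

/-- The initial velocity `ψ₁^ε = i (∂_xx ψ₀ + f(|ψ₀|²) ψ₀) + ε^α ω^ε`, used at points of the open
interval `(a,b)`. -/
def initialVelocity (f : ℝ → ℝ) (α : ℝ) (ψ₀ : ℝ → ℂ) (ω : ℝ → ℝ → ℂ) (ε x : ℝ) : ℂ :=
  Complex.I * (iteratedDeriv 2 ψ₀ x + nonlin f (ψ₀ x)) + ((ε ^ α : ℝ) : ℂ) * ω ε x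

/-- Assumption (A), on the initial data. -/
structure AssumptionA (a b : ℝ) (m₀ : ℕ) (ψ₀ : ℝ → ℂ) (ω : ℝ → ℝ → ℂ) : Prop where
  value : MemHs a b (m₀ + 2) ψ₀
  perturbation : ∃ c C : ℝ, 0 < c ∧ ∀ ε ∈ Ioc (0 : ℝ) 1,
    MemHs a b m₀ (ω ε) ∧ c ≤ hsNorm a b m₀ (ω ε) ∧ hsNorm a b m₀ (ω ε) ≤ C

/-- Assumption (B), on the solutions `ψ ε` and `ψs` and on their time derivatives.  A function with
a time derivative in `L^∞([0,T];H^1)` is continuous in time with values in `H^1`, so its bounds hold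
at every time; those of the second time derivatives hold at almost every time. -/
structure AssumptionB (a b T α : ℝ) (m₀ : ℕ) (ψ ψt ψtt : ℝ → ℝ → ℝ → ℂ)
    (ψs ψst ψstt : ℝ → ℝ → ℂ) : Prop where
  wave : ∃ C : ℝ, ∀ ε ∈ Ioc (0 : ℝ) 1, ∀ t ∈ Icc 0 T,
    (∀ x ∈ Icc a b, ‖ψ ε t x‖ ≤ C) ∧ HNormLe a b m₀ (ψ ε t) C ∧
    (ψ ε t a = 0 ∧ ψ ε t b = 0) ∧ HNormLe a b 1 (ψt ε t) C
  wave_tt : ∃ C : ℝ, ∀ ε ∈ Ioc (0 : ℝ) 1, ∀ᵐ t ∂(volume.restrict (Icc 0 T)),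
    HNormLe a b 1 (ψtt ε t) (C / ε ^ (2 - min α 2))
  limit : ∃ C : ℝ, ∀ t ∈ Icc 0 T,
    (∀ x ∈ Icc a b, ‖ψs t x‖ ≤ C) ∧ HNormLe a b m₀ (ψs t) C ∧
    (ψs t a = 0 ∧ ψs t b = 0) ∧ HNormLe a b 1 (ψst t) C
  limit_tt : ∃ C : ℝ, ∀ᵐ t ∂(volume.restrict (Icc 0 T)), HNormLe a b 1 (ψstt t) C
  difference : ∃ C : ℝ, ∀ ε ∈ Ioc (0 : ℝ) 1, ∀ t ∈ Icc 0 T,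
    HNormLe a b 1 (fun x => ψ ε t x - ψs t x) (C * ε ^ 2)

/-- The norm of `L^∞([0,T] × (a,b))`, for continuous functions. -/
def supNorm (a b T : ℝ) (u : ℝ → ℝ → ℂ) : ℝ :=
  sSup ((fun p : ℝ × ℝ => ‖u p.1 p.2‖) '' (Icc 0 T ×ˢ Ioo a b))

/-- The constant `M₁ = max {sup_ε ‖ψ^ε‖_{L^∞}, ‖ψ^s‖_{L^∞}}`. -/
def M₁ (a b T : ℝ) (ψ : ℝ → ℝ → ℝ → ℂ) (ψs : ℝ → ℝ → ℂ) : ℝ :=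
  max (⨆ ε : Ioc (0 : ℝ) 1, supNorm a b T (ψ ε)) (supNorm a b T ψs)

/-! ### The numerical method.  Grid vectors are `v : ℕ → ℂ`, with the entries `v 0, …, v M`. -/

/-- The grid points `x_j = a + j (b - a) / M`. -/
def grid (a b : ℝ) (M j : ℕ) : ℝ := a + j * ((b - a) / M)

/-- The value `sin (j l π / M)`. -/
def gridSin (M j l : ℕ) : ℂ := (Real.sin (j * l * Real.pi / M) : ℂ)

/-- The discrete sine coefficients of a grid vector. -/
def dst (M : ℕ) (v : ℕ → ℂ) (l : ℕ) : ℂ :=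
  (2 / M : ℂ) * ∑ j ∈ Finset.Ioo 0 M, v j * gridSin M j l

/-- The sine interpolation operator `I_M`. -/
def interp (a b : ℝ) (M : ℕ) (v : ℕ → ℂ) (x : ℝ) : ℂ :=
  ∑ l ∈ Finset.Ioo 0 M, dst M v l * (Real.sin (mu a b l * (x - a)) : ℂ)

/-- The discrete maximum norm. -/
def linfNorm (M : ℕ) (v : ℕ → ℂ) : ℝ := ((Finset.Ioo 0 M).sup fun j => ‖v j‖₊ : NNReal)

/-- `e^{iθ}` -/
def cis (θ : ℝ) : ℂ := Complex.exp (Complex.I * θ)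

def betaPlus (a b ε : ℝ) (l : ℕ) : ℝ := (1 + √(1 + 4 * ε ^ 2 * mu a b l ^ 2)) / (2 * ε ^ 2)

def betaMinus (a b ε : ℝ) (l : ℕ) : ℝ := (1 - √(1 + 4 * ε ^ 2 * mu a b l ^ 2)) / (2 * ε ^ 2)

def delta (a b ε : ℝ) (l : ℕ) : ℝ := betaPlus a b ε l - betaMinus a b ε l

/-- `e^{iτβ/2} sinc(τβ/2)`, which is `σ_l^±(τ)` for `β = β_l^±`. -/
def sigma (τ β : ℝ) : ℂ := cis (τ * β / 2) * (Real.sinc (τ * β / 2) : ℂ)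

def coefC0 (a b ε τ : ℝ) (l : ℕ) : ℂ :=
  (betaPlus a b ε l * cis (τ * betaMinus a b ε l) - betaMinus a b ε l * cis (τ * betaPlus a b ε l))
    / delta a b ε l

/-- The coefficient of the initial velocity, `-i (e^{iτβ⁺} - e^{iτβ⁻}) / (β⁺ - β⁻)`, written as
`τ e^{iτ/(2ε²)} sinc(τ(β⁺ - β⁻)/2)`. -/
def coefD0 (a b ε τ : ℝ) (l : ℕ) : ℂ :=
  τ * cis (τ / (2 * ε ^ 2)) * (Real.sinc (τ * delta a b ε l / 2) : ℂ)

def coefC (ε τ : ℝ) : ℂ := -cis (τ / ε ^ 2)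

def coefD (a b ε τ : ℝ) (l : ℕ) : ℂ :=
  2 * cis (τ / (2 * ε ^ 2)) * (Real.cos (τ * delta a b ε l / 2) : ℂ)

def coefP (a b ε τ : ℝ) (l : ℕ) : ℂ :=
  -Complex.I * τ / (ε ^ 2 * delta a b ε l) *
    (sigma τ (betaPlus a b ε l) - sigma τ (betaMinus a b ε l))

def coefQ (a b ε τ : ℝ) (l : ℕ) : ℂ :=
  τ / (ε ^ 2 * delta a b ε l) *
    ((1 - sigma τ (betaPlus a b ε l)) / betaPlus a b ε l
      - (1 - sigma τ (betaMinus a b ε l)) / betaMinus a b ε l)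

def coefPStar (a b ε τ : ℝ) (l : ℕ) : ℂ :=
  -Complex.I * τ * cis (τ / ε ^ 2) / (ε ^ 2 * delta a b ε l) *
    (conj (sigma τ (betaPlus a b ε l)) - conj (sigma τ (betaMinus a b ε l)))

def coefQStar (a b ε τ : ℝ) (l : ℕ) : ℂ :=
  τ * cis (τ / ε ^ 2) / (ε ^ 2 * delta a b ε l) *
    ((1 - sigma τ (betaPlus a b ε l)) / (cis (τ * betaPlus a b ε l) * betaPlus a b ε l)
      - (1 - sigma τ (betaMinus a b ε l)) / (cis (τ * betaMinus a b ε l) * betaMinus a b ε l))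

/-- `G(z) = f(|z|²) + f'(|z|²) |z|²` -/
def nonlinG (f : ℝ → ℝ) (z : ℂ) : ℂ :=
  ((f (‖z‖ ^ 2) + derivWithin f (Ici 0) (‖z‖ ^ 2) * ‖z‖ ^ 2 : ℝ) : ℂ)

/-- `H(z) = f'(|z|²) z²` -/
def nonlinH (f : ℝ → ℝ) (z : ℂ) : ℂ := ((derivWithin f (Ici 0) (‖z‖ ^ 2) : ℝ) : ℂ) * z ^ 2

/-- The approximation of the time derivative of the nonlinearity at time `n τ`: exact at `n = 0`,
a backward difference quotient for `n ≥ 1`.  Here `v₁` holds the grid values of the initial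
velocity and `Ψ n` is the numerical solution at time `n τ`. -/
def nonlinDt (f : ℝ → ℝ) (τ : ℝ) (v₁ : ℕ → ℂ) (Ψ : ℕ → ℕ → ℂ) : ℕ → ℕ → ℂ
  | 0, j => nonlinG f (Ψ 0 j) * v₁ j + nonlinH f (Ψ 0 j) * conj (v₁ j)
  | n + 1, j => (nonlin f (Ψ (n + 1) j) - nonlin f (Ψ n j)) / τ

/-- The vectors `Ψ 0, Ψ 1, …` are computed by the exponential wave integrator sine pseudospectral
method with `M` subintervals and time step `τ` from the initial data `u₀`, `u₁`. -/
structure IsEWISP (f : ℝ → ℝ) (a b ε τ : ℝ) (M : ℕ) (u₀ u₁ : ℝ → ℂ) (Ψ : ℕ → ℕ → ℂ) :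
    Prop where
  boundary : ∀ n, Ψ n 0 = 0 ∧ Ψ n M = 0
  initial : ∀ j ∈ Finset.Ioo 0 M, Ψ 0 j = u₀ (grid a b M j)
  first : ∀ j ∈ Finset.Ioo 0 M, Ψ 1 j = ∑ l ∈ Finset.Ioo 0 M,
    (coefC0 a b ε τ l * dst M (Ψ 0) l
      + coefD0 a b ε τ l * dst M (fun i => u₁ (grid a b M i)) l
      + coefP a b ε τ l * dst M (fun i => nonlin f (Ψ 0 i)) l
      + coefQ a b ε τ l * dst M (nonlinDt f τ (fun i => u₁ (grid a b M i)) Ψ 0) l)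
      * gridSin M j l
  step : ∀ n, 1 ≤ n → ∀ j ∈ Finset.Ioo 0 M, Ψ (n + 1) j = ∑ l ∈ Finset.Ioo 0 M,
    (coefC ε τ * dst M (Ψ (n - 1)) l
      + coefD a b ε τ l * dst M (Ψ n) l
      + coefP a b ε τ l * dst M (fun i => nonlin f (Ψ n i)) l
      + coefQ a b ε τ l * dst M (nonlinDt f τ (fun i => u₁ (grid a b M i)) Ψ n) l
      - coefPStar a b ε τ l * dst M (fun i => nonlin f (Ψ (n - 1) i)) l
      - coefQStar a b ε τ l * dst M (nonlinDt f τ (fun i => u₁ (grid a b M i)) Ψ (n - 1)) l)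
      * gridSin M j l

/-- The norm of `L²(a,b)`, with values in `[0,∞]`. -/
def l2Norm (a b : ℝ) (u : ℝ → ℂ) : ENNReal := eLpNorm u 2 (volume.restrict (Ioo a b))

end NLSW

end

/-! In the sine mode of frequency μ the equation reads ε²û'' − iû' + μ²û = F̂, where F̂ is the
coefficient of f(|u|²)u. The operator factors as ε²(∂ₜ − iβ⁺)(∂ₜ − iβ⁻), so the two quantities ε²(û'
− iβ^∓ û) solve first order equations z' = iβ^± z + F̂. Their propagators have modulus one, no
negative power of ε multiplies F̂, and û is their difference divided by iε²δ up to sign, where ε²δ =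
√(1 + 4ε²μ²) ≥ 1. The linear part therefore amplifies nothing, uniformly in ε, although β⁺ is at
least of size ε⁻².

The three-term scheme is the same difference of two one-step recursions, which replace F̂ at time tₙ
+ s by F̂ₙ + s D̂ₙ and integrate this against the propagator exactly (`IsEWISP.mul_dst_eq`). Hence
the error in each mode obeys Eₙ₊₁ = e^{iτβ} Eₙ + ∫ e^{i(τ−s)β} (defect) ds, and it remains to bound
the defect in L² and H¹ (`exists_sum_defect_le`). It has three sources. The aliasing of sine
interpolation is O(h^{m−e}) in H^e for e = 0, 1. The Taylor remainder of F(u) in time is O(τ²),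
because α ≥ 2 bounds u_tt in H¹ uniformly in ε. The errors at the two latest time levels enter
through the local Lipschitz continuity of F; in the discrete H¹ norm this rests on a mixed
difference estimate that needs small increments of the exact solution only
(`exists_mixed_difference`). A discrete Gronwall argument closes the estimate
(`exists_modeEnergy_le`).

The Lipschitz constants presuppose a maximum bound for the numerical solution. The scheme is
explicit, so the H¹ estimate at step n uses this bound at earlier steps only, and the discrete
Sobolev inequality then gives it at step n once h and τ are small (`exists_stability`).

The spatial rate needs u(t) in H^m_s with uniform constants, whereas (B) offers H^m and the
Dirichlet condition. The other traces vanish by a bootstrap: if u(t) is in H^n_s at all times then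
so is F(u(t)), Duhamel's formula together with ε²δ ≥ 2εμ gives μ^{n+1}|û| → 0 for each fixed ε, and
such decay forces the traces required by H^{n+1}_s to vanish (`HS.of_tendsto`). The rate of decay
degenerates with ε, but only the vanishing of the traces is drawn from it; the constants come from
the H^m norm (`IsRegularWave.hs_of_hNormLe`). -/

noncomputable section

namespace NLSW

/-! ### Absolutely continuous functions as primitives -/

/-- `u` is on `[a,b]` a primitive of the integrable function `v`. -/
def IsPrim {E : Type*} [NormedAddCommGroup E] [NormedSpace ℝ E] (a b : ℝ) (u v : ℝ → E) : Prop :=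
  IntervalIntegrable v volume a b ∧ ∀ x ∈ Icc a b, u x = u a + ∫ y in a..x, v y

section Prim

variable {E : Type*} [NormedAddCommGroup E] [NormedSpace ℝ E]

theorem absolutelyContinuousOnInterval_of_dist_le {X Y : Type*} [PseudoMetricSpace X]
    [PseudoMetricSpace Y] {u : ℝ → X} {g : ℝ → Y} {a b K : ℝ}
    (hg : AbsolutelyContinuousOnInterval g a b)
    (h : ∀ x ∈ uIcc a b, ∀ y ∈ uIcc a b, dist (u x) (u y) ≤ K * dist (g x) (g y)) :
    AbsolutelyContinuousOnInterval u a b := by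
  unfold AbsolutelyContinuousOnInterval at hg ⊢
  have hK := hg.const_mul K
  rw [mul_zero] at hK
  refine squeeze_zero' (Filter.Eventually.of_forall fun E =>
    Finset.sum_nonneg fun i _ => dist_nonneg) ?_ hK
  refine Filter.eventually_inf_principal.2 (Filter.Eventually.of_forall fun E hE => ?_)
  rw [Finset.mul_sum]
  refine Finset.sum_le_sum fun i hi => ?_
  have := hE.1 i hi
  exact h _ this.1 _ this.2

theorem IsPrim.integrable_sub {a b : ℝ} {u v : ℝ → E} (h : IsPrim a b u v) {x y : ℝ}
    (hx : x ∈ Icc a b) (hy : y ∈ Icc a b) : IntervalIntegrable v volume x y := by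
  have hab : a ≤ b := hx.1.trans hx.2
  refine h.1.mono_set ?_
  rw [uIcc_of_le hab]
  exact ordConnected_Icc.uIcc_subset hx hy

theorem IsPrim.sub_eq {a b : ℝ} {u v : ℝ → E} (h : IsPrim a b u v) {x y : ℝ}
    (hx : x ∈ Icc a b) (hy : y ∈ Icc a b) : u y - u x = ∫ s in x..y, v s := by
  have ha : a ∈ Icc a b := ⟨le_rfl, hx.1.trans hx.2⟩
  rw [h.2 x hx, h.2 y hy, add_sub_add_left_eq_sub,
    intervalIntegral.integral_interval_sub_left (h.integrable_sub ha hy) (h.integrable_sub ha hx)]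

theorem IsPrim.mono {a b c d : ℝ} {u v : ℝ → E} (h : IsPrim a b u v) (hc : c ∈ Icc a b)
    (hd : d ∈ Icc a b) (_hcd : c ≤ d) : IsPrim c d u v := by
  refine ⟨h.integrable_sub hc hd, fun x hx => ?_⟩
  rw [← h.sub_eq hc ⟨hc.1.trans hx.1, hx.2.trans hd.2⟩]
  abel

theorem IsPrim.absolutelyContinuous {a b : ℝ} (hab : a ≤ b) {u v : ℝ → E} (h : IsPrim a b u v) :
    AbsolutelyContinuousOnInterval u a b := by
  have h1 : IntervalIntegrable (fun x => ‖v x‖) volume a b := h.1.norm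
  have h2 := h1.absolutelyContinuousOnInterval_intervalIntegral (c := a) left_mem_uIcc
  have ha : a ∈ Icc a b := ⟨le_rfl, hab⟩
  refine absolutelyContinuousOnInterval_of_dist_le (K := 1) h2 fun x hx y hy => ?_
  rw [uIcc_of_le hab] at hx hy
  rw [one_mul, dist_comm, dist_eq_norm, h.sub_eq hx hy, dist_comm, Real.dist_eq,
    intervalIntegral.integral_interval_sub_left (h.integrable_sub ha hy).norm
      (h.integrable_sub ha hx).norm]
  exact intervalIntegral.norm_integral_le_abs_integral_norm

theorem IsPrim.continuousOn {a b : ℝ} (hab : a ≤ b) {u v : ℝ → E} (h : IsPrim a b u v) :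
    ContinuousOn u (Icc a b) := by
  have := (h.absolutelyContinuous hab).continuousOn
  rwa [uIcc_of_le hab] at this

theorem IsPrim.hasDerivAt_of_continuousAt [CompleteSpace E] {a b x : ℝ} {u v : ℝ → E}
    (h : IsPrim a b u v) (hx : x ∈ Ioo a b) (hv : ContinuousOn v (Icc a b)) :
    HasDerivAt u (v x) x := by
  have hxI : Icc a b ∈ nhds x := Icc_mem_nhds hx.1 hx.2
  have ha : a ∈ Icc a b := ⟨le_rfl, (hx.1.trans hx.2).le⟩
  have h1 : HasDerivAt (fun z => u a + ∫ y in a..z, v y) (v x) x := by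
    refine HasDerivAt.const_add _ (intervalIntegral.integral_hasDerivAt_right
      (h.integrable_sub ha ⟨hx.1.le, hx.2.le⟩) ?_ (hv.continuousAt hxI))
    exact (hv.mono Ioo_subset_Icc_self).stronglyMeasurableAtFilter isOpen_Ioo x hx
  refine h1.congr_of_eventuallyEq ?_
  filter_upwards [hxI] with z hz using h.2 z hz

theorem IsPrim.ae_hasDerivAt [CompleteSpace E] {a b : ℝ} {u v : ℝ → E}
    (h : IsPrim a b u v) : ∀ᵐ x, x ∈ Ioo a b → HasDerivAt u (v x) x := by
  filter_upwards [h.1.ae_hasDerivAt_integral] with x hx hxI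
  have hab := (hxI.1.trans hxI.2).le
  rw [uIcc_of_le hab] at hx
  have h1 := (hx ⟨hxI.1.le, hxI.2.le⟩ a ⟨le_rfl, hab⟩).const_add (u a)
  refine h1.congr_of_eventuallyEq ?_
  filter_upwards [Icc_mem_nhds hxI.1 hxI.2] with z hz using h.2 z hz

theorem isPrim_integral {a b : ℝ} {v : ℝ → E} (hv : IntervalIntegrable v volume a b) (c : E) :
    IsPrim a b (fun x => c + ∫ y in a..x, v y) v :=
  ⟨hv, fun x _ => by simp⟩

theorem IsPrim.congr {a b : ℝ} (hab : a ≤ b) {u u' v v' : ℝ → E} (h : IsPrim a b u v)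
    (hu : EqOn u u' (Icc a b)) (hv : ∀ᵐ x ∂volume.restrict (Ioo a b), v x = v' x) :
    IsPrim a b u' v' := by
  have h' : ∀ᵐ x ∂volume.restrict (uIoc a b), v x = v' x := by
    rwa [uIoc_of_le hab, restrict_Ioo_eq_restrict_Ioc.symm]
  refine ⟨h.1.congr_ae h', fun x hx => ?_⟩
  rw [← hu hx, ← hu ⟨le_rfl, hab⟩, h.2 x hx]
  congr 1
  refine intervalIntegral.integral_congr_ae_restrict ?_
  refine ae_restrict_of_ae_restrict_of_subset ?_ h'
  rw [uIoc_of_le hx.1, uIoc_of_le hab]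
  exact Ioc_subset_Ioc_right hx.2

/-- The difference of `u` and the integral of `v` is absolutely continuous with derivative zero
almost everywhere, hence constant. Product and chain rules thereby reduce to computing derivatives
almost everywhere. -/
theorem isPrim_of_absolutelyContinuous [CompleteSpace E] {a b : ℝ} (hab : a ≤ b) {u v : ℝ → E}
    (hu : AbsolutelyContinuousOnInterval u a b) (hv : IntervalIntegrable v volume a b)
    (hd : ∀ᵐ x, x ∈ Ioo a b → HasDerivAt u (v x) x) : IsPrim a b u v := by
  have hp := isPrim_integral hv 0
  have hac := hu.sub (hp.absolutelyContinuous hab)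
  have h0 : ∀ᵐ x, x ∈ uIcc a b → HasDerivAt (u - fun x => 0 + ∫ y in a..x, v y) 0 x := by
    -- The derivative is known on the open interval, while the constancy criterion asks for the
    -- closed one; the end points are null sets.
    have hna : ∀ᵐ x : ℝ, x ≠ a := by simp [ae_iff, measure_singleton]
    have hnb : ∀ᵐ x : ℝ, x ≠ b := by simp [ae_iff, measure_singleton]
    filter_upwards [hd, hp.ae_hasDerivAt, hna, hnb] with x h1 h2 h3 h4 hx
    rw [uIcc_of_le hab] at hx
    have hx' : x ∈ Ioo a b := ⟨lt_of_le_of_ne hx.1 (Ne.symm h3), lt_of_le_of_ne hx.2 h4⟩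
    simpa using (h1 hx').sub (h2 hx')
  obtain ⟨C, hC⟩ := hac.const_of_ae_hasDerivAt_zero h0
  rw [uIcc_of_le hab] at hC
  refine ⟨hv, fun x hx => ?_⟩
  have h1 := hC x hx
  have h2 := hC a ⟨le_rfl, hab⟩
  simp only [Pi.sub_apply, zero_add, intervalIntegral.integral_same, sub_zero] at h1 h2
  rw [h2, ← h1]; abel

theorem IsPrim.add {a b : ℝ} {u v u' v' : ℝ → E} (h : IsPrim a b u u')
    (h' : IsPrim a b v v') : IsPrim a b (fun x => u x + v x) (fun x => u' x + v' x) := by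
  refine ⟨h.1.add h'.1, fun x hx => ?_⟩
  have ha : a ∈ Icc a b := ⟨le_rfl, hx.1.trans hx.2⟩
  beta_reduce
  rw [intervalIntegral.integral_add (h.integrable_sub ha hx) (h'.integrable_sub ha hx), h.2 x hx,
    h'.2 x hx]
  abel

theorem IsPrim.const_mul {a b : ℝ} {u u' : ℝ → ℂ} (h : IsPrim a b u u') (c : ℂ) :
    IsPrim a b (fun x => c * u x) (fun x => c * u' x) := by
  refine ⟨h.1.const_mul c, fun x hx => ?_⟩
  beta_reduce
  rw [intervalIntegral.integral_const_mul, h.2 x hx, mul_add]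

theorem IsPrim.conj {a b : ℝ} {u u' : ℝ → ℂ} (h : IsPrim a b u u') :
    IsPrim a b (fun x => conj (u x)) (fun x => conj (u' x)) := by
  refine ⟨⟨Complex.conjLIE.toContinuousLinearEquiv.toContinuousLinearMap.integrable_comp h.1.1,
    Complex.conjLIE.toContinuousLinearEquiv.toContinuousLinearMap.integrable_comp h.1.2⟩,
    fun x hx => ?_⟩
  beta_reduce
  rw [intervalIntegral.intervalIntegral_conj, h.2 x hx, map_add]

theorem IsPrim.mul {a b : ℝ} (hab : a ≤ b) {u v u' v' : ℝ → ℂ} (h : IsPrim a b u u')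
    (h' : IsPrim a b v v') :
    IsPrim a b (fun x => u x * v x) (fun x => u' x * v x + u x * v' x) := by
  have hcu := (h.absolutelyContinuous hab).continuousOn
  have hcv := (h'.absolutelyContinuous hab).continuousOn
  refine isPrim_of_absolutelyContinuous hab
    ((h.absolutelyContinuous hab).smul (h'.absolutelyContinuous hab))
    ((h.1.mul_continuousOn hcv).add (h'.1.continuousOn_mul hcu)) ?_
  filter_upwards [h.ae_hasDerivAt, h'.ae_hasDerivAt] with x h1 h2 hx
  exact (h1 hx).mul (h2 hx)

/-- At 0 the function `f` is differentiable from one side only. Since `r` never leaves [0,∞), the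
derivative within that half line still obeys the chain rule where `r` vanishes. As the derivative of
a real curve, `v` is real almost everywhere. -/
theorem IsPrim.comp_real {a b : ℝ} (hab : a ≤ b) {f : ℝ → ℝ} (hf : ContDiffOn ℝ 1 f (Ici 0))
    {r : ℝ → ℝ} (hr : ∀ x, 0 ≤ r x) {v : ℝ → ℂ} (h : IsPrim a b (fun x => (r x : ℂ)) v) :
    IsPrim a b (fun x => (f (r x) : ℂ)) (fun x => ((derivWithin f (Ici 0) (r x) : ℝ) : ℂ) * v x) := by
  have hac := h.absolutelyContinuous hab
  have hcr : ContinuousOn r (Icc a b) := by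
    have h1 : ContinuousOn (fun x => (r x : ℂ)) (Icc a b) := h.continuousOn hab
    exact Complex.continuous_re.comp_continuousOn h1
  obtain ⟨R, hR⟩ := isCompact_Icc.exists_bound_of_continuousOn hcr
  have hrI : ∀ x ∈ Icc a b, r x ∈ Icc 0 R := fun x hx => ⟨hr x, (le_abs_self _).trans (hR x hx)⟩
  obtain ⟨K, hK⟩ := (hf.mono (fun x hx => hx.1 : Icc 0 R ⊆ Ici 0)).exists_lipschitzOnWith
    (by decide) (convex_Icc _ _) isCompact_Icc
  have hcd : ContinuousOn (fun x => derivWithin f (Ici 0) (r x)) (Icc a b) :=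
    (hf.continuousOn_derivWithin (uniqueDiffOn_Ici 0) le_rfl).comp hcr fun x _ => hr x
  refine isPrim_of_absolutelyContinuous hab ?_ ?_ ?_
  · refine absolutelyContinuousOnInterval_of_dist_le (K := K) hac fun x hx y hy => ?_
    rw [uIcc_of_le hab] at hx hy
    have := hK.dist_le_mul _ (hrI x hx) _ (hrI y hy)
    simpa [dist_eq_norm, ← Complex.ofReal_sub, -Complex.coe_algebraMap] using this
  · refine h.1.continuousOn_mul ?_
    rw [uIcc_of_le hab]
    exact Complex.continuous_ofReal.comp_continuousOn hcd
  · filter_upwards [h.ae_hasDerivAt] with x hx hxI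
    have h1 := hx hxI
    have h2 : HasDerivAt r (v x).re x := Complex.reCLM.hasFDerivAt.comp_hasDerivAt x h1
    have h3 : v x = ((v x).re : ℂ) := h1.unique h2.ofReal_comp
    have h4 : HasDerivWithinAt f (derivWithin f (Ici 0) (r x)) (Ici 0) (r x) :=
      (hf.differentiableOn (by decide) _ (hr x)).hasDerivWithinAt
    have h5 : HasDerivAt (fun x => f (r x)) (derivWithin f (Ici 0) (r x) * (v x).re) x := by
      rw [mul_comm]
      exact h4.scomp_hasDerivAt_of_eq x h2 (fun y => hr y) rfl
    rw [h3]
    simpa using h5.ofReal_comp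

end Prim

/-- The Cauchy–Schwarz inequality for the integral over an interval. -/
theorem sq_integral_le {a b : ℝ} (hab : a ≤ b) {g : ℝ → ℝ} (hg : IntervalIntegrable g volume a b)
    (hg2 : IntervalIntegrable (fun x => g x ^ 2) volume a b) :
    (∫ x in a..b, g x) ^ 2 ≤ (b - a) * ∫ x in a..b, g x ^ 2 := by
  rcases hab.eq_or_lt with rfl | hab'
  · simp
  -- The mean value of `g`; the inequality is the nonnegativity of ∫ (g − c)².
  set c := (∫ x in a..b, g x) / (b - a) with hc
  have hL : 0 < b - a := by linarith
  have h0 : 0 ≤ ∫ x in a..b, (g x - c) ^ 2 :=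
    intervalIntegral.integral_nonneg hab fun x _ => sq_nonneg _
  have h1 : ∫ x in a..b, (g x - c) ^ 2
      = (∫ x in a..b, g x ^ 2) - 2 * c * (∫ x in a..b, g x) + (b - a) * c ^ 2 := by
    rw [← intervalIntegral.integral_const_mul, ← intervalIntegral.integral_sub hg2
      (hg.const_mul _), ← smul_eq_mul (b - a), ← intervalIntegral.integral_const,
      ← intervalIntegral.integral_add (hg2.sub (hg.const_mul _)) (by simp)]
    congr 1; ext x; ring
  have h2 : (∫ x in a..b, g x) = c * (b - a) := by rw [hc]; field_simp
  rw [h1, h2] at h0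
  rw [h2]
  nlinarith

theorem norm_sq_integral_le {E : Type*} [NormedAddCommGroup E] [NormedSpace ℝ E]
    {a b : ℝ} (hab : a ≤ b) {g : ℝ → E}
    (hg : IntervalIntegrable g volume a b)
    (hg2 : IntervalIntegrable (fun x => ‖g x‖ ^ 2) volume a b) :
    ‖∫ x in a..b, g x‖ ^ 2 ≤ (b - a) * ∫ x in a..b, ‖g x‖ ^ 2 := by
  refine le_trans ?_ (sq_integral_le hab hg.norm hg2)
  gcongr
  exact intervalIntegral.norm_integral_le_integral_norm hab

theorem ae_eq_zero_of_forall_integral_eq_zero {T : ℝ} {v : ℝ → ℂ}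
    (hv : IntervalIntegrable v volume 0 T) (h : ∀ t ∈ Icc 0 T, ∫ s in (0 : ℝ)..t, v s = 0) :
    ∀ᵐ t ∂volume.restrict (Icc 0 T), v t = 0 := by
  rw [← restrict_Ioo_eq_restrict_Icc, ae_restrict_iff' measurableSet_Ioo]
  have hp : IsPrim 0 T (fun _ => (0 : ℂ)) v := ⟨hv, fun t ht => by simp [h t ht]⟩
  filter_upwards [hp.ae_hasDerivAt] with t ht htI
  exact (ht htI).unique (hasDerivAt_const t (0 : ℂ))

/-! ### Sobolev spaces with parity conditions at the end points -/

theorem intervalIntegrable_of_memLp {a b : ℝ} (hab : a ≤ b) {u : ℝ → ℂ}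
    (h : MemLp u 2 (volume.restrict (Ioo a b))) : IntervalIntegrable u volume a b := by
  rw [intervalIntegrable_iff_integrableOn_Ioo_of_le hab]
  exact h.integrable (by norm_num)

theorem intervalIntegrable_sq_of_memLp {a b : ℝ} (hab : a ≤ b) {u : ℝ → ℂ}
    (h : MemLp u 2 (volume.restrict (Ioo a b))) :
    IntervalIntegrable (fun x => ‖u x‖ ^ 2) volume a b := by
  rw [intervalIntegrable_iff_integrableOn_Ioo_of_le hab]
  exact h.integrable_norm_pow (by norm_num)

theorem memLp_of_continuousOn {a b : ℝ} {u : ℝ → ℂ} (h : ContinuousOn u (Icc a b)) :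
    MemLp u 2 (volume.restrict (Ioo a b)) := by
  obtain ⟨C, hC⟩ := isCompact_Icc.exists_bound_of_continuousOn h
  refine MemLp.of_bound ((h.mono Ioo_subset_Icc_self).aestronglyMeasurable measurableSet_Ioo) C ?_
  exact (ae_restrict_mem measurableSet_Ioo).mono fun x hx => hC x (Ioo_subset_Icc_self hx)

theorem integral_sq_le_of_bound {a b : ℝ} (hab : a ≤ b) {u : ℝ → ℂ} {C : ℝ}
    (h : ∀ x ∈ Icc a b, ‖u x‖ ≤ C) : ∫ x in a..b, ‖u x‖ ^ 2 ≤ C ^ 2 * (b - a) := by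
  have := intervalIntegral.norm_integral_le_of_norm_le_const (a := a) (b := b)
    (f := fun x => ‖u x‖ ^ 2) (C := C ^ 2) fun x hx => by
      rw [uIoc_of_le hab] at hx
      rw [norm_pow, norm_norm]
      gcongr
      exact h x (Ioc_subset_Icc_self hx)
  rw [abs_of_nonneg (by linarith)] at this
  exact (le_abs_self _).trans this

/-- The functions `u ∈ H^n(a,b)`, with derivatives of order `< n` bounded by `C` and derivative of
order `n` bounded by `C` in `L²`, such that the traces of the derivatives of even order `< n`
(for `s = true`), respectively of odd order `< n` (for `s = false`), vanish. -/
def HS (a b : ℝ) : ℕ → Bool → ℝ → (ℝ → ℂ) → Prop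
  | 0, _, C, u => 0 ≤ C ∧ MemLp u 2 (volume.restrict (Ioo a b)) ∧ ∫ x in a..b, ‖u x‖ ^ 2 ≤ C ^ 2
  | n + 1, s, C, u => (∀ x ∈ Icc a b, ‖u x‖ ≤ C) ∧ (s = true → u a = 0 ∧ u b = 0) ∧
      ∃ v, HS a b n (!s) C v ∧ IsPrim a b u v

section HS

variable {a b : ℝ}

theorem HS.nonneg (hab : a ≤ b) {n : ℕ} {s : Bool} {C : ℝ} {u : ℝ → ℂ} (h : HS a b n s C u) :
    0 ≤ C := by
  cases n with
  | zero => exact h.1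
  | succ n => exact (norm_nonneg _).trans (h.1 a ⟨le_rfl, hab⟩)

theorem HS.continuousOn (hab : a ≤ b) {n : ℕ} {s : Bool} {C : ℝ} {u : ℝ → ℂ}
    (h : HS a b (n + 1) s C u) : ContinuousOn u (Icc a b) := by
  obtain ⟨-, -, v, -, hp⟩ := h
  exact hp.continuousOn hab

theorem HS.memLp (hab : a ≤ b) {n : ℕ} {s : Bool} {C : ℝ} {u : ℝ → ℂ} (h : HS a b n s C u) :
    MemLp u 2 (volume.restrict (Ioo a b)) := by
  cases n with
  | zero => exact h.2.1
  | succ n => exact memLp_of_continuousOn (h.continuousOn hab)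

theorem HS.congr (hab : a ≤ b) {n : ℕ} {s : Bool} {C : ℝ} {u u' : ℝ → ℂ} (h : HS a b n s C u)
    (he : EqOn u u' (Icc a b)) : HS a b n s C u' := by
  cases n with
  | zero =>
    obtain ⟨h0, h1, h2⟩ := h
    have hae : u =ᵐ[volume.restrict (Ioo a b)] u' :=
      (ae_restrict_mem measurableSet_Ioo).mono fun x hx => he (Ioo_subset_Icc_self hx)
    refine ⟨h0, (memLp_congr_ae hae).1 h1, ?_⟩
    rwa [← intervalIntegral.integral_congr (f := fun x => ‖u x‖ ^ 2)]
    intro x hx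
    rw [uIcc_of_le hab] at hx
    simp [he hx]
  | succ n =>
    obtain ⟨h0, h1, v, h2, h3⟩ := h
    refine ⟨fun x hx => he hx ▸ h0 x hx, fun hs => ?_, v, h2, h3.congr hab he (by simp)⟩
    rw [← he ⟨le_rfl, hab⟩, ← he ⟨hab, le_rfl⟩]
    exact h1 hs

theorem HS.mono {n : ℕ} {s : Bool} {C C' : ℝ} {u : ℝ → ℂ} (h : HS a b n s C u)
    (hC : C ≤ C') : HS a b n s C' u := by
  induction n generalizing s u with
  | zero => exact ⟨h.1.trans hC, h.2.1, h.2.2.trans (pow_le_pow_left₀ h.1 hC 2)⟩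
  | succ n ih =>
    obtain ⟨h0, h1, v, h2, h3⟩ := h
    exact ⟨fun x hx => (h0 x hx).trans hC, h1, v, ih h2, h3⟩

/-- Passing from the maximum to the L² norm costs √(b − a), which 1 + (b − a) dominates. -/
theorem HS.zero_of_bound (hab : a ≤ b) (s : Bool) {C : ℝ} {u : ℝ → ℂ}
    (hu : ContinuousOn u (Icc a b)) (h : ∀ x ∈ Icc a b, ‖u x‖ ≤ C) :
    HS a b 0 s ((1 + (b - a)) * C) u := by
  have hC : 0 ≤ C := (norm_nonneg _).trans (h a ⟨le_rfl, hab⟩)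
  have hL : 0 ≤ b - a := by linarith
  refine ⟨by positivity, memLp_of_continuousOn hu, (integral_sq_le_of_bound hab h).trans ?_⟩
  rw [mul_pow, mul_comm]
  gcongr
  nlinarith

theorem HS.lower (hab : a ≤ b) {n : ℕ} {s : Bool} {C : ℝ} {u : ℝ → ℂ}
    (h : HS a b (n + 1) s C u) : HS a b n s ((1 + (b - a)) * C) u := by
  have hL : 0 ≤ b - a := by linarith
  have hC := h.nonneg hab
  have hCC : C ≤ (1 + (b - a)) * C := by nlinarith
  induction n generalizing s u with
  | zero => exact HS.zero_of_bound hab s (h.continuousOn hab) h.1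
  | succ n ih =>
    obtain ⟨h0, h1, v, h2, h3⟩ := h
    exact ⟨fun x hx => (h0 x hx).trans hCC, h1, v, ih h2, h3⟩

theorem HS.add (hab : a ≤ b) {n : ℕ} {s : Bool} {C C' : ℝ} {u v : ℝ → ℂ} (h : HS a b n s C u)
    (h' : HS a b n s C' v) : HS a b n s (2 * (C + C')) (fun x => u x + v x) := by
  have hC := h.nonneg hab
  have hC' := h'.nonneg hab
  induction n generalizing s u v with
  | zero =>
    refine ⟨by positivity, h.2.1.add h'.2.1, ?_⟩
    have i1 := intervalIntegrable_sq_of_memLp hab h.2.1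
    have i2 := intervalIntegrable_sq_of_memLp hab h'.2.1
    have i3 := intervalIntegrable_sq_of_memLp hab (h.2.1.add h'.2.1)
    have : ∫ x in a..b, ‖u x + v x‖ ^ 2 ≤ ∫ x in a..b, (2 * ‖u x‖ ^ 2 + 2 * ‖v x‖ ^ 2) := by
      refine intervalIntegral.integral_mono_on hab i3 ((i1.const_mul 2).add (i2.const_mul 2))
        fun x _ => ?_
      have := pow_le_pow_left₀ (norm_nonneg _) (norm_add_le (u x) (v x)) 2
      nlinarith [sq_nonneg (‖u x‖ - ‖v x‖)]
    refine this.trans ?_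
    rw [intervalIntegral.integral_add (i1.const_mul 2) (i2.const_mul 2),
      intervalIntegral.integral_const_mul, intervalIntegral.integral_const_mul]
    nlinarith [h.2.2, h'.2.2, mul_nonneg hC hC']
  | succ n ih =>
    obtain ⟨h0, h1, u', h2, h3⟩ := h
    obtain ⟨k0, k1, v', k2, k3⟩ := h'
    refine ⟨fun x hx => (norm_add_le _ _).trans ?_, fun hs => ?_, _, ih h2 k2, h3.add k3⟩
    · linarith [h0 x hx, k0 x hx]
    · simp [h1 hs, k1 hs]

theorem HS.const_mul {n : ℕ} {s : Bool} {C : ℝ} {u : ℝ → ℂ} (h : HS a b n s C u) (c : ℂ) :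
    HS a b n s (‖c‖ * C) (fun x => c * u x) := by
  induction n generalizing s u with
  | zero =>
    refine ⟨mul_nonneg (norm_nonneg _) h.1, h.2.1.const_mul c, ?_⟩
    simp only [norm_mul, mul_pow]
    rw [intervalIntegral.integral_const_mul]
    gcongr
    exact h.2.2
  | succ n ih =>
    obtain ⟨h0, h1, u', h2, h3⟩ := h
    refine ⟨fun x hx => ?_, fun hs => by simp [h1 hs], _, ih h2, h3.const_mul c⟩
    rw [norm_mul]
    gcongr
    exact h0 x hx

theorem HS.conj {n : ℕ} {s : Bool} {C : ℝ} {u : ℝ → ℂ} (h : HS a b n s C u) :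
    HS a b n s C (fun x => conj (u x)) := by
  induction n generalizing s u with
  | zero =>
    refine ⟨h.1, ?_, by simpa using h.2.2⟩
    exact h.2.1.star
  | succ n ih =>
    obtain ⟨h0, h1, u', h2, h3⟩ := h
    exact ⟨fun x hx => by simpa using h0 x hx, fun hs => by simp [h1 hs], _, ih h2, h3.conj⟩

theorem HS.mul_continuous (hab : a ≤ b) {s : Bool} (s' : Bool) {C C' : ℝ} {u v : ℝ → ℂ}
    (h : HS a b 0 s C u) (hv : ContinuousOn v (Icc a b)) (hC' : ∀ x ∈ Icc a b, ‖v x‖ ≤ C') :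
    HS a b 0 s' (C * C') (fun x => u x * v x) := by
  have h0 : 0 ≤ C' := (norm_nonneg _).trans (hC' a ⟨le_rfl, hab⟩)
  have hvm : AEStronglyMeasurable v (volume.restrict (Ioo a b)) :=
    (hv.mono Ioo_subset_Icc_self).aestronglyMeasurable measurableSet_Ioo
  have hm : MemLp (fun x => u x * v x) 2 (volume.restrict (Ioo a b)) := by
    refine MemLp.of_le (h.2.1.const_mul (C' : ℂ)) (h.2.1.1.mul hvm) ?_
    refine (ae_restrict_mem measurableSet_Ioo).mono fun x hx => ?_
    rw [norm_mul, norm_mul, mul_comm, Complex.norm_real, Real.norm_of_nonneg h0]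
    gcongr
    exact hC' x (Ioo_subset_Icc_self hx)
  refine ⟨mul_nonneg h.1 h0, hm, ?_⟩
  have i1 := intervalIntegrable_sq_of_memLp hab h.2.1
  calc ∫ x in a..b, ‖u x * v x‖ ^ 2 ≤ ∫ x in a..b, C' ^ 2 * ‖u x‖ ^ 2 := by
        refine intervalIntegral.integral_mono_on hab (intervalIntegrable_sq_of_memLp hab hm)
          (i1.const_mul _) fun x hx => ?_
        rw [norm_mul, mul_pow, mul_comm]
        gcongr
        exact hC' x hx
    _ ≤ (C * C') ^ 2 := by
        rw [intervalIntegral.integral_const_mul, mul_pow, mul_comm]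
        gcongr
        exact h.2.2

/-- Parities multiply as for odd (`true`) and even (`false`) reflections, and a derivative flips the
parity, so both terms of the Leibniz rule have the opposite of the product's parity and the
induction closes. In the base case the derivatives are only square integrable and are paired with
continuous factors. The constant depends on the data only through `C` and `C'`, as uniformity in ε
requires. -/
theorem HS.exists_mul (hab : a ≤ b) (n : ℕ) (C C' : ℝ) : ∃ K, ∀ (s s' : Bool) (u v : ℝ → ℂ),
    HS a b (n + 1) s C u → HS a b (n + 1) s' C' v →
      HS a b (n + 1) (s ^^ s') K (fun x => u x * v x) := by
  induction n generalizing C C' with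
  | zero =>
    refine ⟨max (C * C') (2 * (C * C' + C' * C)), fun s s' u v h h' => ?_⟩
    have hcu := h.continuousOn hab
    have hcv := h'.continuousOn hab
    have hC := h.nonneg hab
    obtain ⟨h0, h1, u', h2, h3⟩ := h
    obtain ⟨k0, k1, v', k2, k3⟩ := h'
    refine ⟨fun x hx => ?_, fun hs => ?_, _, HS.mono ?_ (le_max_right _ _), h3.mul hab k3⟩
    · rw [norm_mul]
      exact le_max_of_le_left (mul_le_mul (h0 x hx) (k0 x hx) (norm_nonneg _) hC)
    · cases s <;> cases s' <;> simp_all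
    · refine HS.add hab (h2.mul_continuous hab _ hcv k0) ?_
      simpa only [mul_comm] using k2.mul_continuous hab (!(s ^^ s')) hcu h0
  | succ n ih =>
    obtain ⟨K, hK⟩ := ih C ((1 + (b - a)) * C')
    obtain ⟨K', hK'⟩ := ih ((1 + (b - a)) * C) C'
    refine ⟨max (C * C') (2 * (K + K')), fun s s' u v h h' => ?_⟩
    have hl := h.lower hab
    have hl' := h'.lower hab
    have hC := h.nonneg hab
    obtain ⟨h0, h1, u', h2, h3⟩ := h
    obtain ⟨k0, k1, v', k2, k3⟩ := h'
    refine ⟨fun x hx => ?_, fun hs => ?_, _, HS.mono ?_ (le_max_right _ _), h3.mul hab k3⟩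
    · rw [norm_mul]
      exact le_max_of_le_left (mul_le_mul (h0 x hx) (k0 x hx) (norm_nonneg _) hC)
    · cases s <;> cases s' <;> simp_all
    · refine HS.add hab ?_ ?_
      · simpa using hK _ _ _ _ h2 hl'
      · simpa using hK' _ _ _ _ hl k2

theorem exists_bound_comp {g : ℝ → ℝ} (hg : ContinuousOn g (Ici 0)) (a b C : ℝ) :
    ∃ B, ∀ r : ℝ → ℝ, (∀ x, 0 ≤ r x) → (∀ x ∈ Icc a b, ‖(r x : ℂ)‖ ≤ C) →
      ∀ x ∈ Icc a b, ‖(g (r x) : ℂ)‖ ≤ B := by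
  obtain ⟨B, hB⟩ := isCompact_Icc.exists_bound_of_continuousOn
    (hg.mono (fun x hx => hx.1 : Icc 0 C ⊆ Ici 0))
  refine ⟨B, fun r hr h x hx => ?_⟩
  rw [Complex.norm_real]
  have := h x hx
  rw [Complex.norm_real, Real.norm_of_nonneg (hr x)] at this
  exact hB _ ⟨hr x, this⟩

/-- By the chain rule the derivative is f'(r) r', with f'(r) even by induction and r' odd. The
induction runs over all functions `f`, because f' takes the place of f with one derivative less. -/
theorem HS.exists_comp (hab : a ≤ b) (n : ℕ) (f : ℝ → ℝ)
    (hf : ContDiffOn ℝ (n + 1 : ℕ) f (Ici 0)) (C : ℝ) :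
    ∃ K, ∀ r : ℝ → ℝ, (∀ x, 0 ≤ r x) → HS a b (n + 1) false C (fun x => (r x : ℂ)) →
      HS a b (n + 1) false K (fun x => (f (r x) : ℂ)) := by
  obtain ⟨B, hB⟩ := exists_bound_comp hf.continuousOn a b C
  have hf1 : ContDiffOn ℝ 1 f (Ici 0) := hf.of_le (by exact_mod_cast Nat.le_add_left 1 n)
  have hcd := hf1.continuousOn_derivWithin (uniqueDiffOn_Ici 0) le_rfl
  induction n generalizing f C B with
  | zero =>
    obtain ⟨B', hB'⟩ := exists_bound_comp hcd a b C
    refine ⟨max B (C * B'), fun r hr h => ?_⟩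
    have hc : ContinuousOn r (Icc a b) :=
      Complex.continuous_re.comp_continuousOn (h.continuousOn hab)
    obtain ⟨h0, -, v, h2, h3⟩ := h
    refine ⟨fun x hx => le_max_of_le_left (hB r hr h0 x hx), by simp, _,
      HS.mono ?_ (le_max_right _ _), h3.comp_real hab hf1 hr⟩
    have := h2.mul_continuous hab (!false) (v := fun x => ((derivWithin f (Ici 0) (r x) : ℝ) : ℂ))
      (Complex.continuous_ofReal.comp_continuousOn (hcd.comp hc fun x _ => hr x)) (hB' r hr h0)
    simpa only [mul_comm] using this
  | succ n ih =>
    have hf' : ContDiffOn ℝ (n + 1 : ℕ) (derivWithin f (Ici 0)) (Ici 0) :=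
      hf.derivWithin (uniqueDiffOn_Ici 0) (by exact_mod_cast le_rfl)
    have hf'1 : ContDiffOn ℝ 1 (derivWithin f (Ici 0)) (Ici 0) :=
      hf'.of_le (by exact_mod_cast Nat.le_add_left 1 n)
    obtain ⟨B', hB'⟩ := exists_bound_comp hf'.continuousOn a b ((1 + (b - a)) * C)
    obtain ⟨K, hK⟩ := ih _ hf' _ B' hB' hf'1
      (hf'1.continuousOn_derivWithin (uniqueDiffOn_Ici 0) le_rfl)
    obtain ⟨K', hK'⟩ := HS.exists_mul hab n K C
    refine ⟨max B K', fun r hr h => ?_⟩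
    have hl := h.lower hab
    obtain ⟨h0, -, v, h2, h3⟩ := h
    refine ⟨fun x hx => le_max_of_le_left (hB r hr h0 x hx), by simp, _,
      HS.mono ?_ (le_max_right _ _), h3.comp_real hab hf1 hr⟩
    simpa using hK' _ _ _ _ (hK r hr hl) h2

/-- The nonlinearity acts on the spaces with vanishing traces of even order. -/
theorem HS.exists_nonlin (hab : a ≤ b) {n : ℕ} {f : ℝ → ℝ}
    (hf : ContDiffOn ℝ (n + 1 : ℕ) f (Ici 0)) (C : ℝ) :
    ∃ K, ∀ u : ℝ → ℂ, HS a b (n + 1) true C u →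
      HS a b (n + 1) true K (fun x => nonlin f (u x)) := by
  -- The three constants belong to u·ū = |u|², which is even as a product of two odd functions, to
  -- f(|u|²), which stays even, and to the product of f(|u|²) with the odd function u.
  obtain ⟨K₁, h₁⟩ := HS.exists_mul hab n C C
  obtain ⟨K₂, h₂⟩ := HS.exists_comp hab n f hf K₁
  obtain ⟨K₃, h₃⟩ := HS.exists_mul hab n K₂ C
  refine ⟨K₃, fun u hu => ?_⟩
  have e : (fun x => u x * conj (u x)) = fun x => ((‖u x‖ ^ 2 : ℝ) : ℂ) := by
    ext x
    rw [Complex.mul_conj, Complex.normSq_eq_norm_sq]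
  have := h₁ _ _ _ _ hu hu.conj
  rw [e] at this
  simpa [nonlin] using h₃ _ _ _ _ (h₂ _ (fun x => sq_nonneg _) (by simpa using this)) hu

end HS

/-! ### Sine and cosine coefficients -/

/-- The sine for `s = true`, the cosine for `s = false`. -/
def trig (s : Bool) (x : ℝ) : ℝ := cond s (Real.sin x) (Real.cos x)

/-- The sine (`s = true`) or cosine (`s = false`) coefficients of a function on `(a,b)`. -/
def trigCoeff (a b : ℝ) (s : Bool) (u : ℝ → ℂ) (l : ℕ) : ℂ :=
  (2 / (b - a) : ℝ) * ∫ x in a..b, u x * (trig s (mu a b l * (x - a)) : ℂ)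

theorem trigCoeff_true (a b : ℝ) (u : ℝ → ℂ) (l : ℕ) :
    trigCoeff a b true u l = sineCoeff a b u l := rfl

section

variable {a b : ℝ}

theorem mu_pos (hab : a < b) (l : ℕ) : 0 < mu a b (l + 1) := by
  have : 0 < b - a := by linarith
  unfold mu
  positivity

theorem mu_nonneg (hab : a < b) (l : ℕ) : 0 ≤ mu a b l := by
  have : 0 < b - a := by linarith
  unfold mu
  positivity

/-- Folds the doubled interval about `a`. Here `A` is the integrand on the right half and `B` the
integrand on the left half read backwards. -/
theorem integral_reflect {E : Type*} [NormedAddCommGroup E] [NormedSpace ℝ E] (hab : a < b)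
    {G A B : ℝ → E} (hA : IntervalIntegrable A volume a b) (hB : IntervalIntegrable B volume a b)
    (h1 : ∀ x ∈ Ioo a b, G x = A x) (h2 : ∀ x ∈ Ioo a b, G (2 * a - x) = B x) :
    ∫ x in (a - (b - a))..b, G x = ∫ x in a..b, (A x + B x) := by
  have e2 : ∀ x ∈ Ioo (a - (b - a)) a, G x = B (2 * a - x) := fun x hx => by
    rw [← h2 (2 * a - x) ⟨by linarith [hx.2], by linarith [hx.1]⟩]
    congr 1; ring
  have i1 : IntervalIntegrable G volume a b := by
    refine hA.congr_ae ?_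
    rw [uIoc_of_le hab.le, ← restrict_Ioo_eq_restrict_Ioc]
    exact (ae_restrict_mem measurableSet_Ioo).mono fun x hx => (h1 x hx).symm
  have i2 : IntervalIntegrable G volume (a - (b - a)) a := by
    have := hB.comp_sub_left (2 * a)
    rw [show 2 * a - a = a by ring, show 2 * a - b = a - (b - a) by ring] at this
    refine this.symm.congr_ae ?_
    rw [uIoc_of_le (by linarith), ← restrict_Ioo_eq_restrict_Ioc]
    exact (ae_restrict_mem measurableSet_Ioo).mono fun x hx => (e2 x hx).symm
  rw [← intervalIntegral.integral_add_adjacent_intervals i2 i1,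
    intervalIntegral.integral_congr_Ioo_of_le hab.le h1,
    intervalIntegral.integral_congr_Ioo_of_le (by linarith) e2,
    intervalIntegral.integral_comp_sub_left B, intervalIntegral.integral_add hA hB, add_comm]
  congr 2 <;> ring

/-- For an odd (even) reflection about `a`, the exponentials at x and 2a − x combine to a sine
(cosine). A Fourier coefficient on the doubled interval is thus half a sine (cosine) coefficient, up
to a factor of modulus one. -/
theorem fourierCoeffOn_reflect (hab : a < b) (s : Bool) {v w : ℝ → ℂ}
    (hv : IntervalIntegrable v volume a b)
    (h1 : ∀ x ∈ Ioo a b, w x = v x)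
    (h2 : ∀ x ∈ Ioo a b, w (2 * a - x) = (cond s (-1) 1 : ℂ) * v x) (n : ℤ) :
    ‖fourierCoeffOn (show a - (b - a) < b by linarith) w n‖ ^ 2
      = ‖trigCoeff a b s v n.natAbs‖ ^ 2 / 4 := by
  have hL : 0 < b - a := by linarith
  have hLC : ((b : ℂ) - a) ≠ 0 := by
    rw [← Complex.ofReal_sub]; exact_mod_cast hL.ne'
  rw [fourierCoeffOn_eq_integral]
  have e1 : ∀ x : ℝ, fourier (-n) (x : AddCircle (b - (a - (b - a))))
      = Complex.exp (-(Real.pi * n * a / (b - a) : ℂ) * Complex.I)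
        * Complex.exp (-(Real.pi * n * (x - a) / (b - a) : ℂ) * Complex.I) := fun x => by
    rw [fourier_coe_apply, ← Complex.exp_add]
    congr 1
    push_cast
    have : (b : ℂ) - (a - (b - a)) = 2 * (b - a) := by ring
    rw [this]
    field_simp
    ring
  -- The phase caused by measuring from 0 instead of from `a`; it has modulus one and drops out of
  -- the norm.
  set ph := Complex.exp (-(Real.pi * n * a / (b - a) : ℂ) * Complex.I) with hph
  have hphn : ‖ph‖ = 1 := by
    have : (-(Real.pi * n * a / (b - a) : ℂ)) = ((-(Real.pi * n * a / (b - a)) : ℝ) : ℂ) := by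
      push_cast; ring
    rw [hph, this, Complex.norm_exp_ofReal_mul_I]
  have hcont : ∀ c : ℝ, Continuous fun x : ℝ =>
      ph * Complex.exp (c * (Real.pi * n * (x - a) / (b - a) : ℂ) * Complex.I) := fun c => by
    fun_prop
  rw [integral_reflect hab
    (A := fun x => ph * Complex.exp ((-1 : ℝ) * (Real.pi * n * (x - a) / (b - a) : ℂ) * Complex.I)
      * v x)
    (B := fun x => ph * Complex.exp ((1 : ℝ) * (Real.pi * n * (x - a) / (b - a) : ℂ) * Complex.I)
      * (cond s (-1) 1 * v x))
    (hv.continuousOn_mul (hcont _).continuousOn)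
    ((hv.const_mul _).continuousOn_mul (hcont _).continuousOn)
    (fun x hx => by
      rw [e1, h1 x hx, smul_eq_mul]; congr 3; push_cast; ring)
    (fun x hx => by
      rw [e1, h2 x hx, smul_eq_mul]; congr 3; push_cast; ring)]
  obtain ⟨κ, hκn, hκ⟩ : ∃ κ : ℂ, ‖κ‖ = 2 ∧ ∀ x : ℝ,
      Complex.exp ((-1 : ℝ) * (Real.pi * n * (x - a) / (b - a) : ℂ) * Complex.I)
      + Complex.exp ((1 : ℝ) * (Real.pi * n * (x - a) / (b - a) : ℂ) * Complex.I)
        * (cond s (-1) 1 : ℂ) = κ * (trig s (mu a b n.natAbs * (x - a)) : ℂ) := by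
    have key : ∃ ς : ℝ, |ς| = 1 ∧ ∀ x : ℝ, (Real.pi * n * (x - a) / (b - a) : ℂ)
        = ς * (mu a b n.natAbs * (x - a) : ℝ) := by
      rcases n.natAbs_eq with h | h
      · refine ⟨1, by simp, fun x => ?_⟩
        rw [h, mu]; push_cast; simp; ring
      · refine ⟨-1, by simp, fun x => ?_⟩
        rw [h, mu]; push_cast; simp; ring
    obtain ⟨ς, hς, h⟩ := key
    have hς' : ς = 1 ∨ ς = -1 := by
      rcases abs_choice ς with h | h
      · left; linarith
      · right; linarith
    cases s
    · refine ⟨2, by simp, fun x => ?_⟩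
      rw [h, trig]
      generalize mu a b n.natAbs * (x - a) = θ
      rcases hς' with rfl | rfl <;> simp [Complex.cos] <;> ring_nf
    · refine ⟨-2 * ς * Complex.I, by simp [hς], fun x => ?_⟩
      rw [h, trig]
      generalize mu a b n.natAbs * (x - a) = θ
      rcases hς' with rfl | rfl <;> simp [Complex.sin] <;> ring_nf <;> simp <;> ring
  have e3 : ∫ x in a..b, (ph * Complex.exp ((-1 : ℝ) * (Real.pi * n * (x - a) / (b - a) : ℂ)
      * Complex.I) * v x + ph * Complex.exp ((1 : ℝ) * (Real.pi * n * (x - a) / (b - a) : ℂ)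
      * Complex.I) * (cond s (-1) 1 * v x))
      = (ph * κ) * ∫ x in a..b, v x * (trig s (mu a b n.natAbs * (x - a)) : ℂ) := by
    rw [← intervalIntegral.integral_const_mul]
    congr 1; ext x
    have := hκ x
    linear_combination (ph * v x) * this
  rw [e3, trigCoeff, norm_smul, norm_mul, norm_mul, norm_mul, hphn, hκn, Complex.norm_real,
    Real.norm_of_nonneg (by have : 0 < b - (a - (b - a)) := by linarith
                            positivity), Real.norm_of_nonneg (by positivity)]
  have : b - (a - (b - a)) = 2 * (b - a) := by ring
  rw [this]
  field_simp
  ring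

/-- Parseval's identity for sine and cosine series. -/
theorem hasSum_trigCoeff (hab : a < b) (s : Bool) {v : ℝ → ℂ}
    (hv : MemLp v 2 (volume.restrict (Ioo a b))) :
    HasSum (fun l : ℕ => ‖trigCoeff a b s v (l + 1)‖ ^ 2)
      (2 / (b - a) * (∫ x in a..b, ‖v x‖ ^ 2) - ‖trigCoeff a b s v 0‖ ^ 2 / 2) := by
  have hL : 0 < b - a := by linarith
  -- Extended by zero, `v` and its mirror image have disjoint supports, so their sum is the
  -- reflected function on the doubled interval.
  set V : ℝ → ℂ := (Ioo a b).indicator v with hV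
  have hVm : MemLp V 2 volume := (memLp_indicator_iff_restrict measurableSet_Ioo).2 hv
  set w : ℝ → ℂ := fun x => V x + (cond s (-1) 1 : ℂ) * V (2 * a - x) with hw
  have hwm : MemLp w 2 volume := by
    refine hVm.add (MemLp.const_mul ?_ _)
    exact hVm.comp_measurePreserving (Measure.measurePreserving_sub_left volume (2 * a))
  have h1 : ∀ x ∈ Ioo a b, w x = v x := fun x hx => by
    have : 2 * a - x ∉ Ioo a b := fun h => by linarith [h.1, hx.1]
    simp [hw, hV, hx, this]
  have h2 : ∀ x ∈ Ioo a b, w (2 * a - x) = (cond s (-1) 1 : ℂ) * v x := fun x hx => by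
    have : 2 * a - x ∉ Ioo a b := fun h => by linarith [h.1, hx.1]
    simp [hw, hV, hx, this]
  have hi := intervalIntegrable_sq_of_memLp hab.le hv
  have hP := hasSum_sq_fourierCoeffOn (show a - (b - a) < b by linarith) (hwm.restrict _)
  simp only [fourierCoeffOn_reflect hab s (intervalIntegrable_of_memLp hab.le hv) h1 h2] at hP
  rw [integral_reflect (G := fun x => ‖w x‖ ^ 2) hab hi hi (fun x hx => by simp [h1 x hx])
    (fun x hx => by rw [h2 x hx]; cases s <;> simp), intervalIntegral.integral_add hi hi] at hP
  -- The bilateral sum is folded by pairing n with −n. This counts the mode 0 twice, and removing it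
  -- leaves the correction by half of its square.
  have hS := ((hasSum_nat_add_iff' 1).2 hP.nat_add_neg).mul_left 2
  have e1 : (fun l : ℕ => ‖trigCoeff a b s v (l + 1)‖ ^ 2) = fun l : ℕ =>
      2 * (‖trigCoeff a b s v (((l + 1 : ℕ) : ℤ)).natAbs‖ ^ 2 / 4
        + ‖trigCoeff a b s v (-((l + 1 : ℕ) : ℤ)).natAbs‖ ^ 2 / 4) := by
    ext l
    rw [Int.natAbs_neg, Int.natAbs_natCast]
    ring
  have e2 : 2 / (b - a) * (∫ x in a..b, ‖v x‖ ^ 2) - ‖trigCoeff a b s v 0‖ ^ 2 / 2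
      = 2 * ((b - (a - (b - a)))⁻¹ • ((∫ x in a..b, ‖v x‖ ^ 2) + ∫ x in a..b, ‖v x‖ ^ 2)
        + ‖trigCoeff a b s v (Int.natAbs 0)‖ ^ 2 / 4 - ∑ i ∈ Finset.range 1,
          (‖trigCoeff a b s v (i : ℤ).natAbs‖ ^ 2 / 4
            + ‖trigCoeff a b s v (-(i : ℤ)).natAbs‖ ^ 2 / 4)) := by
    have : b - (a - (b - a)) = 2 * (b - a) := by ring
    rw [this]
    simp
    field_simp
    ring
  rw [e1, e2]
  exact hS

theorem sum_trigCoeff_le (hab : a < b) (s : Bool) {v : ℝ → ℂ}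
    (hv : MemLp v 2 (volume.restrict (Ioo a b))) (N : ℕ) :
    ∑ l ∈ Finset.range N, ‖trigCoeff a b s v (l + 1)‖ ^ 2
      ≤ 2 / (b - a) * ∫ x in a..b, ‖v x‖ ^ 2 := by
  refine (sum_le_hasSum _ (fun _ _ => sq_nonneg _) (hasSum_trigCoeff hab s hv)).trans ?_
  linarith [sq_nonneg ‖trigCoeff a b s v 0‖]

theorem tendsto_trigCoeff (hab : a < b) (s : Bool) {v : ℝ → ℂ}
    (hv : MemLp v 2 (volume.restrict (Ioo a b))) :
    Filter.Tendsto (fun l : ℕ => ‖trigCoeff a b s v (l + 1)‖) Filter.atTop (nhds 0) := by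
  have := (hasSum_trigCoeff hab s hv).summable.tendsto_atTop_zero
  simpa [Real.sqrt_sq] using this.sqrt

theorem isPrim_of_hasDerivAt {u v : ℝ → ℂ} (hv : Continuous v) (h : ∀ x, HasDerivAt u (v x) x)
    (a b : ℝ) : IsPrim a b u v := by
  refine ⟨hv.intervalIntegrable _ _, fun x _ => ?_⟩
  rw [intervalIntegral.integral_eq_sub_of_hasDerivAt (fun y _ => h y) (hv.intervalIntegrable _ _)]
  abel

theorem isPrim_sin (k a b : ℝ) : IsPrim a b (fun x => (Real.sin (k * (x - a)) : ℂ))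
    (fun x => k * (Real.cos (k * (x - a)) : ℂ)) := by
  refine isPrim_of_hasDerivAt (by fun_prop) (fun x => ?_) a b
  have : HasDerivAt (fun x : ℝ => Real.sin (k * (x - a))) (Real.cos (k * (x - a)) * k) x := by
    simpa using (((hasDerivAt_id x).sub_const a).const_mul k).sin
  simpa [mul_comm] using this.ofReal_comp

theorem isPrim_cos (k a b : ℝ) : IsPrim a b (fun x => (Real.cos (k * (x - a)) : ℂ))
    (fun x => -k * (Real.sin (k * (x - a)) : ℂ)) := by
  refine isPrim_of_hasDerivAt (by fun_prop) (fun x => ?_) a b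
  have : HasDerivAt (fun x : ℝ => Real.cos (k * (x - a))) (-Real.sin (k * (x - a)) * k) x := by
    simpa using (((hasDerivAt_id x).sub_const a).const_mul k).cos
  simpa [mul_comm] using this.ofReal_comp

theorem mu_mul_length (hab : a < b) (l : ℕ) : mu a b l * (b - a) = l * Real.pi := by
  have : b - a ≠ 0 := by linarith
  unfold mu
  field_simp

/-- Integration by parts. The cosine is 1 at `a` and (−1)^l at `b`, so the end point values of `u`
survive; this boundary term later detects the traces. In the companion statement for cosine
coefficients the sine vanishes at both ends and nothing survives. -/
theorem mu_mul_trigCoeff_true (hab : a < b) {u v : ℝ → ℂ} (h : IsPrim a b u v) (l : ℕ) :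
    mu a b l * trigCoeff a b true u l
      = (2 / (b - a) : ℝ) * (u a - (-1) ^ l * u b) + trigCoeff a b false v l := by
  have hp := h.mul hab.le (isPrim_cos (mu a b l) a b)
  have := hp.2 b ⟨hab.le, le_rfl⟩
  have hcv : ContinuousOn (fun x : ℝ => (Real.cos (mu a b l * (x - a)) : ℂ)) (uIcc a b) := by
    fun_prop
  have hcs : Continuous (fun x : ℝ => (Real.sin (mu a b l * (x - a)) : ℂ)) := by fun_prop
  have hcu := h.continuousOn hab.le
  rw [← uIcc_of_le hab.le] at hcu
  have hi := (hcu.mul hcs.continuousOn).intervalIntegrable (μ := volume)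
  rw [intervalIntegral.integral_add (h.1.mul_continuousOn hcv)
    ((hi.const_mul (-(mu a b l : ℂ))).congr fun x _ => by simp only [Pi.mul_apply]; ring)] at this
  have e : ∫ x in a..b, u x * (-(mu a b l : ℂ) * (Real.sin (mu a b l * (x - a)) : ℂ))
      = -(mu a b l : ℂ) * ∫ x in a..b, u x * (Real.sin (mu a b l * (x - a)) : ℂ) := by
    rw [← intervalIntegral.integral_const_mul]
    congr 1; ext x; ring
  beta_reduce at this
  rw [e, mu_mul_length hab, Real.cos_nat_mul_pi] at this
  simp only [sub_self, mul_zero, Real.cos_zero] at this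
  push_cast at this
  simp only [trigCoeff, trig, cond_true, cond_false]
  push_cast
  linear_combination (2 / ((b : ℂ) - a)) * this

theorem mu_mul_trigCoeff_false (hab : a < b) {u v : ℝ → ℂ} (h : IsPrim a b u v) (l : ℕ) :
    mu a b l * trigCoeff a b false u l = -trigCoeff a b true v l := by
  have hp := h.mul hab.le (isPrim_sin (mu a b l) a b)
  have := hp.2 b ⟨hab.le, le_rfl⟩
  have hcv : ContinuousOn (fun x : ℝ => (Real.sin (mu a b l * (x - a)) : ℂ)) (uIcc a b) := by
    fun_prop
  have hcs : Continuous (fun x : ℝ => (Real.cos (mu a b l * (x - a)) : ℂ)) := by fun_prop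
  have hcu := h.continuousOn hab.le
  rw [← uIcc_of_le hab.le] at hcu
  have hi := (hcu.mul hcs.continuousOn).intervalIntegrable (μ := volume)
  rw [intervalIntegral.integral_add (h.1.mul_continuousOn hcv)
    ((hi.const_mul (mu a b l : ℂ)).congr fun x _ => by simp only [Pi.mul_apply]; ring)] at this
  have e : ∫ x in a..b, u x * ((mu a b l : ℂ) * (Real.cos (mu a b l * (x - a)) : ℂ))
      = (mu a b l : ℂ) * ∫ x in a..b, u x * (Real.cos (mu a b l * (x - a)) : ℂ) := by
    rw [← intervalIntegral.integral_const_mul]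
    congr 1; ext x; ring
  beta_reduce at this
  rw [e, mu_mul_length hab, Real.sin_nat_mul_pi] at this
  simp only [sub_self, mul_zero, Real.sin_zero, Complex.ofReal_zero, zero_add] at this
  simp only [trigCoeff, trig, cond_true, cond_false]
  push_cast at this ⊢
  linear_combination (-(2 / ((b : ℂ) - a))) * this

theorem mu_mul_norm_trigCoeff (hab : a < b) {s : Bool} {u v : ℝ → ℂ} (h : IsPrim a b u v)
    (h0 : s = true → u a = 0 ∧ u b = 0) (l : ℕ) :
    mu a b l * ‖trigCoeff a b s u l‖ = ‖trigCoeff a b (!s) v l‖ := by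
  rw [← Real.norm_of_nonneg (mu_nonneg hab l), ← Complex.norm_real, ← norm_mul]
  cases s
  · rw [mu_mul_trigCoeff_false hab h, norm_neg]; rfl
  · rw [mu_mul_trigCoeff_true hab h, (h0 rfl).1, (h0 rfl).2]
    simp

/-- Each integration by parts absorbs one factor μ and flips the parity. The boundary terms vanish
alternately because of the traces and because of the sine. Bessel's inequality ends the induction.
-/
theorem HS.sum_le (hab : a < b) {n : ℕ} {s : Bool} {C : ℝ} {u : ℝ → ℂ} (h : HS a b n s C u)
    (N : ℕ) : ∑ l ∈ Finset.range N, mu a b (l + 1) ^ (2 * n) * ‖trigCoeff a b s u (l + 1)‖ ^ 2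
      ≤ 2 / (b - a) * C ^ 2 := by
  have hL : 0 < b - a := by linarith
  induction n generalizing s u with
  | zero =>
    simp only [mul_zero, pow_zero, one_mul]
    exact (sum_trigCoeff_le hab s h.2.1 N).trans (by gcongr; exact h.2.2)
  | succ n ih =>
    obtain ⟨h0, h1, v, h2, h3⟩ := h
    refine le_trans (le_of_eq (Finset.sum_congr rfl fun l _ => ?_)) (ih h2)
    rw [← mu_mul_norm_trigCoeff hab h3 h1]
    ring

theorem HS.tendsto (hab : a < b) {n : ℕ} {s : Bool} {C : ℝ} {u : ℝ → ℂ} (h : HS a b n s C u) :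
    Filter.Tendsto (fun l : ℕ => mu a b (l + 1) ^ n * ‖trigCoeff a b s u (l + 1)‖)
      Filter.atTop (nhds 0) := by
  induction n generalizing s u with
  | zero => simpa using tendsto_trigCoeff hab s h.2.1
  | succ n ih =>
    obtain ⟨h0, h1, v, h2, h3⟩ := h
    refine (ih h2).congr fun l => ?_
    rw [← mu_mul_norm_trigCoeff hab h3 h1]
    ring

end

/-! ### Traces recovered from the decay of coefficients, and Sobolev embeddings. -/

section

variable {a b : ℝ}

theorem tendsto_of_tendsto_mu_pow_mul (hab : a < b) {x : ℕ → ℝ} (hx : ∀ l, 0 ≤ x l) (n : ℕ)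
    (h : Filter.Tendsto (fun l => mu a b (l + 1) ^ n * x l) Filter.atTop (nhds 0)) :
    Filter.Tendsto x Filter.atTop (nhds 0) := by
  have h1 := h.const_mul ((mu a b 1 ^ n)⁻¹)
  rw [mul_zero] at h1
  refine squeeze_zero hx (fun l => ?_) h1
  have hp : 0 < mu a b 1 ^ n := pow_pos (mu_pos hab 0) n
  have hle : mu a b 1 ≤ mu a b (l + 1) := by
    have : 0 < b - a := by linarith
    unfold mu
    gcongr
    exact_mod_cast Nat.le_add_left 1 l
  rw [← mul_assoc]
  refine le_mul_of_one_le_left (hx l) ?_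
  rw [← div_eq_inv_mul, one_le_div hp]
  exact pow_le_pow_left₀ (mu_pos hab 0).le hle n

/-- Along odd and even indices the sequence is constantly p − q and p + q. -/
theorem eq_zero_of_tendsto_alternating {p q : ℂ}
    (h : Filter.Tendsto (fun l : ℕ => p - (-1) ^ (l + 1) * q) Filter.atTop (nhds 0)) :
    p = 0 ∧ q = 0 := by
  have ho : Filter.Tendsto (fun l : ℕ => 2 * l + 1) Filter.atTop Filter.atTop :=
    Filter.tendsto_atTop_mono (fun l => by omega : ∀ l : ℕ, l ≤ 2 * l + 1) Filter.tendsto_id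
  have he : Filter.Tendsto (fun l : ℕ => 2 * l) Filter.atTop Filter.atTop :=
    Filter.tendsto_atTop_mono (fun l => by omega : ∀ l : ℕ, l ≤ 2 * l) Filter.tendsto_id
  have h1 := h.comp ho
  have h2 := h.comp he
  have e1 : (fun l : ℕ => p - (-1) ^ (l + 1) * q) ∘ (fun l : ℕ => 2 * l + 1) = fun _ => p - q := by
    ext l
    have : Even (2 * l + 1 + 1) := ⟨l + 1, by ring⟩
    simp [this.neg_one_pow]
  have e2 : (fun l : ℕ => p - (-1) ^ (l + 1) * q) ∘ (fun l : ℕ => 2 * l) = fun _ => p + q := by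
    ext l
    have : Odd (2 * l + 1) := ⟨l, rfl⟩
    simp [this.neg_one_pow]
  rw [e1] at h1
  rw [e2] at h2
  have h3 := tendsto_nhds_unique h1 tendsto_const_nhds
  have h4 := tendsto_nhds_unique h2 tendsto_const_nhds
  constructor
  · linear_combination -(h3 + h4) / 2
  · linear_combination (h3 - h4) / 2

/-- A function in `H^n` with rapidly decaying sine (or cosine) coefficients has vanishing traces of
even (or odd) order. -/
theorem HS.of_tendsto (hab : a < b) {n : ℕ} {s : Bool} {C : ℝ} {g : ℕ → ℝ → ℂ}
    (hp : ∀ j < n, IsPrim a b (g j) (g (j + 1))) (hb : ∀ j < n, ∀ x ∈ Icc a b, ‖g j x‖ ≤ C)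
    (ht : HS a b 0 s C (g n))
    (h : Filter.Tendsto (fun l : ℕ => mu a b (l + 1) ^ n * ‖trigCoeff a b s (g 0) (l + 1)‖)
      Filter.atTop (nhds 0)) : HS a b n s C (g 0) := by
  induction n generalizing s g with
  | zero => exact ht
  | succ n ih =>
    have hp0 := hp 0 (Nat.succ_pos n)
    have hg1 : MemLp (g 1) 2 (volume.restrict (Ioo a b)) := by
      rcases Nat.eq_zero_or_pos n with rfl | hn
      · exact ht.2.1
      · exact memLp_of_continuousOn ((hp 1 (by omega)).continuousOn hab.le)
    have h0 : s = true → g 0 a = 0 ∧ g 0 b = 0 := by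
      rintro rfl
      -- One factor μ of the decay suffices here: μ û tends to 0, and so do the cosine coefficients
      -- of the square integrable derivative. Integration by parts leaves only the alternating
      -- boundary term, which must therefore tend to 0.
      have h1 := tendsto_of_tendsto_mu_pow_mul hab
        (x := fun l => mu a b (l + 1) * ‖trigCoeff a b true (g 0) (l + 1)‖)
        (fun l => mul_nonneg (mu_pos hab l).le (norm_nonneg _)) n
        (by simpa only [pow_succ, mul_assoc] using h)
      have h2 : Filter.Tendsto (fun l : ℕ => (mu a b (l + 1) : ℂ)
          * trigCoeff a b true (g 0) (l + 1)) Filter.atTop (nhds 0) := by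
        rw [tendsto_zero_iff_norm_tendsto_zero]
        refine h1.congr fun l => ?_
        rw [norm_mul, Complex.norm_real, Real.norm_of_nonneg (mu_pos hab l).le]
      have h3 := h2.sub (tendsto_zero_iff_norm_tendsto_zero.2 (tendsto_trigCoeff hab false hg1))
      simp only [mu_mul_trigCoeff_true hab hp0, add_sub_cancel_right, sub_zero] at h3
      have hL : ((2 / (b - a) : ℝ) : ℂ) ≠ 0 := by
        have : 0 < b - a := by linarith
        exact_mod_cast (by positivity : (2 / (b - a)) ≠ 0)
      have h4 := h3.const_mul ((2 / (b - a) : ℝ) : ℂ)⁻¹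
      simp only [mul_zero, inv_mul_cancel_left₀ hL] at h4
      exact eq_zero_of_tendsto_alternating h4
    refine ⟨hb 0 (Nat.succ_pos n), h0, g 1, ?_, hp0⟩
    refine ih (g := fun j => g (j + 1)) (fun j hj => hp (j + 1) (by omega))
      (fun j hj => hb (j + 1) (by omega)) ht ?_
    refine h.congr fun l => ?_
    rw [zero_add, ← mu_mul_norm_trigCoeff hab hp0 h0]
    ring

theorem HS.of_traces {n : ℕ} {s : Bool} {C : ℝ} {g : ℕ → ℝ → ℂ}
    (hp : ∀ j < n, IsPrim a b (g j) (g (j + 1))) (hb : ∀ j < n, ∀ x ∈ Icc a b, ‖g j x‖ ≤ C)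
    (ht : HS a b 0 s C (g n))
    (h : ∀ k, (s = true → 2 * k < n → g (2 * k) a = 0 ∧ g (2 * k) b = 0) ∧
      (s = false → 2 * k + 1 < n → g (2 * k + 1) a = 0 ∧ g (2 * k + 1) b = 0)) :
    HS a b n s C (g 0) := by
  induction n generalizing s g with
  | zero => exact ht
  | succ n ih =>
    refine ⟨hb 0 (Nat.succ_pos n), fun hs => (h 0).1 hs (Nat.succ_pos n), g 1, ?_,
      hp 0 (Nat.succ_pos n)⟩
    refine ih (g := fun j => g (j + 1)) (fun j hj => hp (j + 1) (by omega))
      (fun j hj => hb (j + 1) (by omega)) ht fun k => ⟨fun hs hk => ?_, fun hs hk => ?_⟩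
    · exact (h k).2 (by simpa using hs) (by omega)
    · exact (h (k + 1)).1 (by simpa using hs) (by omega)

/-- A pointwise bound on a subinterval by the `H¹` norm. -/
theorem IsPrim.length_mul_sq_le {c d : ℝ} (hcd : c ≤ d) {u v : ℝ → ℂ} (h : IsPrim c d u v)
    (hv : MemLp v 2 (volume.restrict (Ioo c d))) {x : ℝ} (hx : x ∈ Icc c d) :
    (d - c) * ‖u x‖ ^ 2
      ≤ 2 * (∫ y in c..d, ‖u y‖ ^ 2) + 2 * (d - c) ^ 2 * ∫ y in c..d, ‖v y‖ ^ 2 := by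
  have hv2 := intervalIntegrable_sq_of_memLp hcd hv
  set B := ∫ y in c..d, ‖v y‖ ^ 2 with hB
  have hd : 0 ≤ d - c := by linarith
  -- The value at `x` is compared with the value at each `y`; integrating over `y` then gives the
  -- claim.
  have h1 : ∀ y ∈ Icc c d, ‖u x‖ ^ 2 ≤ 2 * ‖u y‖ ^ 2 + 2 * ((d - c) * B) := fun y hy => by
    have e := h.sub_eq hy hx
    have h2 : ‖∫ s in y..x, v s‖ ≤ ∫ s in c..d, ‖v s‖ := by
      rw [intervalIntegral.norm_intervalIntegral_eq, intervalIntegral.integral_of_le hcd]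
      refine (norm_integral_le_integral_norm _).trans ?_
      refine setIntegral_mono_set h.1.norm.1 (Filter.Eventually.of_forall fun _ => norm_nonneg _)
        (LE.le.eventuallyLE ?_)
      rw [← uIoc_of_le hcd]
      refine uIoc_subset_uIoc_of_uIcc_subset_uIcc ?_
      rw [uIcc_of_le hcd]
      exact ordConnected_Icc.uIcc_subset hy hx
    have h3 := sq_integral_le hcd h.1.norm hv2
    have h4 : ‖u x - u y‖ ^ 2 ≤ (d - c) * B := by
      rw [e]
      exact (pow_le_pow_left₀ (norm_nonneg _) h2 2).trans h3
    have h5 : ‖u x‖ ≤ ‖u y‖ + ‖u x - u y‖ := by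
      simpa using norm_add_le (u y) (u x - u y)
    nlinarith [pow_le_pow_left₀ (norm_nonneg _) h5 2, sq_nonneg (‖u y‖ - ‖u x - u y‖)]
  have hu := h.continuousOn hcd
  have hi : IntervalIntegrable (fun y => ‖u y‖ ^ 2) volume c d :=
    ContinuousOn.intervalIntegrable (by rw [uIcc_of_le hcd]; exact hu.norm.pow 2)
  have h6 := intervalIntegral.integral_mono_on (f := fun _ => ‖u x‖ ^ 2) hcd (by simp)
    ((hi.const_mul 2).add (intervalIntegrable_const (c := 2 * ((d - c) * B)))) h1
  rw [intervalIntegral.integral_add (hi.const_mul 2) (by simp), intervalIntegral.integral_const_mul,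
    intervalIntegral.integral_const, intervalIntegral.integral_const, smul_eq_mul,
    smul_eq_mul] at h6
  linarith

/-- `WeakDerivs` states integrability for the top derivative only. The others follow by descending
induction, since a primitive of an integrable function is continuous. -/
theorem WeakDerivs.isPrim (hab : a ≤ b) {m : ℕ} {u : ℝ → ℂ} {g : ℕ → ℝ → ℂ}
    (h : WeakDerivs a b m u g) : ∀ j < m, IsPrim a b (g j) (g (j + 1)) := by
  have key : ∀ i < m, IsPrim a b (g (m - 1 - i)) (g (m - 1 - i + 1)) := by
    intro i
    induction i with
    | zero =>
      intro hi
      refine ⟨?_, h.succ _ (by omega)⟩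
      rw [show m - 1 - 0 + 1 = m by omega]
      exact intervalIntegrable_of_memLp hab h.memLp
    | succ i ih =>
      intro hi
      have h1 := (ih (by omega)).continuousOn hab
      rw [show m - 1 - i = m - 1 - (i + 1) + 1 by omega] at h1
      refine ⟨ContinuousOn.intervalIntegrable ?_, h.succ _ (by omega)⟩
      rwa [uIcc_of_le hab]
  intro j hj
  have := key (m - 1 - j) (by omega)
  rwa [show m - 1 - (m - 1 - j) = j by omega] at this

theorem WeakDerivs.memLp_of_le (hab : a ≤ b) {m : ℕ} {u : ℝ → ℂ} {g : ℕ → ℝ → ℂ}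
    (h : WeakDerivs a b m u g) {j : ℕ} (hj : j ≤ m) :
    MemLp (g j) 2 (volume.restrict (Ioo a b)) := by
  rcases hj.eq_or_lt with rfl | hj
  · exact h.memLp
  · exact memLp_of_continuousOn ((h.isPrim hab j hj).continuousOn hab)

/-- A constant of the embeddings of `H^{m}` into `C^{m-1}`. -/
def embConst (a b : ℝ) : ℝ := 1 + 2 / (b - a) + 2 * (b - a)

theorem one_le_embConst (hab : a < b) : 1 ≤ embConst a b := by
  have : 0 < b - a := by linarith
  have : 0 < 2 / (b - a) := by positivity
  unfold embConst
  linarith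

theorem WeakDerivs.bounds (hab : a < b) {m : ℕ} {u : ℝ → ℂ} {g : ℕ → ℝ → ℂ}
    (h : WeakDerivs a b m u g) {C : ℝ}
    (hC : √(∑ j ∈ Finset.range (m + 1), ∫ x in a..b, ‖g j x‖ ^ 2) ≤ C) :
    (∀ j ≤ m, ∫ x in a..b, ‖g j x‖ ^ 2 ≤ C ^ 2) ∧
      ∀ j < m, ∀ x ∈ Icc a b, ‖g j x‖ ≤ embConst a b * C := by
  have hL : 0 < b - a := by linarith
  have hC0 : 0 ≤ C := (Real.sqrt_nonneg _).trans hC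
  have h0 : ∀ j, 0 ≤ ∫ x in a..b, ‖g j x‖ ^ 2 := fun j =>
    intervalIntegral.integral_nonneg hab.le fun x _ => sq_nonneg _
  have h1 : ∀ j ≤ m, ∫ x in a..b, ‖g j x‖ ^ 2 ≤ C ^ 2 := fun j hj => by
    refine le_trans ?_ ((Real.sqrt_le_left hC0).1 hC)
    exact Finset.single_le_sum (f := fun j => ∫ x in a..b, ‖g j x‖ ^ 2) (fun i _ => h0 i)
      (Finset.mem_range.2 (by omega))
  refine ⟨h1, fun j hj x hx => ?_⟩
  have h2 := (h.isPrim hab.le j hj).length_mul_sq_le hab.le (h.memLp_of_le hab.le hj) hx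
  have h3 := h1 j hj.le
  have h4 := h1 (j + 1) hj
  have h5 : (b - a) * ‖g j x‖ ^ 2 ≤ 2 * C ^ 2 + 2 * (b - a) ^ 2 * C ^ 2 := by
    refine h2.trans ?_
    gcongr
  -- `embConst` dominates 2/(b − a) + 2(b − a). It is also at least 1, hence at most its own square,
  -- which allows roots to be taken below.
  have h6 : ‖g j x‖ ^ 2 ≤ embConst a b * C ^ 2 := by
    have : ‖g j x‖ ^ 2 ≤ (2 * C ^ 2 + 2 * (b - a) ^ 2 * C ^ 2) / (b - a) := by
      rw [le_div_iff₀ hL]; linarith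
    refine this.trans ?_
    rw [embConst, div_le_iff₀ hL]
    have : (1 + 2 / (b - a) + 2 * (b - a)) * C ^ 2 * (b - a)
      = (b - a) * C ^ 2 + (2 * C ^ 2 + 2 * (b - a) ^ 2 * C ^ 2) := by field_simp; ring
    rw [this]
    nlinarith [sq_nonneg C]
  have h7 := one_le_embConst hab
  refine abs_le_of_sq_le_sq' (h6.trans ?_) (by positivity) |>.2
  nlinarith [sq_nonneg C, mul_nonneg (sq_nonneg C) (by linarith : 0 ≤ embConst a b - 1)]

theorem WeakDerivs.hs_zero (hab : a < b) {m : ℕ} {u : ℝ → ℂ} {g : ℕ → ℝ → ℂ}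
    (h : WeakDerivs a b m u g) {C : ℝ}
    (hC : √(∑ j ∈ Finset.range (m + 1), ∫ x in a..b, ‖g j x‖ ^ 2) ≤ C) (s : Bool) {j : ℕ}
    (hj : j ≤ m) : HS a b 0 s (embConst a b * C) (g j) := by
  have hC0 : 0 ≤ C := (Real.sqrt_nonneg _).trans hC
  have h1 := one_le_embConst hab
  refine ⟨by positivity, h.memLp_of_le hab.le hj, ((h.bounds hab hC).1 j hj).trans ?_⟩
  gcongr
  nlinarith

theorem MemHs.exists_hs (hab : a < b) {m : ℕ} {u : ℝ → ℂ} (h : MemHs a b m u) :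
    ∃ C, HS a b m true C u := by
  obtain ⟨g, hg, ht⟩ := h
  have hb := hg.bounds hab le_rfl
  refine ⟨_, (HS.of_traces (hg.isPrim hab.le) hb.2 (hg.hs_zero hab le_rfl true le_rfl)
    fun k => ⟨fun _ => ht k, by simp⟩).congr hab.le hg.zero⟩

theorem HNormLe.hs_one (hab : a < b) {u : ℝ → ℂ} {C : ℝ} (h : HNormLe a b 1 u C)
    (h0 : u a = 0 ∧ u b = 0) : HS a b 1 true (embConst a b * C) u := by
  obtain ⟨g, hg, hC⟩ := h
  refine (HS.of_traces (hg.isPrim hab.le) (hg.bounds hab hC).2 (hg.hs_zero hab hC true le_rfl)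
    fun k => ⟨fun _ hk => ?_, by simp⟩).congr hab.le hg.zero
  obtain rfl : k = 0 := by omega
  rwa [mul_zero, hg.zero ⟨le_rfl, hab.le⟩, hg.zero ⟨hab.le, le_rfl⟩]

theorem HNormLe.bound (hab : a < b) {m : ℕ} {u : ℝ → ℂ} {C : ℝ} (h : HNormLe a b (m + 1) u C)
    {x : ℝ} (hx : x ∈ Icc a b) : ‖u x‖ ≤ embConst a b * C := by
  obtain ⟨g, hg, hC⟩ := h
  rw [← hg.zero hx]
  exact (hg.bounds hab hC).2 0 (by omega) x hx

/-- Separates membership from size: the decay is used only qualitatively, to obtain the traces,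
while the constant comes from the Sobolev norm alone. A decay whose rate degenerates as ε → 0 is
therefore harmless. -/
theorem HNormLe.hs_of_tendsto (hab : a < b) {m n : ℕ} (hn : n ≤ m) {u : ℝ → ℂ} {C : ℝ}
    (h : HNormLe a b m u C)
    (ht : Filter.Tendsto (fun l : ℕ => mu a b (l + 1) ^ n * ‖sineCoeff a b u (l + 1)‖)
      Filter.atTop (nhds 0)) : HS a b n true (embConst a b * C) u := by
  obtain ⟨g, hg, hC⟩ := h
  refine (HS.of_tendsto hab (fun j hj => hg.isPrim hab.le j (by omega))
    (fun j hj => (hg.bounds hab hC).2 j (by omega)) (hg.hs_zero hab hC true hn) ?_).congr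
      hab.le hg.zero
  refine ht.congr fun l => ?_
  have e : ∫ x in a..b, u x * (Real.sin (mu a b (l + 1) * (x - a)) : ℂ)
      = ∫ x in a..b, g 0 x * (Real.sin (mu a b (l + 1) * (x - a)) : ℂ) :=
    intervalIntegral.integral_congr fun x hx => by
      rw [uIcc_of_le hab.le] at hx
      simp only [hg.zero hx]
  rw [trigCoeff_true, sineCoeff, sineCoeff, e]

end

/-! ### The discrete sine transform -/

theorem sum_cos_grid {M n : ℕ} (hn : 0 < n) (hnM : n < 2 * M) :
    ∑ j ∈ Finset.range M, Real.cos (j * n * Real.pi / M) = (1 - (-1) ^ n) / 2 := by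
  have hM : (0 : ℝ) < M := by exact_mod_cast (by omega : 0 < M)
  set θ : ℝ := n * Real.pi / M with hθ
  have hs : 0 < Real.sin (θ / 2) := by
    refine Real.sin_pos_of_pos_of_lt_pi (by positivity) ?_
    have h2 : (n : ℝ) < 2 * M := by exact_mod_cast hnM
    rw [hθ, div_div, div_lt_iff₀ (by positivity)]
    nlinarith [Real.pi_pos]
  -- Multiplication by 2 sin(θ/2) makes the cosine sum telescope; this factor is positive because 0
  -- < n < 2M.
  have key : ∀ N : ℕ, 2 * Real.sin (θ / 2) * ∑ j ∈ Finset.range N, Real.cos (j * θ)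
      = Real.sin (N * θ - θ / 2) + Real.sin (θ / 2) := by
    intro N
    induction N with
    | zero => simp
    | succ N ih =>
      rw [Finset.sum_range_succ, mul_add, ih]
      have e : ((N + 1 : ℕ) : ℝ) * θ - θ / 2 = N * θ + θ / 2 := by push_cast; ring
      rw [e, Real.sin_sub, Real.sin_add]
      ring
  have h1 := key M
  have e : (M : ℝ) * θ = n * Real.pi := by rw [hθ]; field_simp
  rw [e, Real.sin_sub, Real.sin_nat_mul_pi, Real.cos_nat_mul_pi] at h1
  have e2 : ∀ j : ℕ, (j : ℝ) * n * Real.pi / M = j * θ := fun j => by rw [hθ]; ring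
  simp only [e2]
  have : Real.sin (θ / 2) * (∑ j ∈ Finset.range M, Real.cos (j * θ) - (1 - (-1) ^ n) / 2) = 0 := by
    linear_combination h1 / 2
  rcases mul_eq_zero.1 this with h | h
  · exact absurd h hs.ne'
  · linarith

theorem sum_Ioo_eq_sum_range {E : Type*} [AddCommMonoid E] (M : ℕ) (F : ℕ → E) (h : F 0 = 0) :
    ∑ j ∈ Finset.Ioo 0 M, F j = ∑ j ∈ Finset.range M, F j := by
  refine Finset.sum_subset (fun j hj => ?_) fun j hj hj' => ?_
  · simp at hj ⊢; omega
  · simp at hj hj'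
    obtain rfl : j = 0 := by omega
    exact h

theorem sum_Ioo_eq_sum_range_succ {E : Type*} [AddCommMonoid E] (M : ℕ) (F : ℕ → E)
    (h : F M = 0) : ∑ j ∈ Finset.Ioo 0 M, F j = ∑ j ∈ Finset.range M, F (j + 1) := by
  cases M with
  | zero => simp
  | succ N =>
    have : Finset.Ioo 0 (N + 1) = (Finset.range N).image (· + 1) := by
      ext j
      simp only [Finset.mem_Ioo, Finset.mem_image, Finset.mem_range]
      constructor
      · rintro ⟨h1, h2⟩
        exact ⟨j - 1, by omega, by omega⟩
      · rintro ⟨i, hi, rfl⟩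
        omega
    rw [Finset.sum_range_succ, h, add_zero, this, Finset.sum_image fun x _ y _ h => by simpa using h]

/-- Product to sum. The integers k − l and k + l have the same parity, so the two cosine sums cancel
unless k = l, when the first of them equals M. -/
theorem sum_sin_mul_sin {M k l : ℕ} (hk : k ∈ Finset.Ioo 0 M) (hl : l ∈ Finset.Ioo 0 M) :
    ∑ j ∈ Finset.Ioo 0 M, Real.sin (j * k * Real.pi / M) * Real.sin (j * l * Real.pi / M)
      = if k = l then (M : ℝ) / 2 else 0 := by
  wlog hkl : l ≤ k generalizing k l
  · rw [← show (if l = k then (M : ℝ) / 2 else 0) = if k = l then (M : ℝ) / 2 else 0 by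
      simp only [eq_comm], ← this hl hk (by omega)]
    simp only [mul_comm]
  simp only [Finset.mem_Ioo] at hk hl
  rw [sum_Ioo_eq_sum_range _ _ (by simp)]
  have e : ∀ j : ℕ, Real.sin (j * k * Real.pi / M) * Real.sin (j * l * Real.pi / M)
      = (Real.cos (j * (k - l : ℕ) * Real.pi / M) - Real.cos (j * (k + l : ℕ) * Real.pi / M)) / 2 :=
    fun j => by
      rw [Nat.cast_sub hkl, Nat.cast_add,
        show (j : ℝ) * (k - l) * Real.pi / M = j * k * Real.pi / M - j * l * Real.pi / M by ring,
        show (j : ℝ) * (k + l) * Real.pi / M = j * k * Real.pi / M + j * l * Real.pi / M by ring,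
        Real.cos_sub, Real.cos_add]
      ring
  simp only [e]
  rw [← Finset.sum_div, Finset.sum_sub_distrib, sum_cos_grid (n := k + l) (by omega) (by omega)]
  split_ifs with h
  · subst h
    simp [← two_mul]
  · rw [sum_cos_grid (n := k - l) (by omega) (by omega),
      show k + l = (k - l) + 2 * l by omega, pow_add, pow_mul]
    simp

theorem sum_gridSin {M k l : ℕ} (hk : k ∈ Finset.Ioo 0 M) (hl : l ∈ Finset.Ioo 0 M) :
    ∑ j ∈ Finset.Ioo 0 M, gridSin M j k * gridSin M j l = if k = l then (M : ℂ) / 2 else 0 := by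
  have := congrArg Complex.ofReal (sum_sin_mul_sin hk hl)
  rw [Complex.ofReal_sum] at this
  simp only [gridSin, ← Complex.ofReal_mul, this]
  split_ifs <;> simp

theorem gridSin_comm (M j l : ℕ) : gridSin M j l = gridSin M l j := by
  unfold gridSin
  rw [mul_comm (j : ℝ)]

theorem gridSin_zero (M l : ℕ) : gridSin M 0 l = 0 := by simp [gridSin]

theorem gridSin_self {M : ℕ} (hM : 0 < M) (l : ℕ) : gridSin M M l = 0 := by
  have : (M : ℝ) ≠ 0 := by exact_mod_cast hM.ne'
  have e : (M : ℝ) * l * Real.pi / M = l * Real.pi := by field_simp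
  rw [gridSin, e, Real.sin_nat_mul_pi]
  simp

theorem conj_gridSin (M j l : ℕ) : conj (gridSin M j l) = gridSin M j l := Complex.conj_ofReal _

theorem norm_gridSin_le (M j l : ℕ) : ‖gridSin M j l‖ ≤ 1 := by
  rw [gridSin, Complex.norm_real]
  exact Real.abs_sin_le_one _

theorem dst_congr {M : ℕ} {v w : ℕ → ℂ} (h : ∀ j ∈ Finset.Ioo 0 M, v j = w j) (l : ℕ) :
    dst M v l = dst M w l := by
  unfold dst
  rw [Finset.sum_congr rfl fun j hj => by rw [h j hj]]

theorem dst_add (M : ℕ) (v w : ℕ → ℂ) (l : ℕ) :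
    dst M (fun j => v j + w j) l = dst M v l + dst M w l := by
  simp only [dst, add_mul, Finset.sum_add_distrib, mul_add]

theorem dst_sub (M : ℕ) (v w : ℕ → ℂ) (l : ℕ) :
    dst M (fun j => v j - w j) l = dst M v l - dst M w l := by
  simp only [dst, sub_mul, Finset.sum_sub_distrib, mul_sub]

theorem dst_const_mul (M : ℕ) (c : ℂ) (v : ℕ → ℂ) (l : ℕ) :
    dst M (fun j => c * v j) l = c * dst M v l := by
  simp only [dst, mul_assoc, ← Finset.mul_sum]
  ring

theorem dst_sum_gridSin {M k : ℕ} (hk : k ∈ Finset.Ioo 0 M) (c : ℕ → ℂ) :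
    dst M (fun j => ∑ l ∈ Finset.Ioo 0 M, c l * gridSin M j l) k = c k := by
  have hM : (M : ℂ) ≠ 0 := by
    simp only [Finset.mem_Ioo] at hk
    exact_mod_cast (by omega : M ≠ 0)
  unfold dst
  simp only [Finset.sum_mul]
  rw [Finset.sum_comm]
  have : ∀ l ∈ Finset.Ioo 0 M, ∑ j ∈ Finset.Ioo 0 M, c l * gridSin M j l * gridSin M j k
      = if l = k then c l * (M / 2) else 0 := fun l hl => by
    simp only [mul_assoc, ← Finset.mul_sum, sum_gridSin hl hk]
    split_ifs <;> simp
  rw [Finset.sum_congr rfl this, Finset.sum_ite_eq' _ _ _, if_pos hk]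
  field_simp

/-- The kernel sin(jlπ/M) is symmetric in j and l, so inversion is the same orthogonality with the
two indices exchanged. -/
theorem sum_dst_mul_gridSin {M j : ℕ} (hj : j ∈ Finset.Ioo 0 M) (v : ℕ → ℂ) :
    ∑ l ∈ Finset.Ioo 0 M, dst M v l * gridSin M j l = v j := by
  have h := dst_sum_gridSin hj v
  rw [← h]
  simp only [dst, Finset.sum_mul, Finset.mul_sum]
  refine Finset.sum_congr rfl fun l _ => Finset.sum_congr rfl fun i _ => ?_
  rw [gridSin_comm M i l, gridSin_comm M j l]
  ring

theorem sum_dst_mul_gridSin_of_le {M j : ℕ} (hj : j ≤ M) {v : ℕ → ℂ} (h0 : v 0 = 0)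
    (hM : v M = 0) : ∑ l ∈ Finset.Ioo 0 M, dst M v l * gridSin M j l = v j := by
  rcases Nat.eq_zero_or_pos j with rfl | hj0
  · simp [gridSin_zero, h0]
  rcases hj.eq_or_lt with rfl | hj'
  · simp [gridSin_self hj0, hM]
  · exact sum_dst_mul_gridSin (Finset.mem_Ioo.2 ⟨hj0, hj'⟩) v

theorem sum_mul_conj_eq {M : ℕ} (hM : 0 < M) (v w : ℕ → ℂ) :
    ∑ j ∈ Finset.Ioo 0 M, v j * conj (w j)
      = (M / 2 : ℂ) * ∑ l ∈ Finset.Ioo 0 M, dst M v l * conj (dst M w l) := by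
  have hM' : (M : ℂ) ≠ 0 := by exact_mod_cast hM.ne'
  have h1 : ∀ j ∈ Finset.Ioo 0 M, v j * conj (w j)
      = ∑ l ∈ Finset.Ioo 0 M, v j * gridSin M j l * conj (dst M w l) := fun j hj => by
    nth_rewrite 1 [← sum_dst_mul_gridSin hj w]
    rw [map_sum, Finset.mul_sum]
    refine Finset.sum_congr rfl fun l _ => ?_
    rw [map_mul, conj_gridSin]
    ring
  rw [Finset.sum_congr rfl h1, Finset.sum_comm, Finset.mul_sum]
  refine Finset.sum_congr rfl fun l _ => ?_
  rw [← Finset.sum_mul]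
  nth_rewrite 2 [dst]
  field_simp

/-- Discrete Parseval identity. -/
theorem sum_norm_sq_eq {M : ℕ} (hM : 0 < M) (v : ℕ → ℂ) :
    ∑ j ∈ Finset.Ioo 0 M, ‖v j‖ ^ 2 = M / 2 * ∑ l ∈ Finset.Ioo 0 M, ‖dst M v l‖ ^ 2 := by
  have h := sum_mul_conj_eq hM v v
  simp only [Complex.mul_conj, Complex.normSq_eq_norm_sq] at h
  apply Complex.ofReal_injective
  push_cast at h ⊢
  exact h

theorem sum_by_parts (v : ℕ → ℂ) (N : ℕ) :
    ∑ j ∈ Finset.range N, (v (j + 1) - v j) * conj (v (j + 1) - v j)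
      = ∑ j ∈ Finset.range N, (2 * v (j + 1) - v (j + 2) - v j) * conj (v (j + 1))
        + (v (N + 1) - v N) * conj (v N) - (v 1 - v 0) * conj (v 0) := by
  induction N with
  | zero => simp
  | succ N ih =>
    rw [Finset.sum_range_succ, ih, Finset.sum_range_succ, map_sub]
    ring

/-- The discrete `H¹` seminorm in terms of the discrete sine coefficients. -/
theorem sum_norm_sq_diff_eq {M : ℕ} (hM : 0 < M) {v : ℕ → ℂ} (h0 : v 0 = 0) (hv : v M = 0) :
    ∑ j ∈ Finset.range M, ‖v (j + 1) - v j‖ ^ 2 = M / 2 * ∑ l ∈ Finset.Ioo 0 M,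
      4 * Real.sin (l * Real.pi / (2 * M)) ^ 2 * ‖dst M v l‖ ^ 2 := by
  have hM' : (M : ℝ) ≠ 0 := by exact_mod_cast hM.ne'
  -- The negative second difference. The entry `v (M + 1)`, which has no meaning for a grid vector,
  -- occurs only in products with `v M = 0`.
  set z : ℕ → ℂ := fun i => 2 * v i - v (i + 1) - v (i - 1) with hz
  have h1 := sum_by_parts v M
  rw [hv, h0, map_zero, mul_zero, mul_zero, add_zero, sub_zero] at h1
  have h2 : ∑ j ∈ Finset.range M, (2 * v (j + 1) - v (j + 2) - v j) * conj (v (j + 1))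
      = ∑ j ∈ Finset.Ioo 0 M, z j * conj (v j) := by
    rw [sum_Ioo_eq_sum_range_succ M (fun j => z j * conj (v j)) (by simp [hv])]
    rfl
  -- The grid sines are eigenvectors of the second difference, with eigenvalue 4 sin²(lπ/2M).
  have h3 : ∀ l ∈ Finset.Ioo 0 M, dst M z l
      = (4 * Real.sin (l * Real.pi / (2 * M)) ^ 2 : ℝ) * dst M v l := fun l hl => by
    have e : ∀ i ∈ Finset.Ioo 0 M, z i = ∑ l ∈ Finset.Ioo 0 M,
        ((4 * Real.sin (l * Real.pi / (2 * M)) ^ 2 : ℝ) * dst M v l) * gridSin M i l :=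
      fun i hi => by
        simp only [Finset.mem_Ioo] at hi
        simp only [hz]
        rw [← sum_dst_mul_gridSin_of_le (j := i) (by omega) h0 hv,
          ← sum_dst_mul_gridSin_of_le (j := i + 1) (by omega) h0 hv,
          ← sum_dst_mul_gridSin_of_le (j := i - 1) (by omega) h0 hv, Finset.mul_sum,
          ← Finset.sum_sub_distrib, ← Finset.sum_sub_distrib]
        refine Finset.sum_congr rfl fun l _ => ?_
        have key : (2 * gridSin M i l - gridSin M (i + 1) l - gridSin M (i - 1) l : ℂ)
            = (4 * Real.sin (l * Real.pi / (2 * M)) ^ 2 : ℝ) * gridSin M i l := by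
          simp only [gridSin]
          have hc : ((i - 1 : ℕ) : ℝ) = i - 1 := by rw [Nat.cast_sub (by omega), Nat.cast_one]
          rw [hc, Nat.cast_add, Nat.cast_one,
            show ((i : ℝ) + 1) * l * Real.pi / M = i * l * Real.pi / M
              + 2 * (l * Real.pi / (2 * M)) by field_simp,
            show ((i : ℝ) - 1) * l * Real.pi / M = i * l * Real.pi / M
              - 2 * (l * Real.pi / (2 * M)) by field_simp,
            Real.sin_add, Real.sin_sub, Real.cos_two_mul, Real.cos_sq']
          push_cast
          ring
        linear_combination dst M v l * key
    rw [dst_congr e]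
    exact dst_sum_gridSin hl _
  have h4 : ∑ l ∈ Finset.Ioo 0 M, dst M z l * conj (dst M v l) = ∑ l ∈ Finset.Ioo 0 M,
      (4 * Real.sin (l * Real.pi / (2 * M)) ^ 2 : ℝ) * (dst M v l * conj (dst M v l)) :=
    Finset.sum_congr rfl fun l hl => by rw [h3 l hl, mul_assoc]
  rw [h2, sum_mul_conj_eq hM, h4] at h1
  simp only [Complex.mul_conj, Complex.normSq_eq_norm_sq] at h1
  apply Complex.ofReal_injective
  push_cast at h1 ⊢
  exact h1

section

variable {a b : ℝ}

theorem mu_eq {M : ℕ} (hab : a < b) (hM : 0 < M) (l : ℕ) :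
    mu a b l * ((b - a) / M) = l * Real.pi / M := by
  have : b - a ≠ 0 := by linarith
  have : (M : ℝ) ≠ 0 := by exact_mod_cast hM.ne'
  unfold mu
  field_simp

theorem sum_norm_sq_diff_le (hab : a < b) {M : ℕ} (hM : 0 < M) {v : ℕ → ℂ} (h0 : v 0 = 0)
    (hv : v M = 0) : ∑ j ∈ Finset.range M, ‖v (j + 1) - v j‖ ^ 2
      ≤ M / 2 * ((b - a) / M) ^ 2 * ∑ l ∈ Finset.Ioo 0 M, mu a b l ^ 2 * ‖dst M v l‖ ^ 2 := by
  rw [sum_norm_sq_diff_eq hM h0 hv, mul_assoc]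
  gcongr
  rw [Finset.mul_sum]
  refine Finset.sum_le_sum fun l _ => ?_
  rw [← mul_assoc]
  refine mul_le_mul_of_nonneg_right ?_ (sq_nonneg _)
  rw [← mul_pow, mul_comm (_ / _), mu_eq hab hM]
  have h1 : |Real.sin (l * Real.pi / (2 * M))| ≤ l * Real.pi / (2 * M) := by
    refine Real.abs_sin_le_abs.trans (le_of_eq (abs_of_nonneg (by positivity)))
  have h2 := pow_le_pow_left₀ (abs_nonneg _) h1 2
  rw [sq_abs] at h2
  have e : (l * Real.pi / M) ^ 2 = 4 * (l * Real.pi / (2 * M)) ^ 2 := by field_simp; norm_num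
  rw [e]
  linarith

/-- Jordan's inequality sin x ≥ 2x/π on [0, π/2] produces the factor 4/π². With the preceding bound,
from sin x ≤ x, the discrete H¹ seminorm is equivalent, uniformly in M, to the one weighted by the
exact frequencies. -/
theorem sum_mu_sq_dst_le (hab : a < b) {M : ℕ} (hM : 0 < M) {v : ℕ → ℂ} (h0 : v 0 = 0)
    (hv : v M = 0) : M / 2 * ((b - a) / M) ^ 2 * (4 / Real.pi ^ 2) *
      ∑ l ∈ Finset.Ioo 0 M, mu a b l ^ 2 * ‖dst M v l‖ ^ 2
      ≤ ∑ j ∈ Finset.range M, ‖v (j + 1) - v j‖ ^ 2 := by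
  have hM' : (0 : ℝ) < M := by exact_mod_cast hM
  rw [sum_norm_sq_diff_eq hM h0 hv, mul_assoc, mul_assoc]
  gcongr
  rw [Finset.mul_sum, Finset.mul_sum]
  refine Finset.sum_le_sum fun l hl => ?_
  have hlM : (l : ℝ) < M := by exact_mod_cast (Finset.mem_Ioo.1 hl).2
  have h1 : (l : ℝ) / M ≤ Real.sin (l * Real.pi / (2 * M)) := by
    have := Real.mul_le_sin (x := l * Real.pi / (2 * M)) (by positivity) (by
      rw [div_le_div_iff₀ (by positivity) (by positivity)]
      nlinarith [Real.pi_pos])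
    refine le_trans (le_of_eq ?_) this
    field_simp
  have h2 := pow_le_pow_left₀ (by positivity) h1 2
  have e : ((b - a) / M) ^ 2 * (4 / Real.pi ^ 2 * (mu a b l ^ 2 * ‖dst M v l‖ ^ 2))
      = 4 * (l / M : ℝ) ^ 2 * ‖dst M v l‖ ^ 2 := by
    have := mu_eq hab hM l
    have h3 : ((b - a) / M) ^ 2 * mu a b l ^ 2 = (l * Real.pi / M) ^ 2 := by
      rw [← mul_pow, mul_comm, this]
    calc _ = (((b - a) / M) ^ 2 * mu a b l ^ 2) * (4 / Real.pi ^ 2) * ‖dst M v l‖ ^ 2 := by ring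
      _ = _ := by rw [h3]; field_simp
  rw [e]
  gcongr

/-- The discrete Sobolev inequality. -/
theorem norm_sq_le_sum_diff {M : ℕ} {v : ℕ → ℂ} (h0 : v 0 = 0) {j : ℕ} (hj : j ≤ M) :
    ‖v j‖ ^ 2 ≤ M * ∑ i ∈ Finset.range M, ‖v (i + 1) - v i‖ ^ 2 := by
  have h1 : v j = ∑ i ∈ Finset.range j, (v (i + 1) - v i) := by
    rw [Finset.sum_range_sub, h0, sub_zero]
  have h2 : ‖v j‖ ≤ ∑ i ∈ Finset.range M, ‖v (i + 1) - v i‖ := by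
    rw [h1]
    refine (norm_sum_le _ _).trans (Finset.sum_le_sum_of_subset_of_nonneg ?_ fun _ _ _ =>
      norm_nonneg _)
    exact Finset.range_subset_range.2 hj
  refine (pow_le_pow_left₀ (norm_nonneg _) h2 2).trans ?_
  simpa using sq_sum_le_card_mul_sum_sq (s := Finset.range M) (f := fun i => ‖v (i + 1) - v i‖)

end

/-! ### Sine series, grid values and aliasing -/

section

variable {a b : ℝ}

theorem sineCoeff_zero (a b : ℝ) (u : ℝ → ℂ) : sineCoeff a b u 0 = 0 := by
  simp [sineCoeff, mu]

theorem integral_sq_le_of_sum_le (hab : a < b) {u : ℝ → ℂ}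
    (hu : MemLp u 2 (volume.restrict (Ioo a b))) {B : ℝ}
    (h : ∀ N, ∑ l ∈ Finset.range N, ‖sineCoeff a b u (l + 1)‖ ^ 2 ≤ B) :
    ∫ x in a..b, ‖u x‖ ^ 2 ≤ (b - a) / 2 * B := by
  have hL : 0 < b - a := by linarith
  have h1 := hasSum_trigCoeff hab true hu
  have h2 := le_of_tendsto' h1.tendsto_sum_nat h
  rw [trigCoeff_true, sineCoeff_zero] at h2
  have e : ∫ x in a..b, ‖u x‖ ^ 2
      = (b - a) / 2 * (2 / (b - a) * (∫ x in a..b, ‖u x‖ ^ 2) - ‖(0 : ℂ)‖ ^ 2 / 2) := by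
    simp; field_simp
  rw [e]
  gcongr

/-- Parseval for the cosine series of `v`, whose coefficients have modulus μ|û|. The constant mode
vanishes because ∫ v = u(b) − u(a) = 0. -/
theorem integral_deriv_sq_le_of_sum_le (hab : a < b) {u v : ℝ → ℂ} (hp : IsPrim a b u v)
    (hv : MemLp v 2 (volume.restrict (Ioo a b))) (h0 : u a = 0 ∧ u b = 0) {B : ℝ}
    (h : ∀ N, ∑ l ∈ Finset.range N, mu a b (l + 1) ^ 2 * ‖sineCoeff a b u (l + 1)‖ ^ 2 ≤ B) :
    ∫ x in a..b, ‖v x‖ ^ 2 ≤ (b - a) / 2 * B := by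
  have hL : 0 < b - a := by linarith
  have h1 := hasSum_trigCoeff hab false hv
  have h2 := le_of_tendsto' h1.tendsto_sum_nat (b := B) fun N => by
    refine le_trans (le_of_eq (Finset.sum_congr rfl fun l _ => ?_)) (h N)
    rw [← trigCoeff_true, ← mul_pow, mu_mul_norm_trigCoeff hab hp fun _ => h0]
    rfl
  have h3 : trigCoeff a b false v 0 = 0 := by
    have : ∫ x in a..b, v x = 0 := by
      rw [← hp.sub_eq ⟨le_rfl, hab.le⟩ ⟨hab.le, le_rfl⟩, h0.1, h0.2, sub_zero]
    simp [trigCoeff, mu, trig, this]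
  rw [h3] at h2
  have e : ∫ x in a..b, ‖v x‖ ^ 2
      = (b - a) / 2 * (2 / (b - a) * (∫ x in a..b, ‖v x‖ ^ 2) - ‖(0 : ℂ)‖ ^ 2 / 2) := by
    simp; field_simp
  rw [e]
  gcongr

theorem continuous_sin_mode (a b : ℝ) (l : ℕ) :
    Continuous fun x : ℝ => (Real.sin (mu a b l * (x - a)) : ℂ) := by fun_prop

theorem sineCoeff_add {u v : ℝ → ℂ} (hu : IntervalIntegrable u volume a b)
    (hv : IntervalIntegrable v volume a b) (l : ℕ) :
    sineCoeff a b (fun x => u x + v x) l = sineCoeff a b u l + sineCoeff a b v l := by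
  have hc := (continuous_sin_mode a b l).continuousOn (s := uIcc a b)
  simp only [sineCoeff, add_mul]
  rw [intervalIntegral.integral_add (hu.mul_continuousOn hc) (hv.mul_continuousOn hc), mul_add]

theorem sineCoeff_const_mul (c : ℂ) (u : ℝ → ℂ) (l : ℕ) :
    sineCoeff a b (fun x => c * u x) l = c * sineCoeff a b u l := by
  simp only [sineCoeff, mul_assoc]
  rw [intervalIntegral.integral_const_mul]
  ring

theorem sineCoeff_congr {u v : ℝ → ℂ} (hab : a ≤ b)
    (h : ∀ᵐ x ∂volume.restrict (Ioo a b), u x = v x) (l : ℕ) :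
    sineCoeff a b u l = sineCoeff a b v l := by
  unfold sineCoeff
  congr 1
  refine intervalIntegral.integral_congr_ae_restrict ?_
  rw [uIoc_of_le hab, ← restrict_Ioo_eq_restrict_Ioc]
  filter_upwards [h] with x hx
  rw [hx]

theorem sineCoeff_congr_Ioo {u v : ℝ → ℂ} (hab : a ≤ b) (h : ∀ x ∈ Ioo a b, u x = v x) (l : ℕ) :
    sineCoeff a b u l = sineCoeff a b v l :=
  sineCoeff_congr hab ((ae_restrict_mem measurableSet_Ioo).mono h) l

theorem sineCoeff_sub {u v : ℝ → ℂ} (hu : IntervalIntegrable u volume a b)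
    (hv : IntervalIntegrable v volume a b) (l : ℕ) :
    sineCoeff a b (fun x => u x - v x) l = sineCoeff a b u l - sineCoeff a b v l := by
  have := sineCoeff_add hu (hv.const_mul (-1)) l
  rw [sineCoeff_const_mul] at this
  simpa [sub_eq_add_neg] using this

theorem sineCoeff_sum {ι : Type*} (s : Finset ι) {u : ι → ℝ → ℂ}
    (hu : ∀ i ∈ s, IntervalIntegrable (u i) volume a b) (l : ℕ) :
    sineCoeff a b (fun x => ∑ i ∈ s, u i x) l = ∑ i ∈ s, sineCoeff a b (u i) l := by
  have hc := (continuous_sin_mode a b l).continuousOn (s := uIcc a b)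
  simp only [sineCoeff, Finset.sum_mul]
  rw [intervalIntegral.integral_finsetSum fun i hi => (hu i hi).mul_continuousOn hc,
    Finset.mul_sum]

theorem norm_sineCoeff_le (hab : a < b) {u : ℝ → ℂ} {B : ℝ} (h : ∀ x ∈ Icc a b, ‖u x‖ ≤ B) (l : ℕ) :
    ‖sineCoeff a b u l‖ ≤ 2 * B := by
  have hL : 0 < b - a := by linarith
  have hB : 0 ≤ B := (norm_nonneg _).trans (h a ⟨le_rfl, hab.le⟩)
  have := intervalIntegral.norm_integral_le_of_norm_le_const (a := a) (b := b)
    (f := fun x => u x * (Real.sin (mu a b l * (x - a)) : ℂ)) (C := B) fun x hx => by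
      rw [uIoc_of_le hab.le] at hx
      rw [norm_mul, Complex.norm_real]
      calc _ ≤ B * 1 := mul_le_mul (h x (Ioc_subset_Icc_self hx)) (Real.abs_sin_le_one _)
            (abs_nonneg _) hB
        _ = B := mul_one B
  rw [abs_of_pos hL] at this
  rw [sineCoeff, norm_mul, Complex.norm_real, Real.norm_of_nonneg (by positivity)]
  calc _ ≤ 2 / (b - a) * (B * (b - a)) := by gcongr
    _ = 2 * B := by field_simp

/-- For k ≠ l two integrations by parts give (μ_k² − μ_l²) c = 0. For k = l the sine and cosine
integrals coincide, and their sum is that of the constant 1. -/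
theorem sineCoeff_sin (hab : a < b) {k l : ℕ} (hl : 0 < l) :
    sineCoeff a b (fun x => (Real.sin (mu a b l * (x - a)) : ℂ)) k = if k = l then 1 else 0 := by
  have hL : 0 < b - a := by linarith
  have hml : 0 < mu a b l := by
    obtain ⟨i, rfl⟩ := Nat.exists_eq_succ_of_ne_zero hl.ne'
    exact mu_pos hab i
  have p1 := isPrim_sin (mu a b l) a b
  have p2 := (isPrim_cos (mu a b l) a b)
  have e1 : ∀ k, mu a b k * sineCoeff a b (fun x => (Real.sin (mu a b l * (x - a)) : ℂ)) k
      = mu a b l * trigCoeff a b false (fun x => (Real.cos (mu a b l * (x - a)) : ℂ)) k := by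
    intro k
    rw [← trigCoeff_true, mu_mul_trigCoeff_true hab p1]
    rw [mu_mul_length hab, Real.sin_nat_mul_pi]
    simp only [sub_self, mul_zero, Real.sin_zero, Complex.ofReal_zero, zero_add, trigCoeff]
    simp only [mul_assoc]
    rw [intervalIntegral.integral_const_mul]
    ring
  split_ifs with h
  · subst h
    have e2 := mul_left_cancel₀ (by exact_mod_cast hml.ne') (e1 k)
    have e3 : sineCoeff a b (fun x => (Real.sin (mu a b k * (x - a)) : ℂ)) k
        + trigCoeff a b false (fun x => (Real.cos (mu a b k * (x - a)) : ℂ)) k = 2 := by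
      simp only [sineCoeff, trigCoeff, trig, cond_false]
      rw [← mul_add, ← intervalIntegral.integral_add
        (Continuous.intervalIntegrable (by fun_prop) _ _)
        (Continuous.intervalIntegrable (by fun_prop) _ _)]
      have : ∀ x : ℝ, (Real.sin (mu a b k * (x - a)) : ℂ) * (Real.sin (mu a b k * (x - a)) : ℂ)
          + (Real.cos (mu a b k * (x - a)) : ℂ) * (Real.cos (mu a b k * (x - a)) : ℂ) = 1 :=
        fun x => by
          have := Real.sin_sq_add_cos_sq (mu a b k * (x - a))
          rw [← sq, ← sq]
          exact_mod_cast this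
      simp only [this, intervalIntegral.integral_const]
      have hLC : ((b : ℂ) - a) ≠ 0 := by
        rw [← Complex.ofReal_sub]; exact_mod_cast hL.ne'
      simp
      field_simp
    linear_combination (e2 + e3) / 2
  · have e2 := mu_mul_trigCoeff_false hab p2 k
    have e4 : trigCoeff a b true (fun x => -(mu a b l : ℂ) * (Real.sin (mu a b l * (x - a)) : ℂ)) k
        = -(mu a b l : ℂ) * sineCoeff a b (fun x => (Real.sin (mu a b l * (x - a)) : ℂ)) k :=
      sineCoeff_const_mul _ _ _
    rw [e4] at e2
    have e3 : ((mu a b k ^ 2 - mu a b l ^ 2 : ℝ) : ℂ)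
        * sineCoeff a b (fun x => (Real.sin (mu a b l * (x - a)) : ℂ)) k = 0 := by
      rw [Complex.ofReal_sub, Complex.ofReal_pow, Complex.ofReal_pow]
      linear_combination (mu a b k : ℂ) * e1 k + (mu a b l : ℂ) * e2
    refine (mul_eq_zero.1 e3).resolve_left ?_
    norm_cast
    intro h2
    have h3 : mu a b k = mu a b l := by
      have := mu_nonneg hab k
      exact (pow_left_inj₀ this hml.le two_ne_zero).1 (by linarith)
    unfold mu at h3
    apply h
    have h4 := Real.pi_pos
    field_simp at h3
    exact_mod_cast h3

/-- `∑_{l < M} c_l sin (μ_l (x - a))` -/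
def sinePoly (a b : ℝ) (M : ℕ) (c : ℕ → ℂ) (x : ℝ) : ℂ :=
  ∑ l ∈ Finset.Ioo 0 M, c l * (Real.sin (mu a b l * (x - a)) : ℂ)

theorem sineCoeff_sinePoly (hab : a < b) (M : ℕ) (c : ℕ → ℂ) (k : ℕ) :
    sineCoeff a b (sinePoly a b M c) k = if k ∈ Finset.Ioo 0 M then c k else 0 := by
  unfold sinePoly
  rw [sineCoeff_sum _ fun l _ => (Continuous.intervalIntegrable (by fun_prop) _ _)]
  simp only [sineCoeff_const_mul]
  rw [Finset.sum_congr rfl fun l hl => by rw [sineCoeff_sin hab (Finset.mem_Ioo.1 hl).1]]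
  simp only [mul_ite, mul_one, mul_zero]
  rw [Finset.sum_ite_eq]

theorem sinePoly_grid (hab : a < b) (M : ℕ) (c : ℕ → ℂ) (j : ℕ) :
    sinePoly a b M c (grid a b M j) = ∑ l ∈ Finset.Ioo 0 M, c l * gridSin M j l := by
  unfold sinePoly
  refine Finset.sum_congr rfl fun l hl => ?_
  have hM : 0 < M := by simp only [Finset.mem_Ioo] at hl; omega
  rw [gridSin, grid]
  congr 3
  rw [add_sub_cancel_left, mul_left_comm, mu_eq hab hM]
  ring

theorem sinePoly_left (a b : ℝ) (M : ℕ) (c : ℕ → ℂ) : sinePoly a b M c a = 0 := by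
  simp [sinePoly]

theorem sinePoly_right (hab : a < b) (M : ℕ) (c : ℕ → ℂ) : sinePoly a b M c b = 0 := by
  unfold sinePoly
  refine Finset.sum_eq_zero fun l _ => ?_
  rw [mu_mul_length hab, Real.sin_nat_mul_pi]
  simp

theorem isPrim_sinePoly (a b : ℝ) (M : ℕ) (c : ℕ → ℂ) : IsPrim a b (sinePoly a b M c)
    (fun x => ∑ l ∈ Finset.Ioo 0 M, c l * (mu a b l * (Real.cos (mu a b l * (x - a)) : ℂ))) := by
  refine isPrim_of_hasDerivAt (by fun_prop) (fun x => ?_) a b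
  unfold sinePoly
  refine HasDerivAt.fun_sum fun l _ => ?_
  have : HasDerivAt (fun x : ℝ => Real.sin (mu a b l * (x - a)))
      (Real.cos (mu a b l * (x - a)) * mu a b l) x := by
    simpa using (((hasDerivAt_id x).sub_const a).const_mul (mu a b l)).sin
  simpa [mul_comm] using (this.ofReal_comp).const_mul (c l)

/-- The sine coefficients of `u` are square summable with the weights `μ_l^{2m}`, with sum at most
`A`. -/
def CoeffBound (a b : ℝ) (m : ℕ) (u : ℝ → ℂ) (A : ℝ) : Prop :=
  ∀ N, ∑ l ∈ Finset.range N, mu a b (l + 1) ^ (2 * m) * ‖sineCoeff a b u (l + 1)‖ ^ 2 ≤ A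

theorem CoeffBound.nonneg {m : ℕ} {u : ℝ → ℂ} {A : ℝ} (h : CoeffBound a b m u A) : 0 ≤ A := by
  simpa using h 0

theorem HS.coeffBound (hab : a < b) {n : ℕ} {C : ℝ} {u : ℝ → ℂ} (h : HS a b n true C u) :
    CoeffBound a b n u (2 / (b - a) * C ^ 2) := h.sum_le hab

theorem mu_mono (hab : a < b) {k l : ℕ} (h : k ≤ l) : mu a b k ≤ mu a b l := by
  have : 0 < b - a := by linarith
  unfold mu
  gcongr

/-- Here `r` stands for `u` minus a sine polynomial with coefficients `c`. Modes below M contribute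
the coefficient errors; for modes l ≥ M the spare weight μ^{2(m−e)} is traded for its value at M. -/
theorem sum_remainder_le (hab : a < b) {M m e : ℕ} (hM : 0 < M) (he : e ≤ m) {u r : ℝ → ℂ} {A : ℝ}
    (hA : CoeffBound a b m u A) {c : ℕ → ℂ}
    (hr : ∀ k, sineCoeff a b r k
      = sineCoeff a b u k - if k ∈ Finset.Ioo 0 M then c k else 0) (N : ℕ) :
    ∑ l ∈ Finset.range N, mu a b (l + 1) ^ (2 * e) * ‖sineCoeff a b r (l + 1)‖ ^ 2
      ≤ ∑ l ∈ Finset.Ioo 0 M, mu a b l ^ (2 * e) * ‖sineCoeff a b u l - c l‖ ^ 2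
        + A / mu a b M ^ (2 * (m - e)) := by
  have hmuM : 0 < mu a b M := by
    obtain ⟨i, rfl⟩ := Nat.exists_eq_succ_of_ne_zero hM.ne'
    exact mu_pos hab i
  set G : ℕ → ℝ := fun l => mu a b l ^ (2 * e) * ‖sineCoeff a b u l - c l‖ ^ 2 with hG
  have h1 : ∀ l ∈ Finset.range N, mu a b (l + 1) ^ (2 * e) * ‖sineCoeff a b r (l + 1)‖ ^ 2
      ≤ (if l + 1 < M then G (l + 1) else 0)
        + mu a b (l + 1) ^ (2 * m) * ‖sineCoeff a b u (l + 1)‖ ^ 2 / mu a b M ^ (2 * (m - e)) := by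
    intro l _
    rw [hr]
    have hpos := mu_pos hab l
    by_cases hl : l + 1 < M
    · rw [if_pos (Finset.mem_Ioo.2 ⟨Nat.succ_pos l, hl⟩), if_pos hl]
      exact le_add_of_nonneg_right (by positivity)
    · rw [if_neg (fun h => hl (Finset.mem_Ioo.1 h).2), if_neg hl, sub_zero, zero_add,
        le_div_iff₀ (by positivity)]
      have hle := mu_mono hab (by omega : M ≤ l + 1)
      have : mu a b M ^ (2 * (m - e)) ≤ mu a b (l + 1) ^ (2 * (m - e)) := by gcongr
      calc _ = mu a b (l + 1) ^ (2 * e) * mu a b M ^ (2 * (m - e))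
              * ‖sineCoeff a b u (l + 1)‖ ^ 2 := by ring
        _ ≤ mu a b (l + 1) ^ (2 * e) * mu a b (l + 1) ^ (2 * (m - e))
              * ‖sineCoeff a b u (l + 1)‖ ^ 2 := by gcongr
        _ = _ := by rw [← pow_add]; congr 2; omega
  refine (Finset.sum_le_sum h1).trans ?_
  rw [Finset.sum_add_distrib, ← Finset.sum_div]
  have h2 : ∑ l ∈ Finset.range N, (if l + 1 < M then G (l + 1) else 0)
      ≤ ∑ l ∈ Finset.Ioo 0 M, G l := by
    rw [← Finset.sum_filter]
    have : ∑ l ∈ Finset.range N with l + 1 < M, G (l + 1)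
        = ∑ l ∈ ((Finset.range N).filter (fun l => l + 1 < M)).image (· + 1), G l := by
      rw [Finset.sum_image fun x _ y _ h => by simpa using h]
    rw [this]
    refine Finset.sum_le_sum_of_subset_of_nonneg (fun l hl => ?_) fun l _ _ => ?_
    · simp only [Finset.mem_image, Finset.mem_filter] at hl
      obtain ⟨i, hi, rfl⟩ := hl
      exact Finset.mem_Ioo.2 ⟨Nat.succ_pos i, hi.2⟩
    · have := mu_nonneg hab l
      positivity
  gcongr
  exact hA N

/-! ### Sampling on the grid and the aliasing error. -/

theorem grid_mem_Icc (hab : a < b) {M j : ℕ} (hM : 0 < M) (hj : j ≤ M) :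
    grid a b M j ∈ Icc a b := by
  have hL : 0 < b - a := by linarith
  have hM' : (0 : ℝ) < M := by exact_mod_cast hM
  have hj' : (j : ℝ) ≤ M := by exact_mod_cast hj
  have : (j : ℝ) * ((b - a) / M) ≤ b - a := by
    rw [← mul_div_assoc, div_le_iff₀ hM']
    nlinarith
  refine ⟨?_, by unfold grid; linarith⟩
  unfold grid
  have : 0 ≤ (j : ℝ) * ((b - a) / M) := by positivity
  linarith

theorem grid_mem_Ioo (hab : a < b) {M j : ℕ} (hj : j ∈ Finset.Ioo 0 M) :
    grid a b M j ∈ Ioo a b := by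
  have hL : 0 < b - a := by linarith
  simp only [Finset.mem_Ioo] at hj
  have hM' : (0 : ℝ) < M := by exact_mod_cast (by omega : 0 < M)
  have hj0 : (0 : ℝ) < j := by exact_mod_cast hj.1
  have hj' : (j : ℝ) < M := by exact_mod_cast hj.2
  have : (j : ℝ) * ((b - a) / M) < b - a := by
    rw [← mul_div_assoc, div_lt_iff₀ hM']
    nlinarith
  refine ⟨?_, by unfold grid; linarith⟩
  unfold grid
  have : 0 < (j : ℝ) * ((b - a) / M) := by positivity
  linarith

theorem grid_zero (a b : ℝ) (M : ℕ) : grid a b M 0 = a := by simp [grid]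

theorem grid_self (a b : ℝ) {M : ℕ} (hM : 0 < M) : grid a b M M = b := by
  have hM' : (M : ℝ) ≠ 0 := by exact_mod_cast hM.ne'
  unfold grid
  field_simp
  ring

theorem grid_succ_sub (a b : ℝ) (M j : ℕ) :
    grid a b M (j + 1) - grid a b M j = (b - a) / M := by
  unfold grid
  push_cast
  ring

theorem sum_integral_grid (hab : a < b) {M : ℕ} (hM : 0 < M) {g : ℝ → ℝ}
    (hg : IntervalIntegrable g volume a b) :
    ∑ j ∈ Finset.range M, ∫ x in grid a b M j..grid a b M (j + 1), g x = ∫ x in a..b, g x := by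
  rw [intervalIntegral.sum_integral_adjacent_intervals, grid_zero, grid_self a b hM]
  intro j hj
  refine hg.mono_set ?_
  rw [uIcc_of_le hab.le]
  exact ordConnected_Icc.uIcc_subset (grid_mem_Icc hab hM hj.le) (grid_mem_Icc hab hM hj)

theorem grid_le_succ (hab : a < b) {M : ℕ} (j : ℕ) :
    grid a b M j ≤ grid a b M (j + 1) := by
  have h1 := grid_succ_sub a b M j
  have : 0 ≤ (b - a) / M := div_nonneg (by linarith) (Nat.cast_nonneg _)
  linarith

theorem memLp_cell (hab : a < b) {M j : ℕ} (hM : 0 < M) (hj : j < M) {v : ℝ → ℂ}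
    (hv : MemLp v 2 (volume.restrict (Ioo a b))) :
    MemLp v 2 (volume.restrict (Ioo (grid a b M j) (grid a b M (j + 1)))) :=
  hv.mono_measure (Measure.restrict_mono
    (Ioo_subset_Ioo (grid_mem_Icc hab hM hj.le).1 (grid_mem_Icc hab hM hj).2) le_rfl)

/-- The pointwise H¹ bound applied at the left end point of each cell. Rescaling to a cell of length
h puts h² before the derivative, which balances the lost order in the aliasing estimate. -/
theorem sum_grid_sq_le (hab : a < b) {M : ℕ} (hM : 0 < M) {u v : ℝ → ℂ} (hp : IsPrim a b u v)
    (hv : MemLp v 2 (volume.restrict (Ioo a b))) :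
    (b - a) / M * ∑ j ∈ Finset.range M, ‖u (grid a b M j)‖ ^ 2
      ≤ 2 * (∫ x in a..b, ‖u x‖ ^ 2) + 2 * ((b - a) / M) ^ 2 * ∫ x in a..b, ‖v x‖ ^ 2 := by
  have hu := intervalIntegrable_sq_of_memLp hab.le (memLp_of_continuousOn (hp.continuousOn hab.le))
  rw [← sum_integral_grid hab hM hu,
    ← sum_integral_grid hab hM (intervalIntegrable_sq_of_memLp hab.le hv), Finset.mul_sum,
    Finset.mul_sum, Finset.mul_sum, ← Finset.sum_add_distrib]
  refine Finset.sum_le_sum fun j hj => ?_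
  have hj' := Finset.mem_range.1 hj
  have hle := grid_le_succ hab (M := M) j
  have := (hp.mono (grid_mem_Icc hab hM hj'.le) (grid_mem_Icc hab hM hj') hle).length_mul_sq_le
    hle (memLp_cell hab hM hj' hv) ⟨le_rfl, hle⟩
  rwa [grid_succ_sub] at this

theorem sum_grid_diff_sq_le (hab : a < b) {M : ℕ} (hM : 0 < M) {u v : ℝ → ℂ} (hp : IsPrim a b u v)
    (hv : MemLp v 2 (volume.restrict (Ioo a b))) :
    ∑ j ∈ Finset.range M, ‖u (grid a b M (j + 1)) - u (grid a b M j)‖ ^ 2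
      ≤ (b - a) / M * ∫ x in a..b, ‖v x‖ ^ 2 := by
  rw [← sum_integral_grid hab hM (intervalIntegrable_sq_of_memLp hab.le hv), Finset.mul_sum]
  refine Finset.sum_le_sum fun j hj => ?_
  have hj' := Finset.mem_range.1 hj
  have hle := grid_le_succ hab (M := M) j
  have hm := memLp_cell hab hM hj' hv
  rw [hp.sub_eq (grid_mem_Icc hab hM hj'.le) (grid_mem_Icc hab hM hj'), ← grid_succ_sub a b M j]
  exact norm_sq_integral_le hle (intervalIntegrable_of_memLp hle hm)
    (intervalIntegrable_sq_of_memLp hle hm)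

theorem HS.sum_grid_diff_sq_le (hab : a < b) {M : ℕ} (hM : 0 < M) {s : Bool} {C : ℝ} {u : ℝ → ℂ}
    (h : HS a b 1 s C u) :
    ∑ j ∈ Finset.range M, ‖u (grid a b M (j + 1)) - u (grid a b M j)‖ ^ 2
      ≤ (b - a) / M * C ^ 2 := by
  have hL : 0 < b - a := by linarith
  obtain ⟨-, -, v, h2, h3⟩ := h
  refine (NLSW.sum_grid_diff_sq_le hab hM h3 h2.2.1).trans ?_
  gcongr
  exact h2.2.2

/-- The difference of a function and a sine polynomial, together with its derivative. -/
theorem HS.exists_remainder (hab : a < b) {C : ℝ} {u : ℝ → ℂ} (hu : HS a b 1 true C u) (M : ℕ)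
    (c : ℕ → ℂ) : ∃ r', IsPrim a b (fun x => u x - sinePoly a b M c x) r' ∧
      MemLp r' 2 (volume.restrict (Ioo a b)) ∧
      (u a - sinePoly a b M c a = 0 ∧ u b - sinePoly a b M c b = 0) ∧
      ∀ k, sineCoeff a b (fun x => u x - sinePoly a b M c x) k
        = sineCoeff a b u k - if k ∈ Finset.Ioo 0 M then c k else 0 := by
  have hcu := hu.continuousOn hab.le
  obtain ⟨-, h0, v, hv, hp⟩ := hu
  have hpP := isPrim_sinePoly a b M c
  have hcP := hpP.continuousOn hab.le
  rw [← uIcc_of_le hab.le] at hcP hcu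
  have hpr := hp.add (hpP.const_mul (-1))
  simp only [neg_one_mul, ← sub_eq_add_neg] at hpr
  refine ⟨_, hpr, hv.2.1.sub (memLp_of_continuousOn (by fun_prop)), ?_, fun k => ?_⟩
  · rw [sinePoly_left, sinePoly_right hab, (h0 rfl).1, (h0 rfl).2]
    simp
  · rw [sineCoeff_sub hcu.intervalIntegrable hcP.intervalIntegrable, sineCoeff_sinePoly hab]

/-- The `L²` error of an approximation by a sine polynomial. -/
theorem integral_remainder_sq_le (hab : a < b) {M m : ℕ} (hM : 0 < M) {u : ℝ → ℂ} {A C : ℝ}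
    (hu : HS a b 1 true C u) (hA : CoeffBound a b m u A) (c : ℕ → ℂ) :
    ∫ x in a..b, ‖u x - sinePoly a b M c x‖ ^ 2
      ≤ (b - a) / 2 * (∑ l ∈ Finset.Ioo 0 M, ‖sineCoeff a b u l - c l‖ ^ 2
        + A / mu a b M ^ (2 * m)) := by
  obtain ⟨r', hp, hm, h0, hc⟩ := hu.exists_remainder hab M c
  refine integral_sq_le_of_sum_le hab (memLp_of_continuousOn (hp.continuousOn hab.le)) fun N => ?_
  simpa using sum_remainder_le hab hM (Nat.zero_le m) hA hc N

/-- The error of the derivative of an approximation by a sine polynomial. -/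
theorem integral_remainder_deriv_sq_le (hab : a < b) {M m : ℕ} (hM : 0 < M) (h1 : 1 ≤ m)
    {u : ℝ → ℂ} {A C : ℝ} (hu : HS a b 1 true C u) (hA : CoeffBound a b m u A) (c : ℕ → ℂ)
    {r' : ℝ → ℂ} (hp : IsPrim a b (fun x => u x - sinePoly a b M c x) r')
    (hm : MemLp r' 2 (volume.restrict (Ioo a b))) :
    ∫ x in a..b, ‖r' x‖ ^ 2
      ≤ (b - a) / 2 * (∑ l ∈ Finset.Ioo 0 M, mu a b l ^ 2 * ‖sineCoeff a b u l - c l‖ ^ 2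
        + A / mu a b M ^ (2 * (m - 1))) := by
  obtain ⟨-, -, -, h0, hc⟩ := hu.exists_remainder hab M c
  refine integral_deriv_sq_le_of_sum_le hab hp hm h0 fun N => ?_
  simpa using sum_remainder_le hab hM h1 hA hc N

theorem mu_pos_of_pos (hab : a < b) {M : ℕ} (hM : 0 < M) : 0 < mu a b M := by
  obtain ⟨i, rfl⟩ := Nat.exists_eq_succ_of_ne_zero hM.ne'
  exact mu_pos hab i

/-- The sine interpolation error in terms of the sine coefficients. -/
theorem sum_aliasing_le (hab : a < b) {M m : ℕ} (hM : 0 < M) (hm : 1 ≤ m) {u : ℝ → ℂ} {A C : ℝ}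
    (hu : HS a b 1 true C u) (hA : CoeffBound a b m u A) :
    ∑ l ∈ Finset.Ioo 0 M, ‖sineCoeff a b u l - dst M (fun j => u (grid a b M j)) l‖ ^ 2
      ≤ 2 * (1 + Real.pi ^ 2) * A / mu a b M ^ (2 * m) := by
  have hL : 0 < b - a := by linarith
  have hM' : (0 : ℝ) < M := by exact_mod_cast hM
  have hmuM := mu_pos_of_pos hab hM
  -- The remainder `r` of the truncated sine series is sampled instead of `u`. The grid transform
  -- reproduces the sine polynomial exactly, so the coefficient error is minus the transform of the
  -- samples of `r`. Discrete Parseval bounds it by ‖r‖² + h²‖r'‖², and both terms are O(μ_M^{−2m})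
  -- because μ_M h = π.
  set c := sineCoeff a b u with hc
  obtain ⟨r', hp, hr'm, hr0, -⟩ := hu.exists_remainder hab M c
  have i0 := integral_remainder_sq_le hab hM hu hA c
  have i1 := integral_remainder_deriv_sq_le hab hM hm hu hA c hp hr'm
  simp only [← hc, sub_self, norm_zero, ne_eq, OfNat.ofNat_ne_zero, not_false_eq_true, zero_pow,
    mul_zero, Finset.sum_const_zero, zero_add] at i0 i1
  have hgrid := sum_grid_sq_le hab hM hp hr'm
  have hrg : ∀ k ∈ Finset.Ioo 0 M, c k - dst M (fun j => u (grid a b M j)) k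
      = -dst M (fun j => u (grid a b M j) - sinePoly a b M c (grid a b M j)) k := fun k hk => by
    rw [dst_sub]
    simp only [sinePoly_grid hab]
    rw [dst_sum_gridSin hk]
    ring
  rw [Finset.sum_congr rfl fun k hk => by rw [hrg k hk, norm_neg]]
  have hpars := sum_norm_sq_eq hM fun j => u (grid a b M j) - sinePoly a b M c (grid a b M j)
  rw [sum_Ioo_eq_sum_range _ _ (by rw [grid_zero, hr0.1]; simp)] at hpars
  rw [hpars] at hgrid
  have hmu : mu a b M * ((b - a) / M) = Real.pi := by
    rw [mu_eq hab hM]; field_simp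
  have e1 : ((b - a) / M) ^ 2 * (A / mu a b M ^ (2 * (m - 1)))
      = Real.pi ^ 2 * (A / mu a b M ^ (2 * m)) := by
    rw [← hmu, show 2 * m = 2 * (m - 1) + 2 by omega, pow_add]
    field_simp
  set S := ∑ l ∈ Finset.Ioo 0 M,
    ‖dst M (fun j => u (grid a b M j) - sinePoly a b M c (grid a b M j)) l‖ ^ 2
  have e2 : (b - a) / M * (M / 2 * S) = (b - a) / 2 * S := by field_simp
  rw [e2] at hgrid
  have : (b - a) / 2 * S
      ≤ (b - a) / 2 * (2 * (1 + Real.pi ^ 2) * A / mu a b M ^ (2 * m)) := by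
    refine hgrid.trans ?_
    calc _ ≤ 2 * ((b - a) / 2 * (A / mu a b M ^ (2 * m)))
          + 2 * ((b - a) / M) ^ 2 * ((b - a) / 2 * (A / mu a b M ^ (2 * (m - 1)))) := by gcongr
      _ = 2 * ((b - a) / 2 * (A / mu a b M ^ (2 * m)))
          + (b - a) * (((b - a) / M) ^ 2 * (A / mu a b M ^ (2 * (m - 1)))) := by ring
      _ = _ := by rw [e1]; ring
  exact le_of_mul_le_mul_left this (by positivity)

/-- An inverse inequality: only frequencies below μ_M occur, so the weight costs at most μ_M^{2e}.
-/
theorem sum_mu_aliasing_le (hab : a < b) {M m : ℕ} (hM : 0 < M) {e : ℕ} (hm : 1 ≤ m)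
    (he : e ≤ m) {u : ℝ → ℂ} {A C : ℝ} (hu : HS a b 1 true C u) (hA : CoeffBound a b m u A) :
    ∑ l ∈ Finset.Ioo 0 M, mu a b l ^ (2 * e)
        * ‖sineCoeff a b u l - dst M (fun j => u (grid a b M j)) l‖ ^ 2
      ≤ 2 * (1 + Real.pi ^ 2) * A / mu a b M ^ (2 * (m - e)) := by
  have hmuM : 0 < mu a b M := by
    obtain ⟨i, rfl⟩ := Nat.exists_eq_succ_of_ne_zero hM.ne'
    exact mu_pos hab i
  calc _ ≤ ∑ l ∈ Finset.Ioo 0 M, mu a b M ^ (2 * e)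
        * ‖sineCoeff a b u l - dst M (fun j => u (grid a b M j)) l‖ ^ 2 := by
        refine Finset.sum_le_sum fun l hl => ?_
        have h1 := mu_mono hab (Finset.mem_Ioo.1 hl).2.le
        have h2 := mu_nonneg hab l
        gcongr
    _ ≤ mu a b M ^ (2 * e) * (2 * (1 + Real.pi ^ 2) * A / mu a b M ^ (2 * m)) := by
        rw [← Finset.mul_sum]
        gcongr
        exact sum_aliasing_le hab hM hm hu hA
    _ = _ := by
        rw [show 2 * m = 2 * (m - e) + 2 * e by omega, pow_add]
        field_simp

theorem tendsto_mu_atTop (hab : a < b) :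
    Filter.Tendsto (fun N : ℕ => mu a b N) Filter.atTop Filter.atTop := by
  have hL : 0 < b - a := by linarith
  have h1 : (fun N : ℕ => mu a b N) = fun N : ℕ => Real.pi / (b - a) * (N : ℝ) := by
    ext N; unfold mu; ring
  rw [h1]
  exact tendsto_natCast_atTop_atTop.const_mul_atTop (div_pos Real.pi_pos hL)

theorem tendsto_dst (hab : a < b) {u : ℝ → ℂ} {C : ℝ} (hu : HS a b 1 true C u) (l : ℕ) :
    Filter.Tendsto (fun N : ℕ => dst N (fun j => u (grid a b N j)) l)
      Filter.atTop (nhds (sineCoeff a b u l)) := by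
  rcases Nat.eq_zero_or_pos l with rfl | hl
  · have : ∀ N : ℕ, dst N (fun j => u (grid a b N j)) 0 = 0 := fun N => by simp [dst, gridSin]
    simp only [this, sineCoeff_zero]
    exact tendsto_const_nhds
  rw [tendsto_iff_norm_sub_tendsto_zero]
  set A := 2 / (b - a) * C ^ 2
  have h0 : Filter.Tendsto (fun N : ℕ => 2 * (1 + Real.pi ^ 2) * A / mu a b N ^ (2 * 1))
      Filter.atTop (nhds 0) :=
    Filter.Tendsto.const_div_atTop
      ((Filter.tendsto_pow_atTop (by norm_num)).comp (tendsto_mu_atTop hab)) _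
  have h1 : Filter.Tendsto (fun N : ℕ => ‖dst N (fun j => u (grid a b N j)) l
      - sineCoeff a b u l‖ ^ 2) Filter.atTop (nhds 0) := by
    refine squeeze_zero' (Filter.Eventually.of_forall fun _ => sq_nonneg _) ?_ h0
    filter_upwards [Filter.eventually_gt_atTop l] with N hN
    rw [norm_sub_rev]
    exact (Finset.single_le_sum (f := fun k => ‖sineCoeff a b u k
      - dst N (fun j => u (grid a b N j)) k‖ ^ 2) (fun _ _ => sq_nonneg _)
      (Finset.mem_Ioo.2 ⟨hl, hN⟩ : l ∈ Finset.Ioo 0 N)).trans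
        (sum_aliasing_le hab (by omega) le_rfl hu (hu.coeffBound hab))
  simpa [Real.sqrt_sq] using h1.sqrt

end

/-! ### The time evolution of the sine coefficients -/

theorem cis_add (x y : ℝ) : cis (x + y) = cis x * cis y := by
  unfold cis
  rw [← Complex.exp_add]
  push_cast
  ring_nf

theorem cis_zero : cis 0 = 1 := by simp [cis]

theorem norm_cis (x : ℝ) : ‖cis x‖ = 1 := by
  unfold cis
  rw [mul_comm, Complex.norm_exp_ofReal_mul_I]

theorem cis_ne_zero (x : ℝ) : cis x ≠ 0 := Complex.exp_ne_zero _

theorem cis_mul_cis_neg (x : ℝ) : cis x * cis (-x) = 1 := by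
  rw [← cis_add, add_neg_cancel, cis_zero]

theorem continuous_cis : Continuous cis := by
  unfold cis
  fun_prop

theorem hasDerivAt_cis_mul (β x : ℝ) :
    HasDerivAt (fun r : ℝ => cis (r * β)) (Complex.I * β * cis (x * β)) x := by
  have h1 : HasDerivAt (fun r : ℝ => ((r * β : ℝ) : ℂ)) (β : ℂ) x := by
    have : HasDerivAt (fun r : ℝ => r * β) β x := by simpa using (hasDerivAt_id x).mul_const β
    exact this.ofReal_comp
  have h2 := (h1.const_mul Complex.I).cexp
  rw [mul_comm] at h2
  exact h2

/-- The product e^{−iβt} z has derivative e^{−iβt} φ almost everywhere, and it is the integral of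
that derivative because `z` is absolutely continuous. -/
theorem variation_of_constants {T β : ℝ} {z φ : ℝ → ℂ}
    (hz : IsPrim 0 T z (fun t => Complex.I * β * z t + φ t)) {t s : ℝ} (ht : 0 ≤ t) (hs : 0 ≤ s)
    (hts : t + s ≤ T) :
    z (t + s) = cis (s * β) * z t + ∫ r in (0 : ℝ)..s, cis ((s - r) * β) * φ (t + r) := by
  have hT : 0 ≤ T := by linarith
  have hc : IsPrim 0 T (fun r : ℝ => cis (r * -β))
      (fun r : ℝ => Complex.I * (-β : ℝ) * cis (r * -β)) :=
    isPrim_of_hasDerivAt (by have := continuous_cis; fun_prop) (hasDerivAt_cis_mul (-β)) 0 T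
  have hw := (hc.mul hT hz).congr hT (v' := fun r => cis (r * -β) * φ r) (fun _ _ => rfl)
    (Filter.Eventually.of_forall fun r => by push_cast; ring)
  have h1 := hw.sub_eq (x := t) (y := t + s) ⟨ht, by linarith⟩ ⟨by linarith, hts⟩
  have h2 : ∫ r in t..t + s, cis (r * -β) * φ r
      = ∫ r in (0 : ℝ)..s, cis ((t + r) * -β) * φ (t + r) := by
    rw [intervalIntegral.integral_comp_add_left (fun r => cis (r * -β) * φ r) t, add_zero]
  rw [h2] at h1
  have h3 := congrArg (fun x => cis ((t + s) * β) * x) h1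
  have e1 : cis ((t + s) * β) * cis ((t + s) * -β) = 1 := by
    rw [mul_neg, cis_mul_cis_neg]
  have e2 : cis ((t + s) * β) * cis (t * -β) = cis (s * β) := by
    rw [← cis_add]; congr 1; ring
  have e3 : cis ((t + s) * β) * ∫ r in (0 : ℝ)..s, cis ((t + r) * -β) * φ (t + r)
      = ∫ r in (0 : ℝ)..s, cis ((s - r) * β) * φ (t + r) := by
    rw [← intervalIntegral.integral_const_mul]
    congr 1; ext r
    rw [← mul_assoc, ← cis_add]
    congr 2; ring
  simp only [mul_sub, e3, ← mul_assoc, e1, e2, one_mul] at h3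
  rw [← h3]
  ring

/-! ### The characteristic roots, that is, the zeros of ε²β² − β − μ². -/

section beta

variable (a b ε : ℝ) (l : ℕ)

theorem betaPlus_add_betaMinus : betaPlus a b ε l + betaMinus a b ε l = 1 / ε ^ 2 := by
  unfold betaPlus betaMinus
  rw [← add_div]
  ring_nf

theorem betaPlus_mul_betaMinus : betaPlus a b ε l * betaMinus a b ε l = -(mu a b l ^ 2 / ε ^ 2) := by
  rcases eq_or_ne ε 0 with rfl | hε
  · simp [betaPlus, betaMinus]
  unfold betaPlus betaMinus
  have := Real.sq_sqrt (show 0 ≤ 1 + 4 * ε ^ 2 * mu a b l ^ 2 by positivity)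
  field_simp
  linear_combination -this

theorem sq_mul_delta (hε : 0 < ε) :
    ε ^ 2 * delta a b ε l = √(1 + 4 * ε ^ 2 * mu a b l ^ 2) := by
  unfold delta betaPlus betaMinus
  field_simp
  ring

/-- This quantity is the divisor when a sine coefficient is recovered from the two modes, so the
lower bound 1 is what makes stability uniform in ε. -/
theorem one_le_sq_mul_delta (hε : 0 < ε) : 1 ≤ ε ^ 2 * delta a b ε l := by
  rw [sq_mul_delta a b ε l hε, Real.one_le_sqrt]
  have : 0 ≤ 4 * ε ^ 2 * mu a b l ^ 2 := by positivity
  linarith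

theorem delta_pos (hε : 0 < ε) : 0 < delta a b ε l := by
  have h := one_le_sq_mul_delta a b ε l hε
  by_contra hd
  have : ε ^ 2 * delta a b ε l ≤ 0 := mul_nonpos_of_nonneg_of_nonpos (sq_nonneg _) (not_lt.1 hd)
  linarith

/-- Gains one power of μ at the price of ε⁻¹, and so serves only where ε is fixed, in the recovery
of the traces. -/
theorem two_mul_mu_le (hε : 0 < ε) : 2 * mu a b l ≤ ε * delta a b ε l := by
  have h := sq_mul_delta a b ε l hε
  have h1 : 2 * ε * mu a b l ≤ √(1 + 4 * ε ^ 2 * mu a b l ^ 2) :=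
    Real.le_sqrt_of_sq_le (by nlinarith)
  rw [← h] at h1
  have : ε * (2 * mu a b l) ≤ ε * (ε * delta a b ε l) := by linarith
  exact le_of_mul_le_mul_left this hε

theorem abs_betaPlus_le_delta (hε : 0 < ε) : |betaPlus a b ε l| ≤ delta a b ε l := by
  have h1 : 1 ≤ √(1 + 4 * ε ^ 2 * mu a b l ^ 2) := by
    rw [← sq_mul_delta a b ε l hε]; exact one_le_sq_mul_delta a b ε l hε
  have h2 : 0 < ε ^ 2 := by positivity
  unfold delta betaPlus betaMinus
  rw [abs_of_nonneg (by positivity), ← sub_div]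
  gcongr
  linarith

theorem abs_betaMinus_le_delta (hε : 0 < ε) : |betaMinus a b ε l| ≤ delta a b ε l := by
  have h1 : 1 ≤ √(1 + 4 * ε ^ 2 * mu a b l ^ 2) := by
    rw [← sq_mul_delta a b ε l hε]; exact one_le_sq_mul_delta a b ε l hε
  have h2 : 0 < ε ^ 2 := by positivity
  unfold delta betaPlus betaMinus
  rw [abs_div, abs_of_nonneg (by positivity : 0 ≤ 2 * ε ^ 2), ← sub_div, abs_sub_comm,
    abs_of_nonneg (by linarith)]
  refine div_le_div_of_nonneg_right ?_ (by positivity)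
  linarith

variable {a b ε}

theorem sq_mul_delta_le (hab : a < b) (hε : 0 < ε) (hε1 : ε ≤ 1) :
    ε ^ 2 * delta a b ε l ≤ 1 + 2 * mu a b l := by
  have hm := mu_nonneg hab l
  rw [sq_mul_delta a b ε l hε]
  refine Real.sqrt_le_iff.2 ⟨by positivity, ?_⟩
  have : ε ^ 2 ≤ 1 := pow_le_one₀ hε.le hε1
  nlinarith [mul_nonneg (sub_nonneg.2 this) (sq_nonneg (mu a b l))]

theorem betaMinus_ne_zero (hab : a < b) (hε : 0 < ε) {l : ℕ} (hl : 0 < l) :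
    betaMinus a b ε l ≠ 0 := by
  intro h
  have h1 := betaPlus_mul_betaMinus a b ε l
  rw [h, mul_zero] at h1
  have := mu_pos_of_pos hab hl
  have : 0 < mu a b l ^ 2 / ε ^ 2 := by positivity
  linarith

theorem betaPlus_pos (hε : 0 < ε) (l : ℕ) : 0 < betaPlus a b ε l := by
  unfold betaPlus
  positivity

end beta

theorem norm_dst_le {M : ℕ} {v : ℕ → ℂ} {B : ℝ} (hB : 0 ≤ B) (h : ∀ j ∈ Finset.Ioo 0 M, ‖v j‖ ≤ B)
    (l : ℕ) : ‖dst M v l‖ ≤ 2 * B := by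
  rcases Nat.eq_zero_or_pos M with rfl | hM
  · simp [dst]; exact hB
  have hM' : (0 : ℝ) < M := by exact_mod_cast hM
  have h1 : ‖∑ j ∈ Finset.Ioo 0 M, v j * gridSin M j l‖ ≤ M * B := by
    refine (norm_sum_le_of_le (f := fun j => v j * gridSin M j l) _ (fun j hj => ?_)).trans
      (b := ∑ j ∈ Finset.Ioo 0 M, B) ?_
    · rw [norm_mul]
      exact mul_le_of_le_one_right (norm_nonneg _) (norm_gridSin_le M j l) |>.trans (h j hj)
    · rw [Finset.sum_const, nsmul_eq_mul, Nat.card_Ioo]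
      gcongr
      omega
  rw [dst, norm_mul, norm_div]
  simp only [Complex.norm_ofNat, Complex.norm_natCast]
  calc _ ≤ 2 / M * (M * B) := by gcongr
    _ = 2 * B := by field_simp

/-! ### Differentiation in time of the sine coefficients. -/

section time

variable {a b T : ℝ}

theorem IsTimeDeriv.isPrim {u v : ℝ → ℝ → ℂ} (h : IsTimeDeriv a b T u v) {x : ℝ}
    (hx : x ∈ Icc a b) : IsPrim 0 T (fun t => u t x) (fun t => v t x) := h x hx

/-- Time derivatives are given for each x separately, without joint measurability, so the two
integrals cannot be exchanged by Fubini's theorem. The grid transforms are finite sums and commute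
with the time integral; they converge to the sine coefficients and are bounded by 2C, so dominated
convergence passes the identity to the limit. -/
theorem IsTimeDeriv.isPrim_sineCoeff (hab : a < b) (hT : 0 ≤ T) {u v : ℝ → ℝ → ℂ} {C : ℝ}
    (h : IsTimeDeriv a b T u v) (hu : ∀ t ∈ Icc 0 T, HS a b 1 true C (u t))
    (hv : ∀ᵐ t ∂volume.restrict (Icc 0 T), HS a b 1 true C (v t)) (l : ℕ) :
    IsPrim 0 T (fun t => sineCoeff a b (u t) l) (fun t => sineCoeff a b (v t) l) := by
  have hC : 0 ≤ C := (hu 0 ⟨le_rfl, hT⟩).nonneg hab.le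
  have hv' : ∀ᵐ t ∂volume.restrict (uIoc 0 T), HS a b 1 true C (v t) := by
    rw [uIoc_of_le hT]
    exact ae_restrict_of_ae_restrict_of_subset Ioc_subset_Icc_self hv
  have hint : ∀ N, ∀ t ∈ Icc 0 T,
      IntervalIntegrable (fun s => dst N (fun j => v s (grid a b N j)) l) volume 0 t ∧
      dst N (fun j => u t (grid a b N j)) l = dst N (fun j => u 0 (grid a b N j)) l
        + ∫ s in (0 : ℝ)..t, dst N (fun j => v s (grid a b N j)) l := by
    intro N t ht
    have hi : ∀ j ∈ Finset.Ioo 0 N, IntervalIntegrable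
        (fun s => v s (grid a b N j) * gridSin N j l) volume 0 t := fun j hj =>
      ((h.isPrim (Ioo_subset_Icc_self (grid_mem_Ioo hab hj))).integrable_sub ⟨le_rfl, hT⟩
        ht).mul_const _
    refine ⟨?_, ?_⟩
    · unfold dst
      refine IntervalIntegrable.const_mul ?_ _
      refine (IntervalIntegrable.sum _ hi).congr fun s _ => ?_
      simp [Finset.sum_apply]
    · unfold dst
      rw [intervalIntegral.integral_const_mul, intervalIntegral.integral_finsetSum hi, ← mul_add,
        ← Finset.sum_add_distrib]
      congr 1
      refine Finset.sum_congr rfl fun j hj => ?_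
      rw [intervalIntegral.integral_mul_const,
        (h.isPrim (Ioo_subset_Icc_self (grid_mem_Ioo hab hj))).2 t ht, add_mul]
  have hlim : ∀ᵐ t ∂volume.restrict (uIoc 0 T), Filter.Tendsto
      (fun N => dst N (fun j => v t (grid a b N j)) l) Filter.atTop
        (nhds (sineCoeff a b (v t) l)) := by
    filter_upwards [hv'] with t ht using tendsto_dst hab ht l
  have hbd : ∀ N, ∀ᵐ t ∂volume.restrict (uIoc 0 T),
      ‖dst N (fun j => v t (grid a b N j)) l‖ ≤ 2 * C := fun N => by
    filter_upwards [hv'] with t ht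
    exact norm_dst_le hC (fun j hj => ht.1 _ (Ioo_subset_Icc_self (grid_mem_Ioo hab hj))) l
  have hmeas : AEStronglyMeasurable (fun t => sineCoeff a b (v t) l)
      (volume.restrict (uIoc 0 T)) :=
    aestronglyMeasurable_of_tendsto_ae _ (fun N => ((hint N T ⟨hT, le_rfl⟩).1.def').1) hlim
  have hbv : ∀ᵐ t ∂volume.restrict (uIoc 0 T), ‖sineCoeff a b (v t) l‖ ≤ 2 * C := by
    filter_upwards [hv'] with t ht using norm_sineCoeff_le hab ht.1 l
  refine ⟨?_, fun t ht => ?_⟩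
  · rw [intervalIntegrable_iff]
    have : IsFiniteMeasure (volume.restrict (uIoc 0 T)) := by rw [uIoc_of_le hT]; infer_instance
    exact Integrable.of_bound hmeas _ hbv
  · have hsub : uIoc 0 t ⊆ uIoc 0 T := by
      rw [uIoc_of_le hT, uIoc_of_le ht.1]
      exact Ioc_subset_Ioc_right ht.2
    have h1 := intervalIntegral.tendsto_integral_filter_of_dominated_convergence (μ := volume)
      (a := 0) (b := t) (F := fun N s => dst N (fun j => v s (grid a b N j)) l)
      (f := fun s => sineCoeff a b (v s) l) (l := Filter.atTop) (fun _ => 2 * C)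
      (Filter.Eventually.of_forall fun N => (hint N t ht).1.def'.1)
      (Filter.Eventually.of_forall fun N => (ae_restrict_iff' measurableSet_uIoc).1
        (ae_restrict_of_ae_restrict_of_subset hsub (hbd N)))
      (by simp) ((ae_restrict_iff' measurableSet_uIoc).1
        (ae_restrict_of_ae_restrict_of_subset hsub hlim))
    have h2 := (tendsto_dst hab (hu 0 ⟨le_rfl, hT⟩) l).add h1
    have h3 := tendsto_dst hab (hu t ht) l
    refine tendsto_nhds_unique h3 (h2.congr fun N => ?_)
    exact ((hint N t ht).2).symm

theorem IsPrim.eq_zero_of_eq_zero {u v w : ℝ → ℂ} (hT : 0 < T) (h : IsPrim 0 T u v)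
    (hvw : IsPrim 0 T v w) (hu : ∀ t ∈ Icc 0 T, u t = 0) : ∀ t ∈ Icc 0 T, v t = 0 := by
  have h1 := ae_eq_zero_of_forall_integral_eq_zero h.1 fun t ht => by
    rw [← h.sub_eq ⟨le_rfl, hT.le⟩ ht, hu t ht, hu 0 ⟨le_rfl, hT.le⟩, sub_zero]
  exact Measure.eqOn_Icc_of_ae_eq volume hT.ne h1 (hvw.continuousOn hT.le) continuousOn_const

theorem IsPrim.norm_sub_le {E : Type*} [NormedAddCommGroup E] [NormedSpace ℝ E] {u v : ℝ → E}
    {C : ℝ} (h : IsPrim 0 T u v) (hC : ∀ᵐ t ∂volume.restrict (Icc 0 T), ‖v t‖ ≤ C) {s t : ℝ}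
    (hs : s ∈ Icc 0 T) (ht : t ∈ Icc 0 T) : ‖u t - u s‖ ≤ C * |t - s| := by
  rw [h.sub_eq hs ht]
  refine intervalIntegral.norm_integral_le_of_norm_le_const_ae ?_
  refine (ae_restrict_iff' measurableSet_uIoc).1 (ae_restrict_of_ae_restrict_of_subset ?_ hC)
  exact uIoc_subset_uIcc.trans (ordConnected_Icc.uIcc_subset hs ht)

/-- The map z ↦ |z|² is smooth with values in [0,∞), so regularity of `f` up to the end point 0 is
all that is needed. -/
theorem contDiff_nonlin {k : ℕ} {f : ℝ → ℝ} (hf : ContDiffOn ℝ k f (Ici 0)) :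
    ContDiff ℝ k (nonlin f) := by
  have h1 : ContDiff ℝ k fun z : ℂ => f (‖z‖ ^ 2) := by
    have : ContDiffOn ℝ k (fun z : ℂ => f (‖z‖ ^ 2)) univ :=
      hf.comp (contDiff_norm_sq ℝ).contDiffOn fun z _ => sq_nonneg ‖z‖
    exact contDiffOn_univ.1 this
  exact (Complex.ofRealCLM.contDiff.comp h1).mul contDiff_id

theorem exists_lipschitz_nonlin {f : ℝ → ℝ} (hf : ContDiffOn ℝ (1 : ℕ) f (Ici 0)) (R : ℝ) :
    ∃ K : ℝ, 0 ≤ K ∧ ∀ z w : ℂ, ‖z‖ ≤ R → ‖w‖ ≤ R →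
      ‖nonlin f z - nonlin f w‖ ≤ K * ‖z - w‖ := by
  obtain ⟨K, hK⟩ := (contDiff_nonlin hf).contDiffOn.exists_lipschitzOnWith (by simp)
    (convex_closedBall (0 : ℂ) R) (isCompact_closedBall _ _)
  refine ⟨K, K.2, fun z w hz hw => ?_⟩
  have := hK.dist_le_mul z (by simpa using hz) w (by simpa using hw)
  simpa [dist_eq_norm] using this

end time

/-! ### Regularity of the waves -/

variable {a b T : ℝ}

theorem HNormLe.of_le (hab : a < b) {m n : ℕ} (hn : n ≤ m) {u : ℝ → ℂ} {C : ℝ}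
    (h : HNormLe a b m u C) : HNormLe a b n u C := by
  obtain ⟨g, hg, hC⟩ := h
  refine ⟨g, ⟨hg.zero, fun j hj => hg.succ j (by omega), hg.memLp_of_le hab.le hn⟩,
    (Real.sqrt_le_sqrt (Finset.sum_le_sum_of_subset_of_nonneg ?_ fun j _ _ => ?_)).trans hC⟩
  · exact Finset.range_mono (by omega)
  · exact intervalIntegral.integral_nonneg hab.le fun x _ => sq_nonneg _

theorem HS.exists_of_le (hab : a ≤ b) {m n : ℕ} (hn : n ≤ m) {s : Bool} {u : ℝ → ℂ} {C : ℝ}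
    (h : HS a b m s C u) : ∃ C', HS a b n s C' u := by
  induction m, hn using Nat.le_induction generalizing C with
  | base => exact ⟨C, h⟩
  | succ m _ ih => exact ih (h.lower hab)

theorem HS.intervalIntegrable (hab : a ≤ b) {n : ℕ} {s : Bool} {C : ℝ} {u : ℝ → ℂ}
    (h : HS a b n s C u) : IntervalIntegrable u volume a b :=
  intervalIntegrable_of_memLp hab (h.memLp hab)

/-- Only `u` has to vanish at the ends: the other integration by parts has the sine in its boundary
term. -/
theorem sineCoeff_deriv_two (hab : a < b) {u v w : ℝ → ℂ} (hu : IsPrim a b u v)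
    (hv : IsPrim a b v w) (h0 : u a = 0 ∧ u b = 0) (l : ℕ) :
    sineCoeff a b w l = -(mu a b l : ℂ) ^ 2 * sineCoeff a b u l := by
  have h1 := mu_mul_trigCoeff_true hab hu l
  have h2 := mu_mul_trigCoeff_false hab hv l
  rw [h0.1, h0.2, trigCoeff_true] at h1
  rw [trigCoeff_true] at h2
  linear_combination h2 + (mu a b l : ℂ) * h1

/-- A solution of the wave equation in the Fourier variable, with the bounds that make its sine
coefficients differentiable in time. -/
structure IsRegularWave (f : ℝ → ℝ) (a b T ε C : ℝ) (u ut utt : ℝ → ℝ → ℂ) : Prop where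
  deriv_one : IsTimeDeriv a b T u ut
  deriv_two : IsTimeDeriv a b T ut utt
  value : ∀ t ∈ Icc 0 T, HS a b 1 true C (u t)
  velocity : ∀ t ∈ Icc 0 T, HS a b 1 true C (ut t)
  acceleration : ∀ᵐ t ∂volume.restrict (Icc 0 T), HS a b 1 true C (utt t)
  equation : ∀ l, ∀ᵐ t ∂volume.restrict (Ioo 0 T),
    Complex.I * sineCoeff a b (ut t) l - (ε : ℂ) ^ 2 * sineCoeff a b (utt t) l
      - (mu a b l : ℂ) ^ 2 * sineCoeff a b (u t) l
      + sineCoeff a b (fun x => nonlin f (u t x)) l = 0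

/-- The point is that the time derivatives vanish at the end points too. This follows by
differentiating the Dirichlet condition in time, at every time for the velocity, which is continuous
there, and at almost every time for the acceleration. -/
theorem IsNLSWSolution.isRegularWave (hab : a < b) (hT : 0 < T) {f : ℝ → ℝ} (hf : Continuous (nonlin f))
    {ε C C' : ℝ} {u₀ u₁ : ℝ → ℂ} {u ut utt : ℝ → ℝ → ℂ}
    (h : IsNLSWSolution f a b T ε u₀ u₁ u ut utt)
    (hu : ∀ t ∈ Icc 0 T, HNormLe a b 1 (u t) C) (hut : ∀ t ∈ Icc 0 T, HNormLe a b 1 (ut t) C)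
    (hutt : ∀ᵐ t ∂volume.restrict (Icc 0 T), HNormLe a b 1 (utt t) C')
    (hC : C ≤ C') :
    IsRegularWave f a b T ε (embConst a b * C') u ut utt := by
  have hE : embConst a b * C ≤ embConst a b * C' :=
    mul_le_mul_of_nonneg_left hC (zero_le_one.trans (one_le_embConst hab))
  have ha : a ∈ Icc a b := ⟨le_rfl, hab.le⟩
  have hb : b ∈ Icc a b := ⟨hab.le, le_rfl⟩
  have z1 : ∀ x ∈ Icc a b, (∀ t ∈ Icc 0 T, u t x = 0) → ∀ t ∈ Icc 0 T, ut t x = 0 := fun x hx h0 =>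
    (h.deriv_one.isPrim hx).eq_zero_of_eq_zero hT (h.deriv_two.isPrim hx) h0
  have z2 : ∀ x ∈ Icc a b, (∀ t ∈ Icc 0 T, ut t x = 0) →
      ∀ᵐ t ∂volume.restrict (Icc 0 T), utt t x = 0 := fun x hx h0 => by
    have hp := h.deriv_two.isPrim hx
    refine ae_eq_zero_of_forall_integral_eq_zero hp.1 fun t ht => ?_
    have := hp.sub_eq ⟨le_rfl, hT.le⟩ ht
    rw [← this, h0 t ht, h0 0 ⟨le_rfl, hT.le⟩, sub_zero]
  have za := z1 a ha fun t ht => (h.dirichlet t ht).1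
  have zb := z1 b hb fun t ht => (h.dirichlet t ht).2
  have v0 : ∀ t ∈ Icc 0 T, HS a b 1 true (embConst a b * C') (u t) := fun t ht =>
    ((hu t ht).hs_one hab (h.dirichlet t ht)).mono hE
  have v1 : ∀ t ∈ Icc 0 T, HS a b 1 true (embConst a b * C') (ut t) := fun t ht =>
    ((hut t ht).hs_one hab ⟨za t ht, zb t ht⟩).mono hE
  have v2 : ∀ᵐ t ∂volume.restrict (Icc 0 T), HS a b 1 true (embConst a b * C') (utt t) := by
    filter_upwards [hutt, z2 a ha za, z2 b hb zb] with t h1 h2 h3 using h1.hs_one hab ⟨h2, h3⟩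
  refine ⟨h.deriv_one, h.deriv_two, v0, v1, v2, fun l => ?_⟩
  filter_upwards [h.equation, ae_restrict_of_ae_restrict_of_subset Ioo_subset_Icc_self v2,
    ae_restrict_mem measurableSet_Ioo] with t ht h2 htm
  obtain ⟨g, hg, he⟩ := ht
  have htm' := Ioo_subset_Icc_self htm
  have i1 := (v1 t htm').intervalIntegrable hab.le
  have i2 := h2.intervalIntegrable hab.le
  have i3 := intervalIntegrable_of_memLp hab.le hg.memLp
  have i4 : IntervalIntegrable (fun x => nonlin f (u t x)) volume a b := by
    refine ContinuousOn.intervalIntegrable ?_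
    rw [uIcc_of_le hab.le]
    exact hf.comp_continuousOn ((v0 t htm').continuousOn hab.le)
  have e1 := sineCoeff_congr hab.le he l
  have e0 : sineCoeff a b (fun _ => (0 : ℂ)) l = 0 := by simp [sineCoeff]
  rw [e0, sineCoeff_add (((i1.const_mul _).sub (i2.const_mul _)).add i3) i4,
    sineCoeff_add ((i1.const_mul _).sub (i2.const_mul _)) i3,
    sineCoeff_sub (i1.const_mul _) (i2.const_mul _), sineCoeff_const_mul, sineCoeff_const_mul,
    sineCoeff_deriv_two hab (hg.isPrim hab.le 0 (by norm_num)) (hg.isPrim hab.le 1 (by norm_num))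
      ?_] at e1
  · rw [sineCoeff_congr_Ioo hab.le (u := g 0) (v := u t)
      (fun x hx => hg.zero (Ioo_subset_Icc_self hx))] at e1
    rw [← e1]
    ring
  · rw [hg.zero ha, hg.zero hb]
    exact h.dirichlet t htm'

/-- `ε² (∂_t û - i β' û)`: the modes that diagonalise the linear wave equation. -/
def waveMode (a b ε β' : ℝ) (l : ℕ) (u v : ℝ → ℂ) : ℂ :=
  (ε : ℂ) ^ 2 * (sineCoeff a b v l - Complex.I * β' * sineCoeff a b u l)

namespace IsRegularWave

variable {f : ℝ → ℝ} {ε C : ℝ} {u ut utt : ℝ → ℝ → ℂ}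

/-- By Vieta, ε²∂² − i∂ + μ² = ε²(∂ − iβ)(∂ − iβ'). Applying ε²(∂ − iβ') to û leaves a first order
equation whose source carries no power of ε. -/
theorem isPrim_waveMode (h : IsRegularWave f a b T ε C u ut utt) (hab : a < b) (hT : 0 < T)
    (hε : 0 < ε) {β β' : ℝ} {l : ℕ} (h1 : β + β' = 1 / ε ^ 2)
    (h2 : β * β' = -(mu a b l ^ 2 / ε ^ 2)) :
    IsPrim 0 T (fun t => waveMode a b ε β' l (u t) (ut t))
      (fun t => Complex.I * β * waveMode a b ε β' l (u t) (ut t)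
        + sineCoeff a b (fun x => nonlin f (u t x)) l) := by
  have hae : ∀ᵐ t ∂volume.restrict (Icc 0 T), HS a b 1 true C (ut t) :=
    (ae_restrict_mem measurableSet_Icc).mono fun t ht => h.velocity t ht
  have p1 := h.deriv_one.isPrim_sineCoeff hab hT.le h.value hae l
  have p2 := h.deriv_two.isPrim_sineCoeff hab hT.le h.velocity h.acceleration l
  have p3 := (p2.add (p1.const_mul (-(Complex.I * β')))).const_mul ((ε : ℂ) ^ 2)
  refine p3.congr hT.le (fun t _ => by simp only [waveMode]; ring) ?_
  have hε' : (ε : ℂ) ≠ 0 := by exact_mod_cast hε.ne'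
  have h1' : (ε : ℂ) ^ 2 * (β + β') = 1 := by
    have : ε ^ 2 * (β + β') = 1 := by rw [h1]; field_simp
    exact_mod_cast this
  have h2' : (ε : ℂ) ^ 2 * (β * β') = -(mu a b l : ℂ) ^ 2 := by
    have : ε ^ 2 * (β * β') = -mu a b l ^ 2 := by rw [h2]; field_simp
    exact_mod_cast this
  filter_upwards [h.equation l] with t ht
  simp only [waveMode]
  linear_combination -ht - Complex.I * sineCoeff a b (ut t) l * h1'
    + sineCoeff a b (u t) l * h2' * Complex.I ^ 2
    - (mu a b l : ℂ) ^ 2 * sineCoeff a b (u t) l * (Complex.I_sq)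

theorem norm_sub_le (h : IsRegularWave f a b T ε C u ut utt) {s t : ℝ} (hs : s ∈ Icc 0 T)
    (ht : t ∈ Icc 0 T) {x : ℝ} (hx : x ∈ Icc a b) : ‖u t x - u s x‖ ≤ C * |t - s| :=
  (h.deriv_one.isPrim hx).norm_sub_le
    ((ae_restrict_mem measurableSet_Icc).mono fun r hr => (h.velocity r hr).1 x hx) hs ht

theorem norm_velocity_sub_le (h : IsRegularWave f a b T ε C u ut utt) {s t : ℝ} (hs : s ∈ Icc 0 T)
    (ht : t ∈ Icc 0 T) {x : ℝ} (hx : x ∈ Icc a b) : ‖ut t x - ut s x‖ ≤ C * |t - s| :=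
  (h.deriv_two.isPrim hx).norm_sub_le (h.acceleration.mono fun _ hr => hr.1 x hx) hs ht

theorem nonneg (h : IsRegularWave f a b T ε C u ut utt) (hab : a < b) (hT : 0 < T) : 0 ≤ C :=
  (h.value 0 ⟨le_rfl, hT.le⟩).nonneg hab.le

theorem continuousOn_sineCoeff_nonlin (h : IsRegularWave f a b T ε C u ut utt) (hab : a < b)
    (hT : 0 < T) (hf : ContDiffOn ℝ (1 : ℕ) f (Ici 0)) (l : ℕ) :
    ContinuousOn (fun t => sineCoeff a b (fun x => nonlin f (u t x)) l) (Icc 0 T) := by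
  obtain ⟨K, hK0, hK⟩ := exists_lipschitz_nonlin hf C
  have hC := h.nonneg hab hT
  have hc : ∀ t ∈ Icc 0 T, IntervalIntegrable (fun x => nonlin f (u t x)) volume a b := by
    intro t ht
    refine ContinuousOn.intervalIntegrable ?_
    rw [uIcc_of_le hab.le]
    exact (contDiff_nonlin hf).continuous.comp_continuousOn ((h.value t ht).continuousOn hab.le)
  refine LipschitzOnWith.continuousOn (K := (2 * (K * C)).toNNReal) ?_
  refine LipschitzOnWith.of_dist_le_mul fun t ht s hs => ?_
  rw [Real.coe_toNNReal _ (by positivity), dist_eq_norm, Real.dist_eq,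
    ← sineCoeff_sub (hc t ht) (hc s hs)]
  refine (norm_sineCoeff_le hab (B := K * (C * |t - s|)) (fun x hx => ?_) l).trans (by linarith)
  exact (hK _ _ ((h.value t ht).1 x hx) ((h.value s hs).1 x hx)).trans
    (mul_le_mul_of_nonneg_left (h.norm_sub_le hs ht hx) hK0)

theorem duhamel (h : IsRegularWave f a b T ε C u ut utt) (hab : a < b) (hT : 0 < T)
    (hε : 0 < ε) {β β' : ℝ} {l : ℕ} (h1 : β + β' = 1 / ε ^ 2)
    (h2 : β * β' = -(mu a b l ^ 2 / ε ^ 2)) {t s : ℝ} (ht : 0 ≤ t) (hs : 0 ≤ s) (hts : t + s ≤ T) :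
    waveMode a b ε β' l (u (t + s)) (ut (t + s))
      = cis (s * β) * waveMode a b ε β' l (u t) (ut t)
        + ∫ r in (0 : ℝ)..s, cis ((s - r) * β)
          * sineCoeff a b (fun x => nonlin f (u (t + r) x)) l :=
  variation_of_constants (h.isPrim_waveMode hab hT hε h1 h2) ht hs hts

end IsRegularWave

/-- The velocity cancels in the difference of the two modes. -/
theorem sineCoeff_eq_waveMode_sub (a b ε : ℝ) (l : ℕ) (u v : ℝ → ℂ) :
    Complex.I * ((ε ^ 2 * delta a b ε l : ℝ) : ℂ) * sineCoeff a b u l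
      = waveMode a b ε (betaMinus a b ε l) l u v - waveMode a b ε (betaPlus a b ε l) l u v := by
  unfold waveMode delta
  push_cast
  ring

namespace IsRegularWave

variable {f : ℝ → ℝ} {ε C : ℝ} {u ut utt : ℝ → ℝ → ℂ}

/-- Duhamel's formula from time 0 with unimodular propagators. The integral is extended to [0,T] so
that the bound does not depend on `t`. -/
theorem norm_waveMode_le (h : IsRegularWave f a b T ε C u ut utt) (hab : a < b) (hT : 0 < T)
    (hf : ContDiffOn ℝ (1 : ℕ) f (Ici 0))
    (hε : 0 < ε) {β β' : ℝ} {l : ℕ} (h1 : β + β' = 1 / ε ^ 2)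
    (h2 : β * β' = -(mu a b l ^ 2 / ε ^ 2)) (hβ : |β'| ≤ delta a b ε l) {t : ℝ}
    (ht : t ∈ Icc 0 T) :
    ‖waveMode a b ε β' l (u t) (ut t)‖ ≤ ε ^ 2 * ‖sineCoeff a b (ut 0) l‖
      + ε ^ 2 * delta a b ε l * ‖sineCoeff a b (u 0) l‖
      + ∫ r in (0 : ℝ)..T, ‖sineCoeff a b (fun x => nonlin f (u r x)) l‖ := by
  have hc := h.continuousOn_sineCoeff_nonlin hab hT hf l
  have hd := h.duhamel hab hT hε h1 h2 (t := 0) le_rfl ht.1 (by linarith [ht.2])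
  simp only [zero_add] at hd
  rw [hd]
  refine (norm_add_le _ _).trans (add_le_add ?_ ?_)
  · rw [norm_mul, norm_cis, one_mul, waveMode, norm_mul, norm_pow, Complex.norm_real,
      Real.norm_of_nonneg hε.le, mul_assoc (ε ^ 2), ← mul_add]
    gcongr
    refine (_root_.norm_sub_le _ _).trans ?_
    gcongr
    rw [norm_mul, norm_mul, Complex.norm_I, one_mul, Complex.norm_real]
    gcongr
    exact hβ
  · refine (intervalIntegral.norm_integral_le_integral_norm ht.1).trans ?_
    simp only [norm_mul, norm_cis, one_mul]
    refine intervalIntegral.integral_mono_interval le_rfl ht.1 ht.2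
      (Filter.Eventually.of_forall fun _ => norm_nonneg _) ?_
    refine ContinuousOn.intervalIntegrable ?_
    rw [uIcc_of_le hT.le]
    exact hc.norm

/-- On division by ε²δ ≥ 2εμ the nonlinear term loses its factor μ: a source with decay of order n
yields a wave with decay of order n + 1. The factor ε on the left is the price, harmless because
only limits in `l` at fixed ε are taken. -/
theorem norm_sineCoeff_le (h : IsRegularWave f a b T ε C u ut utt) (hab : a < b) (hT : 0 < T)
    (hf : ContDiffOn ℝ (1 : ℕ) f (Ici 0)) (hε : 0 < ε) (hε1 : ε ≤ 1) (l : ℕ) {t : ℝ}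
    (ht : t ∈ Icc 0 T) :
    ε * (mu a b (l + 1) * ‖sineCoeff a b (u t) (l + 1)‖)
      ≤ 2 * (mu a b (l + 1) * ‖sineCoeff a b (ut 0) (l + 1)‖)
      + 2 * (mu a b (l + 1) * ‖sineCoeff a b (u 0) (l + 1)‖)
      + ∫ r in (0 : ℝ)..T, ‖sineCoeff a b (fun x => nonlin f (u r x)) (l + 1)‖ := by
  have hs := betaPlus_add_betaMinus a b ε (l + 1)
  have hp := betaPlus_mul_betaMinus a b ε (l + 1)
  have e1 := h.norm_waveMode_le hab hT hf hε hs hp (abs_betaMinus_le_delta a b ε _ hε) ht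
  have e2 := h.norm_waveMode_le hab hT hf hε ((add_comm _ _).trans hs) ((mul_comm _ _).trans hp)
    (abs_betaPlus_le_delta a b ε _ hε) ht
  have e3 := congrArg norm (sineCoeff_eq_waveMode_sub a b ε (l + 1) (u t) (ut t))
  have hd := delta_pos a b ε (l + 1) hε
  have hD := one_le_sq_mul_delta a b ε (l + 1) hε
  have hm := two_mul_mu_le a b ε (l + 1) hε
  have hmu := mu_pos hab l
  set δ := delta a b ε (l + 1)
  set μ := mu a b (l + 1)
  rw [norm_mul, norm_mul, Complex.norm_I, one_mul, Complex.norm_real,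
    Real.norm_of_nonneg (by positivity)] at e3
  have e4 := e3.le.trans (_root_.norm_sub_le _ _)
  set Y := ‖sineCoeff a b (u t) (l + 1)‖
  set Y0 := ‖sineCoeff a b (u 0) (l + 1)‖
  set Y1 := ‖sineCoeff a b (ut 0) (l + 1)‖
  set J := ∫ r in (0 : ℝ)..T, ‖sineCoeff a b (fun x => nonlin f (u r x)) (l + 1)‖
  have hJ : 0 ≤ J := intervalIntegral.integral_nonneg hT.le fun _ _ => norm_nonneg _
  have hY1 : 0 ≤ Y1 := norm_nonneg _
  have hY0 : 0 ≤ Y0 := norm_nonneg _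
  have e5 : ε ^ 2 * δ * Y ≤ 2 * (ε ^ 2 * Y1 + ε ^ 2 * δ * Y0 + J) := by linarith
  have e6 : ε ^ 2 * δ * (ε * (μ * Y)) ≤ ε ^ 2 * δ * (2 * (μ * Y1) + 2 * (μ * Y0) + J) := by
    calc ε ^ 2 * δ * (ε * (μ * Y)) = ε * μ * (ε ^ 2 * δ * Y) := by ring
      _ ≤ ε * μ * (2 * (ε ^ 2 * Y1 + ε ^ 2 * δ * Y0 + J)) := by gcongr
      _ = ε ^ 3 * (2 * (μ * Y1)) + 2 * ε * (ε ^ 2 * δ * (μ * Y0)) + 2 * μ * (ε * J) := by ring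
      _ ≤ ε ^ 2 * δ * (2 * (μ * Y1)) + 2 * 1 * (ε ^ 2 * δ * (μ * Y0)) + ε * δ * (ε * J) := by
          have : ε ^ 3 ≤ 1 := pow_le_one₀ hε.le hε1
          gcongr
          exact this.trans hD
      _ = _ := by ring
  exact le_of_mul_le_mul_left e6 (by positivity)

/-- Dominated convergence in time. The dominating constant bounds a single term of the weighted
Bessel sum, uniformly in time and in `l`. -/
theorem tendsto_integral_nonlin (h : IsRegularWave f a b T ε C u ut utt) (hab : a < b) (hT : 0 < T)
    (hf : ContDiffOn ℝ (1 : ℕ) f (Ici 0)) {n : ℕ} {K : ℝ}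
    (hK : ∀ t ∈ Icc 0 T, HS a b n true K (fun x => nonlin f (u t x))) :
    Filter.Tendsto (fun l : ℕ => mu a b (l + 1) ^ n *
      ∫ r in (0 : ℝ)..T, ‖sineCoeff a b (fun x => nonlin f (u r x)) (l + 1)‖)
      Filter.atTop (nhds 0) := by
  have hsub : uIoc 0 T ⊆ Icc 0 T := by
    rw [uIoc_of_le hT.le]
    exact Ioc_subset_Icc_self
  have h1 := intervalIntegral.tendsto_integral_filter_of_dominated_convergence (μ := volume)
    (a := 0) (b := T) (F := fun (l : ℕ) r => mu a b (l + 1) ^ n *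
      ‖sineCoeff a b (fun x => nonlin f (u r x)) (l + 1)‖)
    (f := fun _ => 0) (l := Filter.atTop) (fun _ => √(2 / (b - a) * K ^ 2))
    (Filter.Eventually.of_forall fun l =>
      (((h.continuousOn_sineCoeff_nonlin hab hT hf (l + 1)).norm.const_mul _).mono
        hsub).aestronglyMeasurable measurableSet_uIoc)
    (Filter.Eventually.of_forall fun l => Filter.Eventually.of_forall fun r hr => ?_)
    (by simp) (Filter.Eventually.of_forall fun r hr => (hK r (hsub hr)).tendsto hab)
  · simpa [intervalIntegral.integral_const_mul] using h1
  · have h2 := (hK r (hsub hr)).sum_le hab (l + 1)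
    have h3 := Finset.single_le_sum (f := fun l => mu a b (l + 1) ^ (2 * n) *
      ‖trigCoeff a b true (fun x => nonlin f (u r x)) (l + 1)‖ ^ 2)
      (fun i _ => mul_nonneg (pow_nonneg (mu_pos hab i).le _) (sq_nonneg _))
      (Finset.self_mem_range_succ l)
    have h4 : 0 ≤ mu a b (l + 1) ^ n := pow_nonneg (mu_pos hab l).le _
    rw [norm_mul, norm_norm, Real.norm_of_nonneg h4]
    refine Real.le_sqrt_of_sq_le (le_trans (le_of_eq ?_) (h3.trans h2))
    rw [trigCoeff_true]
    ring

/-- Bootstrap in the order n, starting from the Dirichlet condition. If all u(t) are in the class of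
order n, so is the nonlinearity, Duhamel gains one order of decay, and the next traces vanish. `C₀`
and `C₁` enter only through this qualitative decay, so the final constant does not contain them. -/
theorem hs_of_hNormLe (h : IsRegularWave f a b T ε C u ut utt) (hab : a < b) (hT : 0 < T)
    (hε : 0 < ε) (hε1 : ε ≤ 1) {m : ℕ} (hm : 1 ≤ m) (hf : ContDiffOn ℝ m f (Ici 0)) {C' : ℝ}
    (hu : ∀ t ∈ Icc 0 T, HNormLe a b m (u t) C') {C₀ C₁ : ℝ}
    (h0 : HS a b m true C₀ (u 0)) (h1 : HS a b m true C₁ (ut 0)) :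
    ∀ t ∈ Icc 0 T, HS a b m true (embConst a b * C') (u t) := by
  have key : ∀ n, 1 ≤ n → n ≤ m → ∀ t ∈ Icc 0 T, HS a b n true (embConst a b * C') (u t) := by
    intro n hn
    induction n, hn using Nat.le_induction with
    | base => exact fun hm t ht => ((hu t ht).of_le hab hm).hs_one hab ((h.value t ht).2.1 rfl)
    | succ n hn ih =>
      intro hnm t ht
      obtain ⟨n, rfl⟩ : ∃ k, n = k + 1 := ⟨n - 1, by omega⟩
      obtain ⟨K, hK⟩ := HS.exists_nonlin hab.le (n := n)
        (hf.of_le (by exact_mod_cast (by omega : n + 1 ≤ m))) (embConst a b * C')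
      have hf1 : ContDiffOn ℝ (1 : ℕ) f (Ici 0) := hf.of_le (by exact_mod_cast hm)
      have t1 := h.tendsto_integral_nonlin hab hT hf1 fun t ht => hK _ (ih (by omega) t ht)
      obtain ⟨C₀', h0'⟩ := h0.exists_of_le hab.le hnm
      obtain ⟨C₁', h1'⟩ := h1.exists_of_le hab.le hnm
      have t2 := h0'.tendsto hab
      have t3 := h1'.tendsto hab
      have t4 := (((t3.const_mul 2).add (t2.const_mul 2)).add t1).const_mul ε⁻¹
      rw [mul_zero, add_zero, zero_add, mul_zero] at t4
      refine (hu t ht).hs_of_tendsto hab hnm (squeeze_zero (fun l => ?_) (fun l => ?_) t4)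
      · exact mul_nonneg (pow_nonneg (mu_pos hab l).le _) (norm_nonneg _)
      · have e := h.norm_sineCoeff_le hab hT hf1 hε hε1 l ht
        have hp : 0 ≤ mu a b (l + 1) ^ (n + 1) := pow_nonneg (mu_pos hab l).le _
        have e' := mul_le_mul_of_nonneg_left e hp
        rw [inv_mul_eq_div, le_div_iff₀ hε]
        simp only [trigCoeff_true]
        calc _ = mu a b (l + 1) ^ (n + 1) * (ε * (mu a b (l + 1) *
              ‖sineCoeff a b (u t) (l + 1)‖)) := by ring
          _ ≤ _ := e'
          _ = _ := by ring
  exact key m hm le_rfl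

end IsRegularWave

/-! ### The initial velocity -/

/-- Links the classical second derivative in the definition of the initial velocity to the
continuous representative. Order n + 3 makes this derivative continuous, and two derivatives restore
the parity. -/
theorem HS.exists_deriv_two {n : ℕ} {s : Bool} {C : ℝ} {u : ℝ → ℂ} (hab : a ≤ b)
    (h : HS a b (n + 3) s C u) : ∃ w, HS a b (n + 1) s C w ∧
      ∀ x ∈ Ioo a b, iteratedDeriv 2 u x = w x := by
  obtain ⟨-, -, v, hv, hp⟩ := h
  have hvc := hv.continuousOn hab
  obtain ⟨-, -, w, hw, hq⟩ := hv
  rw [Bool.not_not] at hw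
  refine ⟨w, hw, fun x hx => ?_⟩
  have hwc := hw.continuousOn hab
  rw [iteratedDeriv_succ, iteratedDeriv_one]
  have : deriv u =ᶠ[nhds x] v := by
    filter_upwards [isOpen_Ioo.mem_nhds hx] with y hy
    exact (hp.hasDerivAt_of_continuousAt hy hvc).deriv
  rw [this.deriv_eq]
  exact (hq.hasDerivAt_of_continuousAt hx hwc).deriv

theorem CoeffBound.of_le (hab : a < b) {m n : ℕ} (hn : n ≤ m) {u : ℝ → ℂ} {A : ℝ}
    (h : CoeffBound a b m u A) : CoeffBound a b n u (A / mu a b 1 ^ (2 * (m - n))) := by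
  intro N
  have h1 : 0 < mu a b 1 := by simpa using mu_pos hab 0
  rw [le_div_iff₀ (by positivity), Finset.sum_mul]
  refine (Finset.sum_le_sum fun l _ => ?_).trans (h N)
  have h2 : mu a b 1 ^ (2 * (m - n)) ≤ mu a b (l + 1) ^ (2 * (m - n)) :=
    pow_le_pow_left₀ h1.le (mu_mono hab (by omega)) _
  have h3 : mu a b (l + 1) ^ (2 * m)
      = mu a b (l + 1) ^ (2 * n) * mu a b (l + 1) ^ (2 * (m - n)) := by
    rw [← pow_add]; congr 1; omega
  rw [h3]
  have := mu_pos hab l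
  calc _ = mu a b (l + 1) ^ (2 * n) * mu a b 1 ^ (2 * (m - n))
          * ‖sineCoeff a b u (l + 1)‖ ^ 2 := by ring
    _ ≤ _ := by gcongr

theorem CoeffBound.add_const_mul (hab : a < b) {m : ℕ} {u v w : ℝ → ℂ} {A B : ℝ} {c d : ℂ}
    (hu : CoeffBound a b m u A) (hv : CoeffBound a b m v B) (hc : ‖c‖ ≤ 1) (hd : ‖d‖ ≤ 1)
    (h : ∀ l, sineCoeff a b w l = c * sineCoeff a b u l + d * sineCoeff a b v l) :
    CoeffBound a b m w (2 * A + 2 * B) := by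
  intro N
  have h1 := hu N
  have h2 := hv N
  refine le_trans ?_ (add_le_add (mul_le_mul_of_nonneg_left h1 zero_le_two)
    (mul_le_mul_of_nonneg_left h2 zero_le_two))
  rw [Finset.mul_sum, Finset.mul_sum, ← Finset.sum_add_distrib]
  refine Finset.sum_le_sum fun l _ => ?_
  have h3 : ‖sineCoeff a b w (l + 1)‖ ≤ ‖sineCoeff a b u (l + 1)‖ + ‖sineCoeff a b v (l + 1)‖ := by
    rw [h]
    refine (norm_add_le _ _).trans ?_
    rw [norm_mul, norm_mul]
    gcongr <;> exact mul_le_of_le_one_left (norm_nonneg _) ‹_›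
  have h4 := pow_le_pow_left₀ (norm_nonneg _) h3 2
  have h5 : 0 ≤ mu a b (l + 1) ^ (2 * m) := pow_nonneg (mu_pos hab l).le _
  have h6 := sq_nonneg (‖sineCoeff a b u (l + 1)‖ - ‖sineCoeff a b v (l + 1)‖)
  calc _ ≤ mu a b (l + 1) ^ (2 * m)
        * (2 * ‖sineCoeff a b u (l + 1)‖ ^ 2 + 2 * ‖sineCoeff a b v (l + 1)‖ ^ 2) := by
        gcongr; linarith
    _ = _ := by ring

theorem MemHs.coeffBound (hab : a < b) {m : ℕ} {u : ℝ → ℂ} {C : ℝ} (h : MemHs a b m u)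
    (hC : hsNorm a b m u ≤ C) : CoeffBound a b m u (C ^ 2) := by
  obtain ⟨K, hK⟩ := h.exists_hs hab
  have h0 : ∀ l : ℕ, 0 ≤ mu a b (l + 1) ^ (2 * m) * ‖sineCoeff a b u (l + 1)‖ ^ 2 := fun l =>
    mul_nonneg (pow_nonneg (mu_pos hab l).le _) (sq_nonneg _)
  have hs : Summable fun l : ℕ => mu a b (l + 1) ^ (2 * m) * ‖sineCoeff a b u (l + 1)‖ ^ 2 :=
    summable_of_sum_range_le h0 (hK.coeffBound hab)
  have hC0 : 0 ≤ C := (Real.sqrt_nonneg _).trans hC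
  have h1 := (Real.sqrt_le_left hC0).1 hC
  intro N
  refine le_trans ?_ h1
  exact_mod_cast hs.sum_le_tsum (Finset.range N) fun i _ => h0 i

/-- The initial velocity belongs to `H_s^m`, with sine coefficients bounded uniformly in `ε`. -/
theorem AssumptionA.exists_initialVelocity (hab : a < b) {m₀ m k : ℕ} (hm₀ : m ≤ m₀) (hmk : m ≤ k)
    (hm : 1 ≤ m) {f : ℝ → ℝ} (hf : ContDiffOn ℝ k f (Ici 0)) {α : ℝ} (hα : 0 ≤ α) {ψ₀ : ℝ → ℂ}
    {ω : ℝ → ℝ → ℂ} (h : AssumptionA a b m₀ ψ₀ ω) :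
    ∃ A, ∀ ε ∈ Ioc (0 : ℝ) 1, ∀ v : ℝ → ℂ, v a = 0 → v b = 0 →
      (∀ x ∈ Ioo a b, v x = initialVelocity f α ψ₀ ω ε x) →
      (∃ C, HS a b m true C v) ∧ CoeffBound a b m v A := by
  obtain ⟨C₀, hC₀⟩ := h.value.exists_hs hab
  obtain ⟨_, Cω, _, hω⟩ := h.perturbation
  obtain ⟨C₁, hC₁⟩ := hC₀.exists_of_le hab.le (show (m - 1) + 3 ≤ m₀ + 2 by omega)
  obtain ⟨w, hw, hwd⟩ := hC₁.exists_deriv_two hab.le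
  obtain ⟨C₂, hC₂⟩ := hC₀.exists_of_le hab.le (show (m - 1) + 1 ≤ m₀ + 2 by omega)
  obtain ⟨K, hK⟩ := HS.exists_nonlin hab.le (n := m - 1)
    (hf.of_le (by exact_mod_cast (by omega : m - 1 + 1 ≤ k))) C₂
  have hg := hw.add hab.le (hK _ hC₂)
  rw [Nat.sub_add_cancel hm] at hg
  refine ⟨2 * (2 / (b - a) * (2 * (C₁ + K)) ^ 2) + 2 * (Cω ^ 2 / mu a b 1 ^ (2 * (m₀ - m))),
    fun ε hε v hva hvb hv => ?_⟩
  -- This constant may depend on ε and serves for membership only. The bound uniform in ε comes from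
  -- `hsNorm` and is carried by `CoeffBound`.
  obtain ⟨Cε, hCε⟩ := (hω ε hε).1.exists_hs hab
  obtain ⟨Cε', hCε'⟩ := hCε.exists_of_le hab.le hm₀
  have hεα : ‖((ε ^ α : ℝ) : ℂ)‖ ≤ 1 := by
    rw [Complex.norm_real, Real.norm_of_nonneg (Real.rpow_nonneg hε.1.le _)]
    exact Real.rpow_le_one hε.1.le hε.2 hα
  have hs := (hg.const_mul Complex.I).add hab.le (hCε'.const_mul ((ε ^ α : ℝ) : ℂ))
  have hE : ∀ x ∈ Ioo a b, Complex.I * (w x + nonlin f (ψ₀ x)) + ((ε ^ α : ℝ) : ℂ) * ω ε x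
      = v x := fun x hx => by rw [hv x hx, initialVelocity, hwd x hx]
  refine ⟨⟨_, hs.congr hab.le fun x hx => ?_⟩, (hg.coeffBound hab).add_const_mul hab
    (((hω ε hε).1.coeffBound hab (hω ε hε).2.2).of_le hab hm₀)
    (c := Complex.I) (d := ((ε ^ α : ℝ) : ℂ)) (by simp) hεα fun l => ?_⟩
  -- The formula for the velocity is available inside the interval; at the end points both sides
  -- vanish.
  · rcases eq_or_ne x a with rfl | hxa
    · obtain ⟨n, rfl⟩ : ∃ n, m = n + 1 := ⟨m - 1, by omega⟩
      rw [hva]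
      exact (hs.2.1 rfl).1
    rcases eq_or_ne x b with rfl | hxb
    · obtain ⟨n, rfl⟩ : ∃ n, m = n + 1 := ⟨m - 1, by omega⟩
      rw [hvb]
      exact (hs.2.1 rfl).2
    exact hE x ⟨lt_of_le_of_ne hx.1 hxa.symm, lt_of_le_of_ne hx.2 hxb⟩
  · rw [← sineCoeff_congr_Ioo hab.le hE l, sineCoeff_add
      ((hg.intervalIntegrable hab.le).const_mul _) ((hCε.intervalIntegrable hab.le).const_mul _),
      sineCoeff_const_mul, sineCoeff_const_mul]

/-! ### The numerical method in the modes of the linear wave equation -/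

theorem cis_eq (x : ℝ) : cis x = (Real.cos x : ℂ) + Complex.I * (Real.sin x : ℂ) := by
  rw [cis, mul_comm, Complex.exp_mul_I, Complex.ofReal_cos, Complex.ofReal_sin, mul_comm Complex.I]

theorem conj_cis (x : ℝ) : conj (cis x) = cis (-x) := by
  rw [cis_eq, cis_eq, Real.cos_neg, Real.sin_neg, map_add, map_mul, Complex.conj_I,
    Complex.conj_ofReal, Complex.conj_ofReal]
  push_cast
  ring

theorem cis_sub_cis_neg (x : ℝ) : cis x - cis (-x) = 2 * Complex.I * (Real.sin x : ℂ) := by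
  rw [cis_eq, cis_eq, Real.cos_neg, Real.sin_neg]
  push_cast
  ring

theorem cis_add_cis_neg (x : ℝ) : cis x + cis (-x) = 2 * (Real.cos x : ℂ) := by
  rw [cis_eq, cis_eq, Real.cos_neg, Real.sin_neg]
  push_cast
  ring

theorem mul_sinc_self (x : ℝ) : x * Real.sinc x = Real.sin x := by
  rcases eq_or_ne x 0 with rfl | hx
  · simp
  · rw [Real.sinc_of_ne_zero hx]
    field_simp

theorem I_mul_sigma (τ β : ℝ) : Complex.I * (τ * β) * sigma τ β = cis (τ * β) - 1 := by
  have h1 : cis (τ * β) = cis (τ * β / 2) * cis (τ * β / 2) := by rw [← cis_add]; ring_nf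
  have h2 := cis_sub_cis_neg (τ * β / 2)
  have h3 := cis_mul_cis_neg (τ * β / 2)
  have h4 : ((τ * β / 2 : ℝ) : ℂ) * (Real.sinc (τ * β / 2) : ℂ) = (Real.sin (τ * β / 2) : ℂ) := by
    exact_mod_cast mul_sinc_self _
  push_cast at h4
  rw [h1, sigma]
  push_cast at h2 h4 ⊢
  linear_combination 2 * Complex.I * cis (τ * β / 2) * h4 - cis (τ * β / 2) * h2 - h3

/-- Removes the conjugates from the starred coefficients. -/
theorem conj_sigma (τ β : ℝ) : conj (sigma τ β) * cis (τ * β) = sigma τ β := by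
  have h1 : cis (τ * β) = cis (τ * β / 2) * cis (τ * β / 2) := by rw [← cis_add]; ring_nf
  have h3 := cis_mul_cis_neg (τ * β / 2)
  rw [sigma, map_mul, conj_cis, Complex.conj_ofReal, h1]
  linear_combination (Real.sinc (τ * β / 2) : ℂ) * cis (τ * β / 2) * h3

theorem hasDerivAt_cis_sub_mul (τ β x : ℝ) :
    HasDerivAt (fun s : ℝ => cis ((τ - s) * β)) (-(Complex.I * β * cis ((τ - x) * β))) x := by
  have h := (hasDerivAt_cis_mul β (τ - x)).scomp x ((hasDerivAt_id x).const_sub τ)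
  exact h.congr_deriv (by simp)

theorem integral_cis_sub_mul {τ β : ℝ} (hβ : β ≠ 0) :
    ∫ s in (0 : ℝ)..τ, cis ((τ - s) * β) = τ * sigma τ β := by
  have hc := continuous_cis
  have hβ' : (β : ℂ) ≠ 0 := by exact_mod_cast hβ
  have hI : Complex.I * (β : ℂ) ≠ 0 := mul_ne_zero Complex.I_ne_zero hβ'
  have h := intervalIntegral.integral_eq_sub_of_hasDerivAt (a := 0) (b := τ)
    (f := fun s => -(cis ((τ - s) * β) / (Complex.I * β))) (f' := fun s => cis ((τ - s) * β))
    (fun x _ => by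
      refine ((hasDerivAt_cis_sub_mul τ β x).div_const (Complex.I * β)).neg.congr_deriv ?_
      field_simp)
    (Continuous.intervalIntegrable (by fun_prop) _ _)
  rw [h, sub_self, zero_mul, cis_zero, sub_zero]
  have := I_mul_sigma τ β
  field_simp
  linear_combination -this

theorem integral_mul_cis_sub_mul {τ β : ℝ} (hβ : β ≠ 0) :
    ∫ s in (0 : ℝ)..τ, (s : ℂ) * cis ((τ - s) * β) = Complex.I * τ * (1 - sigma τ β) / β := by
  have hc := continuous_cis
  have hβ' : (β : ℂ) ≠ 0 := by exact_mod_cast hβ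
  have hI : Complex.I * (β : ℂ) ≠ 0 := mul_ne_zero Complex.I_ne_zero hβ'
  have h := intervalIntegral.integral_eq_sub_of_hasDerivAt (a := 0) (b := τ)
    (f := fun s : ℝ => -((s : ℂ) * cis ((τ - s) * β) / (Complex.I * β)
      + cis ((τ - s) * β) / (Complex.I * β) ^ 2)) (f' := fun s => (s : ℂ) * cis ((τ - s) * β))
    (fun x _ => by
      have h1 := hasDerivAt_cis_sub_mul τ β x
      have h2 : HasDerivAt (fun s : ℝ => (s : ℂ)) 1 x := (hasDerivAt_id x).ofReal_comp
      refine (((h2.mul h1).div_const (Complex.I * β)).add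
        (h1.div_const ((Complex.I * β) ^ 2))).neg.congr_deriv ?_
      field_simp
      ring)
    (Continuous.intervalIntegrable (by fun_prop) _ _)
  rw [h, sub_self, zero_mul, cis_zero, sub_zero]
  have h1 : cis (τ * β) = Complex.I * (τ * β) * sigma τ β + 1 := by rw [I_mul_sigma]; ring
  rw [h1]
  field_simp
  simp only [Complex.ofReal_zero]
  linear_combination -(τ * Complex.I * β * (1 - sigma τ β)) * Complex.I_sq

/-- The recursion that the method follows in each mode of the linear wave equation. -/
def schemeMode (τ β : ℝ) (z : ℂ) (F D : ℕ → ℂ) : ℕ → ℂ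
  | 0 => z
  | n + 1 => cis (τ * β) * schemeMode τ β z F D n
      + ∫ s in (0 : ℝ)..τ, cis ((τ - s) * β) * (F n + s * D n)

/-- The coefficients built from σ are the exact integrals of 1 and s against the propagator
e^{i(τ−s)β}. -/
theorem schemeMode_succ {τ β : ℝ} (hβ : β ≠ 0) (z : ℂ) (F D : ℕ → ℂ) (n : ℕ) :
    schemeMode τ β z F D (n + 1) = cis (τ * β) * schemeMode τ β z F D n
      + (τ * sigma τ β * F n + Complex.I * τ * (1 - sigma τ β) / β * D n) := by
  have hc := continuous_cis
  rw [schemeMode, ← integral_cis_sub_mul hβ, ← integral_mul_cis_sub_mul hβ,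
    ← intervalIntegral.integral_mul_const, ← intervalIntegral.integral_mul_const,
    ← intervalIntegral.integral_add]
  · congr 2
    ext s
    ring
  · exact Continuous.intervalIntegrable (by fun_prop) _ _
  · exact Continuous.intervalIntegrable (by fun_prop) _ _

/-! ### The coefficients of the scheme in terms of the propagators. -/

section coef

variable {a b ε τ : ℝ} {l : ℕ}

theorem cis_mul_cis_beta :
    cis (τ * betaPlus a b ε l) * cis (τ * betaMinus a b ε l) = cis (τ / ε ^ 2) := by
  rw [← cis_add, ← mul_add, betaPlus_add_betaMinus]
  ring_nf

theorem cis_beta_eq :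
    cis (τ * betaPlus a b ε l) = cis (τ / (2 * ε ^ 2)) * cis (τ * delta a b ε l / 2) ∧
    cis (τ * betaMinus a b ε l) = cis (τ / (2 * ε ^ 2)) * cis (-(τ * delta a b ε l / 2)) := by
  have h := betaPlus_add_betaMinus a b ε l
  have h' : τ / (2 * ε ^ 2) = τ * (betaPlus a b ε l + betaMinus a b ε l) / 2 := by
    rw [h]; ring
  rw [h', ← cis_add, ← cis_add, delta]
  constructor <;> congr 1 <;> ring

theorem coefD_eq : coefD a b ε τ l
    = cis (τ * betaPlus a b ε l) + cis (τ * betaMinus a b ε l) := by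
  rw [cis_beta_eq.1, cis_beta_eq.2, coefD]
  linear_combination -cis (τ / (2 * ε ^ 2)) * cis_add_cis_neg (τ * delta a b ε l / 2)

theorem coefC_eq : coefC ε τ
    = -(cis (τ * betaPlus a b ε l) * cis (τ * betaMinus a b ε l)) := by
  rw [cis_mul_cis_beta, coefC]

theorem delta_mul_coefC0 (hε : 0 < ε) : (delta a b ε l : ℂ) * coefC0 a b ε τ l
    = betaPlus a b ε l * cis (τ * betaMinus a b ε l)
      - betaMinus a b ε l * cis (τ * betaPlus a b ε l) := by
  have hδ : (delta a b ε l : ℂ) ≠ 0 := by exact_mod_cast (delta_pos a b ε l hε).ne'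
  rw [coefC0]
  field_simp

theorem delta_mul_coefD0 : Complex.I * (delta a b ε l : ℂ) * coefD0 a b ε τ l
    = cis (τ * betaPlus a b ε l) - cis (τ * betaMinus a b ε l) := by
  have h1 := cis_sub_cis_neg (τ * delta a b ε l / 2)
  have h4 : ((τ * delta a b ε l / 2 : ℝ) : ℂ) * (Real.sinc (τ * delta a b ε l / 2) : ℂ)
      = (Real.sin (τ * delta a b ε l / 2) : ℂ) := by
    exact_mod_cast mul_sinc_self _
  push_cast at h4
  rw [cis_beta_eq.1, cis_beta_eq.2, coefD0]
  push_cast at h1 ⊢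
  linear_combination -cis (τ / (2 * ε ^ 2)) * h1 + 2 * Complex.I * cis (τ / (2 * ε ^ 2)) * h4

theorem delta_mul_coefP (hε : 0 < ε) :
    Complex.I * ((ε : ℂ) ^ 2 * delta a b ε l) * coefP a b ε τ l
    = τ * sigma τ (betaPlus a b ε l) - τ * sigma τ (betaMinus a b ε l) := by
  have hδ : (delta a b ε l : ℂ) ≠ 0 := by exact_mod_cast (delta_pos a b ε l hε).ne'
  have hε' : (ε : ℂ) ≠ 0 := by exact_mod_cast hε.ne'
  rw [coefP]
  field_simp
  rw [Complex.I_sq]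
  ring

theorem delta_mul_coefQ (hε : 0 < ε) :
    Complex.I * ((ε : ℂ) ^ 2 * delta a b ε l) * coefQ a b ε τ l
    = Complex.I * τ * (1 - sigma τ (betaPlus a b ε l)) / betaPlus a b ε l
      - Complex.I * τ * (1 - sigma τ (betaMinus a b ε l)) / betaMinus a b ε l := by
  have hδ : (delta a b ε l : ℂ) ≠ 0 := by exact_mod_cast (delta_pos a b ε l hε).ne'
  have hε' : (ε : ℂ) ≠ 0 := by exact_mod_cast hε.ne'
  have h : (ε : ℂ) ^ 2 * delta a b ε l ≠ 0 := by positivity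
  rw [coefQ, mul_assoc, ← mul_assoc ((ε : ℂ) ^ 2 * delta a b ε l), mul_div_cancel₀ _ h]
  ring

theorem delta_mul_coefPStar (hε : 0 < ε) :
    Complex.I * ((ε : ℂ) ^ 2 * delta a b ε l) * coefPStar a b ε τ l
    = cis (τ * betaMinus a b ε l) * (τ * sigma τ (betaPlus a b ε l))
      - cis (τ * betaPlus a b ε l) * (τ * sigma τ (betaMinus a b ε l)) := by
  have hδ : (delta a b ε l : ℂ) ≠ 0 := by exact_mod_cast (delta_pos a b ε l hε).ne'
  have hε' : (ε : ℂ) ≠ 0 := by exact_mod_cast hε.ne'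
  have h1 := conj_sigma τ (betaPlus a b ε l)
  have h2 := conj_sigma τ (betaMinus a b ε l)
  have h3 := cis_mul_cis_beta (a := a) (b := b) (ε := ε) (τ := τ) (l := l)
  rw [coefPStar, ← h3]
  field_simp
  rw [Complex.I_sq]
  linear_combination τ * cis (τ * betaMinus a b ε l) * h1 - τ * cis (τ * betaPlus a b ε l) * h2

theorem delta_mul_coefQStar (hε : 0 < ε) :
    Complex.I * ((ε : ℂ) ^ 2 * delta a b ε l) * coefQStar a b ε τ l
    = cis (τ * betaMinus a b ε l)
        * (Complex.I * τ * (1 - sigma τ (betaPlus a b ε l)) / betaPlus a b ε l)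
      - cis (τ * betaPlus a b ε l)
        * (Complex.I * τ * (1 - sigma τ (betaMinus a b ε l)) / betaMinus a b ε l) := by
  have hδ : (delta a b ε l : ℂ) ≠ 0 := by exact_mod_cast (delta_pos a b ε l hε).ne'
  have hε' : (ε : ℂ) ≠ 0 := by exact_mod_cast hε.ne'
  have h : (ε : ℂ) ^ 2 * delta a b ε l ≠ 0 := by positivity
  have h3 := cis_mul_cis_beta (a := a) (b := b) (ε := ε) (τ := τ) (l := l)
  have hp := cis_ne_zero (τ * betaPlus a b ε l)
  have hm := cis_ne_zero (τ * betaMinus a b ε l)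
  have e1 : ∀ x y : ℂ, x / (cis (τ * betaPlus a b ε l) * y) * (cis (τ * betaPlus a b ε l)
      * cis (τ * betaMinus a b ε l)) = cis (τ * betaMinus a b ε l) * (x / y) := fun x y => by
    rw [mul_comm (cis _) y, ← div_div]
    field_simp
  have e2 : ∀ x y : ℂ, x / (cis (τ * betaMinus a b ε l) * y) * (cis (τ * betaPlus a b ε l)
      * cis (τ * betaMinus a b ε l)) = cis (τ * betaPlus a b ε l) * (x / y) := fun x y => by
    rw [mul_comm (cis _) y, ← div_div]
    field_simp
  rw [coefQStar, ← h3, mul_assoc, ← mul_assoc ((ε : ℂ) ^ 2 * delta a b ε l), mul_div_cancel₀ _ h]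
  have f1 := e1 (1 - sigma τ (betaPlus a b ε l)) (betaPlus a b ε l)
  have f2 := e2 (1 - sigma τ (betaMinus a b ε l)) (betaMinus a b ε l)
  linear_combination Complex.I * τ * f1 - Complex.I * τ * f2

end coef

/-- If P and Q follow one-step recursions with multipliers p and q, then P − Q follows the two-step
recursion with coefficients p + q and −pq. Eliminating the earlier step multiplies each old source
by the multiplier of the other recursion. The coefficients `coefD` and `coefC` are these p + q and
−pq, and the starred coefficients are the crossed old sources. -/
theorem IsEWISP.mul_dst_eq {f : ℝ → ℝ} {a b ε τ : ℝ} {M : ℕ} {u₀ u₁ : ℝ → ℂ} {Ψ : ℕ → ℕ → ℂ}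
    (h : IsEWISP f a b ε τ M u₀ u₁ Ψ) (hab : a < b) (hε : 0 < ε) {l : ℕ}
    (hl : l ∈ Finset.Ioo 0 M) (n : ℕ) :
    Complex.I * ((ε ^ 2 * delta a b ε l : ℝ) : ℂ) * dst M (Ψ n) l
      = schemeMode τ (betaPlus a b ε l) ((ε : ℂ) ^ 2 * (dst M (fun j => u₁ (grid a b M j)) l
            - Complex.I * betaMinus a b ε l * dst M (Ψ 0) l))
          (fun n => dst M (fun j => nonlin f (Ψ n j)) l)
          (fun n => dst M (nonlinDt f τ (fun j => u₁ (grid a b M j)) Ψ n) l) n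
        - schemeMode τ (betaMinus a b ε l) ((ε : ℂ) ^ 2 * (dst M (fun j => u₁ (grid a b M j)) l
            - Complex.I * betaPlus a b ε l * dst M (Ψ 0) l))
          (fun n => dst M (fun j => nonlin f (Ψ n j)) l)
          (fun n => dst M (nonlinDt f τ (fun j => u₁ (grid a b M j)) Ψ n) l) n := by
  have hp : betaPlus a b ε l ≠ 0 := (betaPlus_pos hε l).ne'
  have hm : betaMinus a b ε l ≠ 0 := betaMinus_ne_zero hab hε (Finset.mem_Ioo.1 hl).1
  set F := fun n => dst M (fun j => nonlin f (Ψ n j)) l with hF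
  set D := fun n => dst M (nonlinDt f τ (fun j => u₁ (grid a b M j)) Ψ n) l with hD
  have hδ : (delta a b ε l : ℂ) = betaPlus a b ε l - betaMinus a b ε l := by
    rw [delta]; push_cast; rfl
  have e1 := delta_mul_coefC0 (a := a) (b := b) (τ := τ) (l := l) hε
  have e2 := delta_mul_coefD0 (a := a) (b := b) (ε := ε) (τ := τ) (l := l)
  have e3 := delta_mul_coefP (a := a) (b := b) (τ := τ) (l := l) hε
  have e4 := delta_mul_coefQ (a := a) (b := b) (τ := τ) (l := l) hε
  have e5 := delta_mul_coefPStar (a := a) (b := b) (τ := τ) (l := l) hε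
  have e6 := delta_mul_coefQStar (a := a) (b := b) (τ := τ) (l := l) hε
  have e7 := coefC_eq (a := a) (b := b) (ε := ε) (τ := τ) (l := l)
  have e8 := coefD_eq (a := a) (b := b) (ε := ε) (τ := τ) (l := l)
  push_cast
  induction n using Nat.twoStepInduction with
  | zero =>
    simp only [schemeMode]
    rw [hδ]
    ring
  | one =>
    have h1 : dst M (Ψ 1) l = coefC0 a b ε τ l * dst M (Ψ 0) l
        + coefD0 a b ε τ l * dst M (fun j => u₁ (grid a b M j)) l
        + coefP a b ε τ l * F 0 + coefQ a b ε τ l * D 0 :=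
      (dst_congr h.first l).trans (dst_sum_gridSin hl _)
    rw [← zero_add 1, schemeMode_succ hp, schemeMode_succ hm, zero_add, h1]
    simp only [schemeMode]
    linear_combination Complex.I * (ε : ℂ) ^ 2 * dst M (Ψ 0) l * e1
      + (ε : ℂ) ^ 2 * dst M (fun j => u₁ (grid a b M j)) l * e2 + F 0 * e3 + D 0 * e4
  | more n ih0 ih1 =>
    have h1 : dst M (Ψ (n + 1 + 1)) l = coefC ε τ * dst M (Ψ n) l
        + coefD a b ε τ l * dst M (Ψ (n + 1)) l + coefP a b ε τ l * F (n + 1)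
        + coefQ a b ε τ l * D (n + 1) - coefPStar a b ε τ l * F n - coefQStar a b ε τ l * D n :=
      (dst_congr (h.step (n + 1) (by omega)) l).trans (dst_sum_gridSin hl _)
    rw [schemeMode_succ hp, schemeMode_succ hm] at ih1
    rw [schemeMode_succ hp (n := n + 1), schemeMode_succ hm (n := n + 1), schemeMode_succ hp,
      schemeMode_succ hm, h1]
    generalize schemeMode τ (betaPlus a b ε l) _ F D n = P at ih0 ih1 ⊢
    generalize schemeMode τ (betaMinus a b ε l) _ F D n = Q at ih0 ih1 ⊢
    generalize Complex.I * τ * (1 - sigma τ (betaPlus a b ε l)) / betaPlus a b ε l = q₁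
      at e4 e6 ih1 ⊢
    generalize Complex.I * τ * (1 - sigma τ (betaMinus a b ε l)) / betaMinus a b ε l = q₂
      at e4 e6 ih1 ⊢
    rw [e7, e8]
    -- The weights −pq and p + q on the identities at steps n and n + 1 perform this elimination.
    linear_combination -(cis (τ * betaPlus a b ε l) * cis (τ * betaMinus a b ε l)) * ih0
      + (cis (τ * betaPlus a b ε l) + cis (τ * betaMinus a b ε l)) * ih1
      + F (n + 1) * e3 + D (n + 1) * e4 - F n * e5 - D n * e6

/-! ### The error in the modes of the linear wave equation -/

/-- The defect of the numerical approximation of the nonlinearity at time `n τ + s`, in the sine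
mode `l`. -/
def defect (f : ℝ → ℝ) (a b τ : ℝ) (M : ℕ) (u : ℝ → ℝ → ℂ) (v : ℕ → ℂ) (Ψ : ℕ → ℕ → ℂ) (n : ℕ)
    (s : ℝ) (l : ℕ) : ℂ :=
  sineCoeff a b (fun x => nonlin f (u (n * τ + s) x)) l
    - (dst M (fun j => nonlin f (Ψ n j)) l + s * dst M (nonlinDt f τ v Ψ n) l)

/-- The error of the numerical method in a mode of the linear wave equation. -/
def modeErr (f : ℝ → ℝ) (a b ε τ : ℝ) (M : ℕ) (u ut : ℝ → ℝ → ℂ) (v : ℕ → ℂ) (Ψ : ℕ → ℕ → ℂ)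
    (β β' : ℝ) (n l : ℕ) : ℂ :=
  waveMode a b ε β' l (u (n * τ)) (ut (n * τ))
    - schemeMode τ β ((ε : ℂ) ^ 2 * (dst M v l - Complex.I * β' * dst M (Ψ 0) l))
      (fun n => dst M (fun j => nonlin f (Ψ n j)) l) (fun n => dst M (nonlinDt f τ v Ψ n) l) n

/-- The squared error after `n` steps, in the norm of `H_s^e`. -/
def modeEnergy (f : ℝ → ℝ) (a b ε τ : ℝ) (M : ℕ) (u ut : ℝ → ℝ → ℂ) (v : ℕ → ℂ) (Ψ : ℕ → ℕ → ℂ)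
    (e n : ℕ) : ℝ :=
  ∑ l ∈ Finset.Ioo 0 M, mu a b l ^ (2 * e) *
    (‖modeErr f a b ε τ M u ut v Ψ (betaPlus a b ε l) (betaMinus a b ε l) n l‖ ^ 2
      + ‖modeErr f a b ε τ M u ut v Ψ (betaMinus a b ε l) (betaPlus a b ε l) n l‖ ^ 2)

/-- Young's inequality with weight τ: the old error grows only by 1 + τ per step, and the weight 1/τ
meets a factor τ from the Cauchy–Schwarz inequality over one step. -/
theorem norm_add_sq_le_of_pos {x y : ℂ} {τ : ℝ} (hτ : 0 < τ) :
    ‖x + y‖ ^ 2 ≤ (1 + τ) * ‖x‖ ^ 2 + (1 + 1 / τ) * ‖y‖ ^ 2 := by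
  have h1 := pow_le_pow_left₀ (norm_nonneg _) (norm_add_le x y) 2
  have h2 : 0 ≤ (τ * ‖x‖ - ‖y‖) ^ 2 / τ := by positivity
  have h3 : (τ * ‖x‖ - ‖y‖) ^ 2 / τ = τ * ‖x‖ ^ 2 - 2 * ‖x‖ * ‖y‖ + 1 / τ * ‖y‖ ^ 2 := by
    field_simp
    ring
  nlinarith

theorem norm_add_sq_le_two {x y : ℂ} : ‖x + y‖ ^ 2 ≤ 2 * ‖x‖ ^ 2 + 2 * ‖y‖ ^ 2 := by
  have h1 := pow_le_pow_left₀ (norm_nonneg _) (norm_add_le x y) 2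
  nlinarith [sq_nonneg (‖x‖ - ‖y‖)]

theorem norm_sub_sq_le_two {x y : ℂ} : ‖x - y‖ ^ 2 ≤ 2 * ‖x‖ ^ 2 + 2 * ‖y‖ ^ 2 := by
  have := norm_add_sq_le_two (x := x) (y := -y)
  rwa [← sub_eq_add_neg, norm_neg] at this

section

variable {f : ℝ → ℝ} {a b T ε C τ : ℝ} {u ut utt : ℝ → ℝ → ℂ} {M : ℕ} {v : ℕ → ℂ}
  {Ψ : ℕ → ℕ → ℂ}

namespace IsRegularWave

theorem continuousOn_defect (h : IsRegularWave f a b T ε C u ut utt) (hab : a < b) (hT : 0 < T)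
    (hf : ContDiffOn ℝ (1 : ℕ) f (Ici 0)) (hτ : 0 < τ) {n : ℕ} (hn : (n + 1 : ℕ) * τ ≤ T) (l : ℕ) :
    ContinuousOn (fun s => defect f a b τ M u v Ψ n s l) (Icc 0 τ) := by
  have h0 : 0 ≤ n * τ := by positivity
  push_cast at hn
  refine ContinuousOn.sub ?_ (by fun_prop)
  refine (h.continuousOn_sineCoeff_nonlin hab hT hf l).comp (f := fun s => n * τ + s)
    (by fun_prop) fun s hs => ⟨by linarith [hs.1], by linarith [hs.2]⟩

/-- Wave and scheme share the propagator e^{iτβ}, so the new error is the rotated old one plus the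
integrated defect. The factor 2 bounds (1 + 1/τ)τ = 1 + τ. -/
theorem norm_sq_modeErr_succ_le (h : IsRegularWave f a b T ε C u ut utt) (hab : a < b) (hT : 0 < T)
    (hf : ContDiffOn ℝ (1 : ℕ) f (Ici 0)) (hε : 0 < ε) (hτ : 0 < τ) (hτ1 : τ ≤ 1) {β β' : ℝ}
    {l : ℕ} (h1 : β + β' = 1 / ε ^ 2)
    (h2 : β * β' = -(mu a b l ^ 2 / ε ^ 2)) {n : ℕ} (hn : (n + 1 : ℕ) * τ ≤ T) :
    ‖modeErr f a b ε τ M u ut v Ψ β β' (n + 1) l‖ ^ 2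
      ≤ (1 + τ) * ‖modeErr f a b ε τ M u ut v Ψ β β' n l‖ ^ 2
        + 2 * ∫ s in (0 : ℝ)..τ, ‖defect f a b τ M u v Ψ n s l‖ ^ 2 := by
  have h0 : 0 ≤ n * τ := by positivity
  have hn' : n * τ + τ ≤ T := by push_cast at hn; linarith
  have hc := continuous_cis
  have hF : ContinuousOn (fun s => sineCoeff a b (fun x => nonlin f (u (n * τ + s) x)) l)
      (Icc 0 τ) :=
    (h.continuousOn_sineCoeff_nonlin hab hT hf l).comp (f := fun s => n * τ + s)
      (by fun_prop) fun s hs => ⟨by linarith [hs.1], by linarith [hs.2]⟩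
  have hd := h.continuousOn_defect (M := M) (v := v) (Ψ := Ψ) hab hT hf hτ hn l
  have hcis : Continuous fun s => cis ((τ - s) * β) := by fun_prop
  have hcd : ContinuousOn (fun s => cis ((τ - s) * β) * defect f a b τ M u v Ψ n s l) (Icc 0 τ) :=
    hcis.continuousOn.mul hd
  have hu : uIcc 0 τ = Icc 0 τ := uIcc_of_le hτ.le
  have e1 : modeErr f a b ε τ M u ut v Ψ β β' (n + 1) l
      = cis (τ * β) * modeErr f a b ε τ M u ut v Ψ β β' n l
        + ∫ s in (0 : ℝ)..τ, cis ((τ - s) * β) * defect f a b τ M u v Ψ n s l := by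
    have hi1 : IntervalIntegrable (fun s => cis ((τ - s) * β)
        * sineCoeff a b (fun x => nonlin f (u (n * τ + s) x)) l) volume 0 τ :=
      ContinuousOn.intervalIntegrable (by rw [hu]; exact hcis.continuousOn.mul hF)
    have hi2 : IntervalIntegrable (fun s : ℝ => cis ((τ - s) * β)
        * (dst M (fun j => nonlin f (Ψ n j)) l + s * dst M (nonlinDt f τ v Ψ n) l)) volume 0 τ :=
      Continuous.intervalIntegrable (by fun_prop) _ _
    have e2 := h.duhamel hab hT hε h1 h2 h0 hτ.le hn'
    have e3 : ((n + 1 : ℕ) : ℝ) * τ = n * τ + τ := by push_cast; ring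
    unfold modeErr
    rw [e3, e2, schemeMode]
    have e4 : ∫ s in (0 : ℝ)..τ, cis ((τ - s) * β) * defect f a b τ M u v Ψ n s l
        = (∫ s in (0 : ℝ)..τ, cis ((τ - s) * β)
            * sineCoeff a b (fun x => nonlin f (u (n * τ + s) x)) l)
          - ∫ s in (0 : ℝ)..τ, cis ((τ - s) * β)
            * (dst M (fun j => nonlin f (Ψ n j)) l + s * dst M (nonlinDt f τ v Ψ n) l) := by
      rw [← intervalIntegral.integral_sub hi1 hi2]
      congr 1
      ext s
      rw [defect]
      ring
    rw [e4]
    ring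
  have e2 := norm_sq_integral_le hτ.le (g := fun s => cis ((τ - s) * β)
    * defect f a b τ M u v Ψ n s l) (ContinuousOn.intervalIntegrable (by rwa [hu]))
    (ContinuousOn.intervalIntegrable (by rw [hu]; exact hcd.norm.pow 2))
  simp only [norm_mul, norm_cis, one_mul, sub_zero] at e2
  have e3 : 0 ≤ ∫ s in (0 : ℝ)..τ, ‖defect f a b τ M u v Ψ n s l‖ ^ 2 :=
    intervalIntegral.integral_nonneg hτ.le fun _ _ => sq_nonneg _
  rw [e1]
  refine (norm_add_sq_le_of_pos hτ).trans (add_le_add ?_ ?_)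
  · rw [norm_mul, norm_cis, one_mul]
  · calc _ ≤ (1 + 1 / τ) * (τ * ∫ s in (0 : ℝ)..τ, ‖defect f a b τ M u v Ψ n s l‖ ^ 2) := by
          gcongr
      _ = (τ + 1) * ∫ s in (0 : ℝ)..τ, ‖defect f a b τ M u v Ψ n s l‖ ^ 2 := by
          field_simp
      _ ≤ _ := by gcongr; linarith

theorem modeEnergy_succ_le (h : IsRegularWave f a b T ε C u ut utt) (hab : a < b) (hT : 0 < T)
    (hf : ContDiffOn ℝ (1 : ℕ) f (Ici 0)) (hε : 0 < ε) (hτ : 0 < τ) (hτ1 : τ ≤ 1) {n e : ℕ}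
    (hn : (n + 1 : ℕ) * τ ≤ T) {B : ℝ} (hB : ∀ s ∈ Icc 0 τ, ∑ l ∈ Finset.Ioo 0 M,
      mu a b l ^ (2 * e) * ‖defect f a b τ M u v Ψ n s l‖ ^ 2 ≤ B) :
    modeEnergy f a b ε τ M u ut v Ψ e (n + 1)
      ≤ (1 + τ) * modeEnergy f a b ε τ M u ut v Ψ e n + 4 * τ * B := by
  have hi : ∀ l, IntervalIntegrable
      (fun s => mu a b l ^ (2 * e) * ‖defect f a b τ M u v Ψ n s l‖ ^ 2) volume 0 τ := fun l => by
    refine ContinuousOn.intervalIntegrable ?_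
    rw [uIcc_of_le hτ.le]
    exact ((h.continuousOn_defect hab hT hf hτ hn l).norm.pow 2).const_mul _
  have e1 : ∑ l ∈ Finset.Ioo 0 M, mu a b l ^ (2 * e)
      * ∫ s in (0 : ℝ)..τ, ‖defect f a b τ M u v Ψ n s l‖ ^ 2 ≤ τ * B := by
    simp_rw [← intervalIntegral.integral_const_mul]
    rw [← intervalIntegral.integral_finsetSum fun l _ => hi l]
    have := intervalIntegral.integral_mono_on hτ.le
      (f := fun s => ∑ l ∈ Finset.Ioo 0 M, mu a b l ^ (2 * e) * ‖defect f a b τ M u v Ψ n s l‖ ^ 2)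
      (g := fun _ => B) ?_ (intervalIntegrable_const (μ := volume)) hB
    · simpa using this
    · refine (IntervalIntegrable.sum (Finset.Ioo 0 M) fun l _ => hi l).congr fun s _ => ?_
      simp [Finset.sum_apply]
  have e2 : modeEnergy f a b ε τ M u ut v Ψ e (n + 1)
      ≤ (1 + τ) * modeEnergy f a b ε τ M u ut v Ψ e n
        + 4 * ∑ l ∈ Finset.Ioo 0 M, mu a b l ^ (2 * e)
          * ∫ s in (0 : ℝ)..τ, ‖defect f a b τ M u v Ψ n s l‖ ^ 2 := by
    unfold modeEnergy
    rw [Finset.mul_sum, Finset.mul_sum, ← Finset.sum_add_distrib]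
    refine Finset.sum_le_sum fun l _ => ?_
    have hs := betaPlus_add_betaMinus a b ε l
    have hp := betaPlus_mul_betaMinus a b ε l
    have d1 := h.norm_sq_modeErr_succ_le (M := M) (v := v) (Ψ := Ψ) hab hT hf hε hτ hτ1 hs hp hn
    have d2 := h.norm_sq_modeErr_succ_le (M := M) (v := v) (Ψ := Ψ) hab hT hf hε hτ hτ1
      ((add_comm _ _).trans hs) ((mul_comm _ _).trans hp) hn
    have hw : 0 ≤ mu a b l ^ (2 * e) := pow_nonneg (mu_nonneg hab l) _
    have d3 := mul_le_mul_of_nonneg_left (add_le_add d1 d2) hw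
    refine d3.trans (le_of_eq ?_)
    ring
  linarith

end IsRegularWave

theorem IsEWISP.sum_sub_dst_le {u₀ u₁ : ℝ → ℂ} (h : IsEWISP f a b ε τ M u₀ u₁ Ψ) (hab : a < b)
    (hε : 0 < ε) (u ut : ℝ → ℝ → ℂ) (e n : ℕ) :
    ∑ l ∈ Finset.Ioo 0 M, mu a b l ^ (2 * e)
        * ‖sineCoeff a b (u (n * τ)) l - dst M (Ψ n) l‖ ^ 2
      ≤ 2 * modeEnergy f a b ε τ M u ut (fun j => u₁ (grid a b M j)) Ψ e n := by
  unfold modeEnergy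
  rw [Finset.mul_sum]
  refine Finset.sum_le_sum fun l hl => ?_
  have hw : 0 ≤ mu a b l ^ (2 * e) := pow_nonneg (mu_nonneg hab l) _
  rw [mul_left_comm]
  refine mul_le_mul_of_nonneg_left ?_ hw
  have e1 := h.mul_dst_eq hab hε hl n
  have e2 := sineCoeff_eq_waveMode_sub a b ε l (u (n * τ)) (ut (n * τ))
  have e3 : Complex.I * ((ε ^ 2 * delta a b ε l : ℝ) : ℂ)
      * (sineCoeff a b (u (n * τ)) l - dst M (Ψ n) l)
      = modeErr f a b ε τ M u ut (fun j => u₁ (grid a b M j)) Ψ (betaPlus a b ε l)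
          (betaMinus a b ε l) n l
        - modeErr f a b ε τ M u ut (fun j => u₁ (grid a b M j)) Ψ (betaMinus a b ε l)
          (betaPlus a b ε l) n l := by
    rw [mul_sub, e1, e2]
    unfold modeErr
    ring
  have hD := one_le_sq_mul_delta a b ε l hε
  have e4 := congrArg norm e3
  rw [norm_mul, norm_mul, Complex.norm_I, one_mul, Complex.norm_real,
    Real.norm_of_nonneg (by linarith)] at e4
  have e5 : ‖sineCoeff a b (u (n * τ)) l - dst M (Ψ n) l‖
      ≤ ε ^ 2 * delta a b ε l * ‖sineCoeff a b (u (n * τ)) l - dst M (Ψ n) l‖ :=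
    le_mul_of_one_le_left (norm_nonneg _) hD
  rw [e4] at e5
  refine (pow_le_pow_left₀ (norm_nonneg _) e5 2).trans ?_
  rw [mul_add]
  exact norm_sub_sq_le_two

/-- Since ε²|β'| can be as large as 1 + 2μ, the initial position error enters with one more
derivative than the velocity error. The weights come from 2(1 + 2μ)² ≤ 4 + 16μ², doubled for the two
modes. -/
theorem modeEnergy_zero_le (hab : a < b) (hε : 0 < ε) (hε1 : ε ≤ 1) (u ut : ℝ → ℝ → ℂ) (e : ℕ) :
    modeEnergy f a b ε τ M u ut v Ψ e 0
      ≤ 4 * (∑ l ∈ Finset.Ioo 0 M, mu a b l ^ (2 * e)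
          * ‖sineCoeff a b (ut 0) l - dst M v l‖ ^ 2)
        + 8 * (∑ l ∈ Finset.Ioo 0 M, mu a b l ^ (2 * e)
          * ‖sineCoeff a b (u 0) l - dst M (Ψ 0) l‖ ^ 2)
        + 32 * (∑ l ∈ Finset.Ioo 0 M, mu a b l ^ (2 * (e + 1))
          * ‖sineCoeff a b (u 0) l - dst M (Ψ 0) l‖ ^ 2) := by
  unfold modeEnergy
  rw [Finset.mul_sum, Finset.mul_sum, Finset.mul_sum, ← Finset.sum_add_distrib,
    ← Finset.sum_add_distrib]
  refine Finset.sum_le_sum fun l _ => ?_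
  have hw : 0 ≤ mu a b l ^ (2 * e) := pow_nonneg (mu_nonneg hab l) _
  have hmu := mu_nonneg hab l
  have hδ := sq_mul_delta_le l hab hε hε1
  have hε2 : ε ^ 2 ≤ 1 := pow_le_one₀ hε.le hε1
  have key : ∀ β β' : ℝ, |β'| ≤ delta a b ε l →
      ‖modeErr f a b ε τ M u ut v Ψ β β' 0 l‖ ^ 2
        ≤ 2 * ‖sineCoeff a b (ut 0) l - dst M v l‖ ^ 2
          + (4 + 16 * mu a b l ^ 2) * ‖sineCoeff a b (u 0) l - dst M (Ψ 0) l‖ ^ 2 := by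
    intro β β' hβ
    have e1 : modeErr f a b ε τ M u ut v Ψ β β' 0 l
        = (ε : ℂ) ^ 2 * (sineCoeff a b (ut 0) l - dst M v l)
          - Complex.I * ((ε ^ 2 * β' : ℝ) : ℂ) * (sineCoeff a b (u 0) l - dst M (Ψ 0) l) := by
      unfold modeErr waveMode schemeMode
      push_cast
      rw [zero_mul]
      ring
    have e2 : |ε ^ 2 * β'| ≤ 1 + 2 * mu a b l := by
      rw [abs_mul, abs_of_nonneg (sq_nonneg ε)]
      exact (mul_le_mul_of_nonneg_left hβ (sq_nonneg ε)).trans hδ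
    rw [e1]
    refine norm_sub_sq_le_two.trans ?_
    rw [norm_mul, norm_mul, norm_mul, Complex.norm_I, one_mul, norm_pow, Complex.norm_real,
      Complex.norm_real, Real.norm_of_nonneg hε.le, Real.norm_eq_abs, mul_pow, mul_pow]
    refine add_le_add ?_ ?_
    · have : (ε ^ 2) ^ 2 ≤ 1 := pow_le_one₀ (sq_nonneg _) hε2
      exact mul_le_mul_of_nonneg_left (mul_le_of_le_one_left (sq_nonneg _) this) zero_le_two
    · rw [← mul_assoc]
      refine mul_le_mul_of_nonneg_right ?_ (sq_nonneg _)
      have := pow_le_pow_left₀ (abs_nonneg _) e2 2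
      nlinarith [sq_nonneg (1 - 2 * mu a b l)]
  have k1 := key (betaPlus a b ε l) _ (abs_betaMinus_le_delta a b ε l hε)
  have k2 := key (betaMinus a b ε l) _ (abs_betaPlus_le_delta a b ε l hε)
  refine (mul_le_mul_of_nonneg_left (add_le_add k1 k2) hw).trans (le_of_eq ?_)
  ring

end

/-! ### Discrete norms and differences of nonlinear functions -/

/-- The squares of the discrete `L²` norm (`e = 0`) and of the discrete `H¹` seminorm (`e ≥ 1`), up
to constants. -/
def gridSq (M : ℕ) : ℕ → (ℕ → ℂ) → ℝ
  | 0, v => (∑ j ∈ Finset.Ioo 0 M, ‖v j‖ ^ 2) / M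
  | _ + 1, v => M * ∑ j ∈ Finset.range M, ‖v (j + 1) - v j‖ ^ 2

theorem gridSq_nonneg (M e : ℕ) (v : ℕ → ℂ) : 0 ≤ gridSq M e v := by
  cases e <;> unfold gridSq <;> positivity

theorem gridSq_congr {M e : ℕ} {v w : ℕ → ℂ} (h : ∀ j ≤ M, v j = w j) :
    gridSq M e v = gridSq M e w := by
  cases e with
  | zero =>
    simp only [gridSq]
    congr 1
    exact Finset.sum_congr rfl fun j hj => by rw [h j (Finset.mem_Ioo.1 hj).2.le]
  | succ e =>
    simp only [gridSq]
    congr 1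
    refine Finset.sum_congr rfl fun j hj => ?_
    have := Finset.mem_range.1 hj
    rw [h j (by omega), h (j + 1) (by omega)]

theorem gridSq_add_le (M e : ℕ) (v w : ℕ → ℂ) :
    gridSq M e (fun j => v j + w j) ≤ 2 * gridSq M e v + 2 * gridSq M e w := by
  cases e with
  | zero =>
    simp only [gridSq]
    rw [← mul_div_assoc, ← mul_div_assoc, ← add_div, Finset.mul_sum, Finset.mul_sum,
      ← Finset.sum_add_distrib]
    gcongr
    exact norm_add_sq_le_two
  | succ e =>
    simp only [gridSq]
    rw [mul_left_comm 2, mul_left_comm 2, ← mul_add, Finset.mul_sum _ _ 2, Finset.mul_sum _ _ 2,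
      ← Finset.sum_add_distrib]
    gcongr
    rw [add_sub_add_comm]
    exact norm_add_sq_le_two

theorem gridSq_const_mul (M e : ℕ) (c : ℂ) (v : ℕ → ℂ) :
    gridSq M e (fun j => c * v j) = ‖c‖ ^ 2 * gridSq M e v := by
  cases e with
  | zero =>
    simp only [gridSq]
    simp only [norm_mul, mul_pow, ← Finset.mul_sum]
    ring
  | succ e =>
    simp only [gridSq]
    simp only [← mul_sub, norm_mul, mul_pow, ← Finset.mul_sum]
    ring

theorem norm_sq_le_gridSq {M : ℕ} {v : ℕ → ℂ} (h0 : v 0 = 0) {j : ℕ} (hj : j ≤ M) :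
    ‖v j‖ ^ 2 ≤ gridSq M 1 v := norm_sq_le_sum_diff h0 hj

theorem sum_mu_dst_le_gridSq {a b : ℝ} (hab : a < b) {M e : ℕ} (he : e ≤ 1) (hM : 0 < M)
    {v : ℕ → ℂ} (h0 : v 0 = 0) (hv : v M = 0) :
    ∑ l ∈ Finset.Ioo 0 M, mu a b l ^ (2 * e) * ‖dst M v l‖ ^ 2
      ≤ (2 + Real.pi ^ 2 / (2 * (b - a) ^ 2)) * gridSq M e v := by
  have hM' : (0 : ℝ) < M := by exact_mod_cast hM
  have hL : 0 < b - a := by linarith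
  have hg := gridSq_nonneg M e v
  have hp : 0 < Real.pi := Real.pi_pos
  rw [add_mul]
  obtain rfl | rfl : e = 0 ∨ e = 1 := by omega
  · refine le_add_of_le_of_nonneg ?_ (by positivity)
    simp only [gridSq]
    rw [sum_norm_sq_eq hM]
    simp only [mul_zero, pow_zero, one_mul]
    refine le_of_eq ?_
    field_simp
  · refine le_add_of_nonneg_of_le (by positivity) ?_
    have h1 := sum_mu_sq_dst_le hab hM h0 hv
    simp only [gridSq]
    rw [mul_one]
    have h2 := mul_le_mul_of_nonneg_left h1
      (show 0 ≤ Real.pi ^ 2 * M / (2 * (b - a) ^ 2) by positivity)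
    refine le_trans (le_of_eq ?_) (h2.trans (le_of_eq ?_))
    · field_simp
      ring
    · ring

theorem gridSq_le_sum_mu_dst {a b : ℝ} (hab : a < b) {M e : ℕ} (he : e ≤ 1) (hM : 0 < M)
    {v : ℕ → ℂ} (h0 : v 0 = 0) (hv : v M = 0) :
    gridSq M e v ≤ (1 + (b - a) ^ 2) *
      ∑ l ∈ Finset.Ioo 0 M, mu a b l ^ (2 * e) * ‖dst M v l‖ ^ 2 := by
  have hM' : (0 : ℝ) < M := by exact_mod_cast hM
  have hS : 0 ≤ ∑ l ∈ Finset.Ioo 0 M, mu a b l ^ (2 * e) * ‖dst M v l‖ ^ 2 :=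
    Finset.sum_nonneg fun l _ => mul_nonneg (pow_nonneg (mu_nonneg hab l) _) (sq_nonneg _)
  rw [add_mul]
  obtain rfl | rfl : e = 0 ∨ e = 1 := by omega
  · refine le_add_of_le_of_nonneg ?_ (by positivity)
    simp only [gridSq]
    rw [sum_norm_sq_eq hM]
    simp only [mul_zero, pow_zero, one_mul] at hS ⊢
    calc _ = 1 / 2 * ∑ l ∈ Finset.Ioo 0 M, ‖dst M v l‖ ^ 2 := by field_simp
      _ ≤ _ := by linarith
  · refine le_add_of_nonneg_of_le (by positivity) ?_
    have h1 := mul_le_mul_of_nonneg_left (sum_norm_sq_diff_le hab hM h0 hv) hM'.le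
    simp only [gridSq]
    rw [mul_one] at hS ⊢
    refine h1.trans ?_
    calc _ = 1 / 2 * ((b - a) ^ 2
          * ∑ l ∈ Finset.Ioo 0 M, mu a b l ^ 2 * ‖dst M v l‖ ^ 2) := by field_simp
      _ ≤ _ := by
        have : 0 ≤ (b - a) ^ 2 * ∑ l ∈ Finset.Ioo 0 M, mu a b l ^ 2 * ‖dst M v l‖ ^ 2 := by
          positivity
        linarith

/-- Cauchy–Schwarz in time for each index, then summation under the integral. It bounds a grid norm
of a time increment from the grid norm of the derivative at almost every time. -/
theorem sum_norm_sq_sub_le_of_isPrim {ι : Type*} (s : Finset ι) {c d B : ℝ} (hcd : c ≤ d)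
    {φ w : ι → ℝ → ℂ} (h : ∀ i ∈ s, IsPrim c d (φ i) (w i))
    (hB : ∀ᵐ r ∂volume.restrict (Ioo c d), ∑ i ∈ s, ‖w i r‖ ^ 2 ≤ B) :
    ∑ i ∈ s, ‖φ i d - φ i c‖ ^ 2 ≤ B * (d - c) ^ 2 := by
  have hd : 0 ≤ d - c := by linarith
  have hB' : ∀ᵐ r ∂volume.restrict (Ioc c d), ∑ i ∈ s, ‖w i r‖ ^ 2 ≤ B := by
    rwa [restrict_Ioo_eq_restrict_Ioc] at hB
  have hi : ∀ i ∈ s, IntervalIntegrable (fun r => ‖w i r‖ ^ 2) volume c d := fun i his => by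
    rw [intervalIntegrable_iff_integrableOn_Ioc_of_le hcd]
    have h1 := ((intervalIntegrable_iff_integrableOn_Ioc_of_le hcd).1 (h i his).1).1
    refine Integrable.of_bound (h1.norm.pow 2) B ?_
    filter_upwards [hB'] with r hr
    rw [norm_pow, norm_norm]
    exact (Finset.single_le_sum (f := fun i => ‖w i r‖ ^ 2) (fun i _ => sq_nonneg _) his).trans hr
  have h1 : ∑ i ∈ s, ∫ r in c..d, ‖w i r‖ ^ 2 ≤ B * (d - c) := by
    rw [← intervalIntegral.integral_finsetSum hi]
    have h2 := intervalIntegral.integral_mono_ae_restrict hcd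
      (f := fun r => ∑ i ∈ s, ‖w i r‖ ^ 2) (g := fun _ => B) ?_
      (intervalIntegrable_const (μ := volume)) ?_
    · rw [intervalIntegral.integral_const, smul_eq_mul] at h2
      linarith
    · refine (IntervalIntegrable.sum s hi).congr fun r _ => ?_
      simp [Finset.sum_apply]
    · rwa [← restrict_Ioo_eq_restrict_Icc]
  calc _ ≤ ∑ i ∈ s, (d - c) * ∫ r in c..d, ‖w i r‖ ^ 2 := by
        refine Finset.sum_le_sum fun i his => ?_
        rw [(h i his).sub_eq ⟨le_rfl, hcd⟩ ⟨hcd, le_rfl⟩]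
        exact norm_sq_integral_le hcd (h i his).1 (hi i his)
    _ = (d - c) * ∑ i ∈ s, ∫ r in c..d, ‖w i r‖ ^ 2 := by rw [Finset.mul_sum]
    _ ≤ (d - c) * (B * (d - c)) := by gcongr
    _ = _ := by ring

theorem IsPrim.sub {c d : ℝ} {u v u' v' : ℝ → ℂ} (h : IsPrim c d u u')
    (h' : IsPrim c d v v') : IsPrim c d (fun x => u x - v x) (fun x => u' x - v' x) := by
  have := h.add (h'.const_mul (-1))
  simpa only [neg_one_mul, ← sub_eq_add_neg] using this

theorem gridSq_sub_le_of_isPrim {M e : ℕ} (hM : 0 < M) {c d B : ℝ} (hcd : c ≤ d)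
    {φ w : ℝ → ℕ → ℂ} (h : ∀ j ≤ M, IsPrim c d (fun r => φ r j) (fun r => w r j))
    (hB : ∀ᵐ r ∂volume.restrict (Ioo c d), gridSq M e (w r) ≤ B) :
    gridSq M e (fun j => φ d j - φ c j) ≤ B * (d - c) ^ 2 := by
  have hM' : (0 : ℝ) < M := by exact_mod_cast hM
  cases e with
  | zero =>
    simp only [gridSq] at hB ⊢
    have := sum_norm_sq_sub_le_of_isPrim (Finset.Ioo 0 M) (B := B * M) hcd
      (fun j hj => h j (Finset.mem_Ioo.1 hj).2.le)
      (by filter_upwards [hB] with r hr; exact (div_le_iff₀ hM').1 hr)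
    rw [div_le_iff₀ hM']
    refine this.trans (le_of_eq (by ring))
  | succ e =>
    simp only [gridSq] at hB ⊢
    have := sum_norm_sq_sub_le_of_isPrim (Finset.range M) (B := B / M) hcd
      (φ := fun j r => φ r (j + 1) - φ r j)
      (fun j hj => (h (j + 1) (by have := Finset.mem_range.1 hj; omega)).sub
        (h j (by have := Finset.mem_range.1 hj; omega)))
      (by filter_upwards [hB] with r hr; rw [le_div_iff₀ hM', mul_comm]; exact hr)
    have h2 := mul_le_mul_of_nonneg_left this hM'.le
    refine le_trans (le_of_eq ?_) (h2.trans (le_of_eq ?_))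
    · congr 1
      refine Finset.sum_congr rfl fun j _ => ?_
      congr 2
      ring
    · field_simp

/-- The discrete form of DG(p)p' − DG(q)q' = (DG(p) − DG(q))p' + DG(q)(p' − q'), along the segments
joining p₂ to p₁ and q₂ to q₁. The asymmetry matters: beyond the difference of increments, only the
increment of p occurs. -/
theorem exists_mixed_difference {E : Type*} [NormedAddCommGroup E] [NormedSpace ℝ E]
    [FiniteDimensional ℝ E] {G : E → ℂ} (hG : ContDiff ℝ 2 G) (R : ℝ) :
    ∃ L : ℝ, 0 ≤ L ∧ ∀ p₁ p₂ q₁ q₂ : E, ‖p₁‖ ≤ R → ‖p₂‖ ≤ R → ‖q₁‖ ≤ R → ‖q₂‖ ≤ R →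
      ‖(G p₁ - G p₂) - (G q₁ - G q₂)‖
        ≤ L * (‖(p₁ - p₂) - (q₁ - q₂)‖ + ‖p₁ - p₂‖ * (‖p₁ - q₁‖ + ‖p₂ - q₂‖)) := by
  have : ProperSpace E := FiniteDimensional.proper ℝ E
  have hD : ContDiff ℝ 1 (fderiv ℝ G) := hG.fderiv_right (by norm_num)
  obtain ⟨K, hK⟩ := hD.contDiffOn.exists_lipschitzOnWith (by simp)
    (convex_closedBall (0 : E) R) (isCompact_closedBall _ _)
  obtain ⟨B, hB⟩ := (isCompact_closedBall (0 : E) R).exists_bound_of_continuousOn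
    hD.continuous.continuousOn
  refine ⟨max B 0 + K, by positivity, fun p₁ p₂ q₁ q₂ hp₁ hp₂ hq₁ hq₂ => ?_⟩
  have hball : ∀ {p q : E}, ‖p‖ ≤ R → ‖q‖ ≤ R → ∀ θ ∈ Icc (0 : ℝ) 1,
      q + θ • (p - q) ∈ Metric.closedBall (0 : E) R := fun {p q} hp hq θ hθ =>
    (convex_closedBall (0 : E) R).add_smul_sub_mem (by simpa using hq) (by simpa using hp) hθ
  have hd : ∀ p q : E, ∀ θ : ℝ, HasDerivAt (fun θ : ℝ => G (q + θ • (p - q)))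
      (fderiv ℝ G (q + θ • (p - q)) (p - q)) θ := fun p q θ => by
    have h1 : HasDerivAt (fun θ : ℝ => q + θ • (p - q)) (p - q) θ := by
      simpa using ((hasDerivAt_id θ).smul_const (p - q)).const_add q
    exact ((hG.differentiable (by norm_num) _).hasFDerivAt.comp_hasDerivAt θ h1)
  have h := norm_image_sub_le_of_norm_deriv_le_segment_01'
    (f := fun θ : ℝ => G (p₂ + θ • (p₁ - p₂)) - G (q₂ + θ • (q₁ - q₂)))
    (f' := fun θ => fderiv ℝ G (p₂ + θ • (p₁ - p₂)) (p₁ - p₂)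
      - fderiv ℝ G (q₂ + θ • (q₁ - q₂)) (q₁ - q₂))
    (C := (max B 0 + K) * (‖(p₁ - p₂) - (q₁ - q₂)‖ + ‖p₁ - p₂‖ * (‖p₁ - q₁‖ + ‖p₂ - q₂‖)))
    (fun θ _ => ((hd p₁ p₂ θ).sub (hd q₁ q₂ θ)).hasDerivWithinAt) (fun θ hθ => ?_)
  · simp only [one_smul, zero_smul, add_zero, add_sub_cancel] at h
    rwa [sub_sub_sub_comm]
  · have hθ' : θ ∈ Icc (0 : ℝ) 1 := Ico_subset_Icc_self hθ
    have m1 := hball hp₁ hp₂ θ hθ'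
    have m2 := hball hq₁ hq₂ θ hθ'
    set x := p₂ + θ • (p₁ - p₂) with hx
    set y := q₂ + θ • (q₁ - q₂) with hy
    have e1 : fderiv ℝ G x (p₁ - p₂) - fderiv ℝ G y (q₁ - q₂)
        = (fderiv ℝ G x - fderiv ℝ G y) (p₁ - p₂) + fderiv ℝ G y ((p₁ - p₂) - (q₁ - q₂)) := by
      rw [sub_apply, map_sub (fderiv ℝ G y) (p₁ - p₂)]
      abel
    have e2 : ‖x - y‖ ≤ ‖p₁ - q₁‖ + ‖p₂ - q₂‖ := by
      have : x - y = θ • (p₁ - q₁) + (1 - θ) • (p₂ - q₂) := by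
        rw [hx, hy]
        module
      rw [this]
      refine (norm_add_le _ _).trans (add_le_add ?_ ?_)
      · rw [norm_smul, Real.norm_of_nonneg hθ'.1]
        exact mul_le_of_le_one_left (norm_nonneg _) hθ'.2
      · rw [norm_smul, Real.norm_of_nonneg (by linarith [hθ'.2])]
        exact mul_le_of_le_one_left (norm_nonneg _) (by linarith [hθ'.1])
    have e3 : ‖fderiv ℝ G x - fderiv ℝ G y‖ ≤ K * (‖p₁ - q₁‖ + ‖p₂ - q₂‖) := by
      have := hK.dist_le_mul x m1 y m2
      rw [dist_eq_norm, dist_eq_norm] at this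
      exact this.trans (by gcongr)
    have e4 : ‖fderiv ℝ G y‖ ≤ max B 0 := (hB y m2).trans (le_max_left _ _)
    rw [e1]
    refine (norm_add_le _ _).trans ?_
    have e5 := (ContinuousLinearMap.le_opNorm (fderiv ℝ G x - fderiv ℝ G y) (p₁ - p₂)).trans
      (mul_le_mul_of_nonneg_right e3 (norm_nonneg _))
    have e6 := (ContinuousLinearMap.le_opNorm (fderiv ℝ G y) ((p₁ - p₂) - (q₁ - q₂))).trans
      (mul_le_mul_of_nonneg_right e4 (norm_nonneg _))
    have hB0 : 0 ≤ max B 0 := le_max_right _ _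
    have hK0 : (0 : ℝ) ≤ K := K.2
    set m := ‖(p₁ - p₂) - (q₁ - q₂)‖
    set t := ‖p₁ - q₁‖ + ‖p₂ - q₂‖
    have hm : 0 ≤ m := norm_nonneg _
    have ht : 0 ≤ ‖p₁ - p₂‖ * t := by positivity
    have := mul_nonneg hK0 hm
    have := mul_nonneg hB0 ht
    calc _ ≤ K * t * ‖p₁ - p₂‖ + max B 0 * m := add_le_add e5 e6
      _ ≤ _ := by ring_nf at *; linarith

/-- For the H¹ seminorm, `p` is the exact solution, whose increments are O(1/M), and `q` the
numerical one, of whose increments nothing is assumed. The values of p − q are bounded by the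
seminorm itself through the discrete Sobolev inequality, as p − q vanishes at 0. -/
theorem exists_gridSq_nonlin_sub_le {f : ℝ → ℝ} (hf : ContDiffOn ℝ (2 : ℕ) f (Ici 0)) {e : ℕ}
    (he : e ≤ 1) (R Λ : ℝ) :
    ∃ K : ℝ, 0 ≤ K ∧ ∀ (M : ℕ) (p q : ℕ → ℂ), 0 < M → (∀ j ≤ M, ‖p j‖ ≤ R) →
      (∀ j ≤ M, ‖q j‖ ≤ R) → p 0 = q 0 → (∀ j < M, ‖p (j + 1) - p j‖ ≤ Λ / M) →
      gridSq M e (fun j => nonlin f (p j) - nonlin f (q j))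
        ≤ K * gridSq M e (fun j => p j - q j) := by
  obtain rfl | rfl : e = 0 ∨ e = 1 := by omega
  · obtain ⟨K, hK0, hK⟩ := exists_lipschitz_nonlin (hf.of_le (by norm_num)) R
    refine ⟨K ^ 2, by positivity, fun M p q hM hp hq _ _ => ?_⟩
    simp only [gridSq]
    rw [← mul_div_assoc, Finset.mul_sum]
    gcongr with j hj
    rw [← mul_pow]
    have hj' := (Finset.mem_Ioo.1 hj).2.le
    exact pow_le_pow_left₀ (norm_nonneg _) (hK _ _ (hp j hj') (hq j hj')) 2
  · obtain ⟨L, hL0, hL⟩ := exists_mixed_difference (contDiff_nonlin hf) R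
    refine ⟨L ^ 2 * (2 + 8 * Λ ^ 2), by positivity, fun M p q hM hp hq h0 hΛ => ?_⟩
    have hM' : (0 : ℝ) < M := by exact_mod_cast hM
    set d := fun j => p j - q j with hd
    set g := gridSq M 1 d with hg
    have hg0 : 0 ≤ g := gridSq_nonneg _ _ _
    have hj : ∀ j ≤ M, ‖d j‖ ≤ √g := fun j hj =>
      Real.le_sqrt_of_sq_le (norm_sq_le_gridSq (by simp [hd, h0]) hj)
    have h1 : ∀ j ∈ Finset.range M,
        ‖(nonlin f (p (j + 1)) - nonlin f (q (j + 1))) - (nonlin f (p j) - nonlin f (q j))‖ ^ 2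
          ≤ L ^ 2 * (2 * ‖d (j + 1) - d j‖ ^ 2 + 8 * Λ ^ 2 * g / M ^ 2) := by
      intro j hjM
      have hjM' := Finset.mem_range.1 hjM
      have h2 := hL (p (j + 1)) (p j) (q (j + 1)) (q j) (hp _ (by omega)) (hp _ (by omega))
        (hq _ (by omega)) (hq _ (by omega))
      have h3 : ‖p (j + 1) - p j‖ * (‖p (j + 1) - q (j + 1)‖ + ‖p j - q j‖) ≤ Λ / M * (2 * √g) := by
        refine mul_le_mul (hΛ j hjM') ?_ (by positivity) ((norm_nonneg _).trans (hΛ j hjM'))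
        have := hj (j + 1) (by omega)
        have := hj j (by omega)
        simp only [hd] at *
        linarith
      have h4 : (p (j + 1) - p j) - (q (j + 1) - q j) = d (j + 1) - d j := by
        simp only [hd]; ring
      rw [h4] at h2
      have h5 : (nonlin f (p (j + 1)) - nonlin f (q (j + 1))) - (nonlin f (p j) - nonlin f (q j))
        = (nonlin f (p (j + 1)) - nonlin f (p j)) - (nonlin f (q (j + 1)) - nonlin f (q j)) := by
        ring
      rw [h5]
      have h6 := h2.trans (mul_le_mul_of_nonneg_left (add_le_add_right h3 _) hL0)
      refine (pow_le_pow_left₀ (norm_nonneg _) h6 2).trans ?_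
      rw [mul_pow]
      refine mul_le_mul_of_nonneg_left ?_ (sq_nonneg _)
      have h7 : (Λ / M * (2 * √g)) ^ 2 = 4 * Λ ^ 2 * g / M ^ 2 := by
        rw [mul_pow, mul_pow, Real.sq_sqrt hg0]; ring
      have h8 : 8 * Λ ^ 2 * g / M ^ 2 = 2 * (4 * Λ ^ 2 * g / M ^ 2) := by ring
      rw [h8, ← h7]
      nlinarith [sq_nonneg (‖d (j + 1) - d j‖ - Λ / M * (2 * √g))]
    have h2 := mul_le_mul_of_nonneg_left (Finset.sum_le_sum h1) hM'.le
    refine h2.trans ?_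
    rw [← Finset.mul_sum, Finset.sum_add_distrib, ← Finset.mul_sum, Finset.sum_const,
      Finset.card_range, nsmul_eq_mul]
    have h3 : (M : ℝ) * ∑ j ∈ Finset.range M, ‖d (j + 1) - d j‖ ^ 2 = g := rfl
    refine le_of_eq ?_
    calc _ = L ^ 2 * (2 * (M * ∑ j ∈ Finset.range M, ‖d (j + 1) - d j‖ ^ 2)
          + 8 * Λ ^ 2 * g) := by field_simp
      _ = _ := by rw [h3]; ring

/-! ### The nonlinearity along the solution -/

/-- `nonlinG` and `nonlinH` are the Wirtinger derivatives of the nonlinearity, so the first step of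
the scheme uses the exact time derivative of F(ψ) at time 0. -/
theorem fderiv_nonlin {f : ℝ → ℝ} (hf : ContDiffOn ℝ (1 : ℕ) f (Ici 0)) (z w : ℂ) :
    fderiv ℝ (nonlin f) z w = nonlinG f z * w + nonlinH f z * conj w := by
  have hl : HasDerivAt (fun t : ℝ => z + t • w) w 0 := by
    simpa using ((hasDerivAt_id (0 : ℝ)).smul_const w).const_add z
  have h1 : HasDerivAt (fun t : ℝ => nonlin f (z + t • w)) (fderiv ℝ (nonlin f) z w) 0 := by
    have hd : HasFDerivAt (nonlin f) (fderiv ℝ (nonlin f) z) (z + (0 : ℝ) • w) := by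
      rw [zero_smul, add_zero]
      exact ((contDiff_nonlin hf).differentiable (by norm_num) z).hasFDerivAt
    exact hd.comp_hasDerivAt 0 hl
  have hr : HasDerivAt (fun t : ℝ => ‖z + t • w‖ ^ 2) (2 * inner ℝ z w) 0 := by
    simpa using hl.norm_sq
  have hf' : HasDerivWithinAt f (derivWithin f (Ici 0) (‖z‖ ^ 2)) (Ici 0) (‖z‖ ^ 2) :=
    (hf.differentiableOn (by norm_num) _ (sq_nonneg ‖z‖ : 0 ≤ ‖z‖ ^ 2)).hasDerivWithinAt
  have h2 : HasDerivAt (fun t : ℝ => f (‖z + t • w‖ ^ 2))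
      (derivWithin f (Ici 0) (‖z‖ ^ 2) * (2 * inner ℝ z w)) 0 := by
    refine HasDerivWithinAt.comp_hasDerivAt (h₂ := f) (t := Ici 0) 0 ?_ hr ?_
    · simpa using hf'
    · exact Filter.Eventually.of_forall fun t => sq_nonneg ‖z + t • w‖
  have h3 := h2.ofReal_comp.mul hl
  have h4 := h1.unique h3
  rw [h4, zero_smul, add_zero, nonlinG, nonlinH, Complex.inner]
  have e1 : (((w * conj z).re : ℝ) : ℂ) * 2 = conj z * w + z * conj w := by
    have := Complex.add_conj (w * conj z)
    rw [map_mul, Complex.conj_conj] at this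
    push_cast at this
    linear_combination -this
  have e2 : ((‖z‖ : ℝ) : ℂ) ^ 2 = z * conj z := (Complex.mul_conj' z).symm
  push_cast
  rw [e2]
  linear_combination ((derivWithin f (Ici 0) (‖z‖ ^ 2) : ℝ) : ℂ) * z * e1

/-- Here three derivatives of `f` are spent: the mixed difference estimate is to be applied to (z,
w) ↦ DF(z)w, which has to be C². -/
theorem contDiff_fderiv_nonlin {f : ℝ → ℝ} (hf : ContDiffOn ℝ (3 : ℕ) f (Ici 0)) :
    ContDiff ℝ 2 fun p : ℂ × ℂ => fderiv ℝ (nonlin f) p.1 p.2 := by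
  have h1 : ContDiff ℝ 2 (fderiv ℝ (nonlin f)) :=
    (contDiff_nonlin hf).fderiv_right (by norm_num)
  exact (h1.comp contDiff_fst).clm_apply contDiff_snd

theorem HS.gridSq_le {a b : ℝ} (hab : a < b) {M : ℕ} (hM : 0 < M) (e : ℕ) {s : Bool} {C : ℝ}
    {u : ℝ → ℂ} (h : HS a b 1 s C u) :
    gridSq M e (fun j => u (grid a b M j)) ≤ (1 + (b - a)) * C ^ 2 := by
  have hM' : (0 : ℝ) < M := by exact_mod_cast hM
  have hL : 0 < b - a := by linarith
  rw [add_mul]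
  cases e with
  | zero =>
    refine le_add_of_le_of_nonneg ?_ (by positivity)
    simp only [gridSq]
    rw [one_mul, div_le_iff₀ hM']
    calc _ ≤ ∑ j ∈ Finset.Ioo 0 M, C ^ 2 := by
          refine Finset.sum_le_sum fun j hj => pow_le_pow_left₀ (norm_nonneg _) ?_ 2
          exact h.1 _ (Ioo_subset_Icc_self (grid_mem_Ioo hab hj))
      _ ≤ _ := by
          rw [Finset.sum_const, nsmul_eq_mul, Nat.card_Ioo, mul_comm]
          gcongr
          omega
  | succ e =>
    refine le_add_of_nonneg_of_le (by positivity) ?_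
    simp only [gridSq]
    refine (mul_le_mul_of_nonneg_left (h.sum_grid_diff_sq_le hab hM) hM'.le).trans (le_of_eq ?_)
    field_simp

section

variable {f : ℝ → ℝ} {a b T ε C : ℝ} {u ut utt : ℝ → ℝ → ℂ}

theorem gridSq_sub_comm (M e : ℕ) (v w : ℕ → ℂ) :
    gridSq M e (fun j => v j - w j) = gridSq M e (fun j => w j - v j) := by
  have := gridSq_const_mul M e (-1) fun j => w j - v j
  simpa using this

theorem IsTimeDeriv.gridSq_sub_le {v : ℝ → ℝ → ℂ} (h : IsTimeDeriv a b T u v) (hab : a < b)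
    {M : ℕ} (hM : 0 < M) (e : ℕ)
    (hv : ∀ᵐ t ∂volume.restrict (Icc 0 T), HS a b 1 true C (v t)) {s t : ℝ} (hs : s ∈ Icc 0 T)
    (ht : t ∈ Icc 0 T) :
    gridSq M e (fun j => u t (grid a b M j) - u s (grid a b M j))
      ≤ (1 + (b - a)) * C ^ 2 * (t - s) ^ 2 := by
  wlog hst : s ≤ t generalizing s t
  · rw [gridSq_sub_comm, ← neg_sub s t, neg_sq]
    exact this ht hs (by linarith)
  refine gridSq_sub_le_of_isPrim hM hst (φ := fun r j => u r (grid a b M j))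
    (w := fun r j => v r (grid a b M j)) (fun j hj =>
      (h.isPrim (grid_mem_Icc hab hM hj)).mono hs ht hst) ?_
  filter_upwards [ae_restrict_of_ae_restrict_of_subset
    (Ioo_subset_Icc_self.trans (Icc_subset_Icc hs.1 ht.2)) hv] with r hr using hr.gridSq_le hab hM e

namespace IsRegularWave

theorem isPrim_nonlin (h : IsRegularWave f a b T ε C u ut utt) (hT : 0 < T)
    (hf : ContDiffOn ℝ (1 : ℕ) f (Ici 0)) {x : ℝ} (hx : x ∈ Icc a b) :
    IsPrim 0 T (fun t => nonlin f (u t x)) (fun t => fderiv ℝ (nonlin f) (u t x) (ut t x)) := by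
  have p1 := h.deriv_one.isPrim hx
  have c1 := p1.continuousOn hT.le
  have c2 := (h.deriv_two.isPrim hx).continuousOn hT.le
  have hF := contDiff_nonlin hf
  have hc : ContinuousOn (fun t => fderiv ℝ (nonlin f) (u t x) (ut t x)) (Icc 0 T) :=
    ((hF.continuous_fderiv (by norm_num)).comp_continuousOn c1).clm_apply c2
  refine ⟨ContinuousOn.intervalIntegrable (by rwa [uIcc_of_le hT.le]), fun t ht => ?_⟩
  rw [intervalIntegral.integral_eq_sub_of_hasDerivAt_of_le ht.1 (f := fun t => nonlin f (u t x))]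
  · ring
  · exact hF.continuous.comp_continuousOn (c1.mono (Icc_subset_Icc_right ht.2))
  · intro s hs
    exact ((hF.differentiable (by norm_num) _).hasFDerivAt.comp_hasDerivAt s
      (p1.hasDerivAt_of_continuousAt ⟨hs.1, hs.2.trans_le ht.2⟩ c2))
  · refine ContinuousOn.intervalIntegrable ?_
    rw [uIcc_of_le ht.1]
    exact hc.mono (Icc_subset_Icc_right ht.2)

end IsRegularWave

theorem norm_prod_sq_le (z w : ℂ) : ‖(z, w)‖ ^ 2 ≤ ‖z‖ ^ 2 + ‖w‖ ^ 2 := by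
  rw [Prod.norm_mk]
  rcases max_choice ‖z‖ ‖w‖ with h | h <;> rw [h] <;> nlinarith [norm_nonneg z, norm_nonneg w]

/-- The derivative ∂ₜF(u) is Lipschitz in time in the discrete norms. In the H¹ case the mixed
difference estimate compares (u, u_t) at neighbouring grid points (p₁, p₂) at time t with the same
points (q₁, q₂) at time s: the spatial increments are square summable and the time increments are at
most C|t − s|. -/
theorem exists_gridSq_velocity_le (hab : a < b) (hT : 0 < T)
    (hf : ContDiffOn ℝ (3 : ℕ) f (Ici 0)) {e : ℕ} (he : e ≤ 1) (C : ℝ) :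
    ∃ Λ : ℝ, 0 ≤ Λ ∧ ∀ (ε : ℝ) (u ut utt : ℝ → ℝ → ℂ) (M : ℕ), 0 < M →
      IsRegularWave f a b T ε C u ut utt → ∀ s ∈ Icc 0 T, ∀ t ∈ Icc 0 T,
      gridSq M e (fun j =>
        fderiv ℝ (nonlin f) (u t (grid a b M j)) (ut t (grid a b M j))
          - fderiv ℝ (nonlin f) (u s (grid a b M j)) (ut s (grid a b M j)))
        ≤ Λ * (t - s) ^ 2 := by
  have hG := contDiff_fderiv_nonlin hf
  set G := fun p : ℂ × ℂ => fderiv ℝ (nonlin f) p.1 p.2 with hGdef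
  have hL : 0 < b - a := by linarith
  have key : ∀ (ε : ℝ) (u ut utt : ℝ → ℝ → ℂ), IsRegularWave f a b T ε C u ut utt →
      ∀ s ∈ Icc 0 T, ∀ t ∈ Icc 0 T, ∀ x ∈ Icc a b,
      ‖(u t x, ut t x)‖ ≤ C ∧ ‖(u t x, ut t x) - (u s x, ut s x)‖ ≤ C * |t - s| := by
    intro ε u ut utt h s hs t ht x hx
    refine ⟨norm_prod_le_iff.2 ⟨(h.value t ht).1 x hx, (h.velocity t ht).1 x hx⟩, ?_⟩
    rw [Prod.mk_sub_mk]
    exact norm_prod_le_iff.2 ⟨h.norm_sub_le hs ht hx, h.norm_velocity_sub_le hs ht hx⟩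
  obtain rfl | rfl : e = 0 ∨ e = 1 := by omega
  · obtain ⟨K, hK⟩ := (hG.of_le (by norm_num : (1 : WithTop ℕ∞) ≤ 2)).contDiffOn.exists_lipschitzOnWith
      (by simp) (convex_closedBall (0 : ℂ × ℂ) C) (isCompact_closedBall _ _)
    refine ⟨K ^ 2 * C ^ 2, by positivity, fun ε u ut utt M hM h s hs t ht => ?_⟩
    have hM' : (0 : ℝ) < M := by exact_mod_cast hM
    simp only [gridSq]
    rw [div_le_iff₀ hM']
    calc _ ≤ ∑ j ∈ Finset.Ioo 0 M, K ^ 2 * C ^ 2 * (t - s) ^ 2 := by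
          refine Finset.sum_le_sum fun j hj => ?_
          have hx := Ioo_subset_Icc_self (grid_mem_Ioo hab hj)
          obtain ⟨k1, k2⟩ := key ε u ut utt h s hs t ht _ hx
          obtain ⟨k3, -⟩ := key ε u ut utt h s hs s hs _ hx
          have := hK.dist_le_mul _ (mem_closedBall_zero_iff.2 k1) _ (mem_closedBall_zero_iff.2 k3)
          rw [dist_eq_norm, dist_eq_norm] at this
          have h2 := pow_le_pow_left₀ (norm_nonneg _)
            (this.trans (mul_le_mul_of_nonneg_left k2 K.2)) 2
          rw [mul_pow, mul_pow, sq_abs, ← mul_assoc] at h2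
          exact h2
      _ ≤ _ := by
          rw [Finset.sum_const, nsmul_eq_mul, Nat.card_Ioo, mul_comm]
          gcongr
          omega
  · obtain ⟨K, hK0, hK⟩ := exists_mixed_difference hG C
    refine ⟨2 * K ^ 2 * (2 * ((1 + (b - a)) * C ^ 2) + 8 * C ^ 2 * ((1 + (b - a)) * C ^ 2)),
      by positivity, fun ε u ut utt M hM h s hs t ht => ?_⟩
    have hM' : (0 : ℝ) < M := by exact_mod_cast hM
    have hC := h.nonneg hab hT
    have hae : ∀ᵐ t ∂volume.restrict (Icc 0 T), HS a b 1 true C (ut t) :=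
      (ae_restrict_mem measurableSet_Icc).mono fun t ht => h.velocity t ht
    have g1 := h.deriv_one.gridSq_sub_le hab hM 1 hae hs ht
    have g2 := h.deriv_two.gridSq_sub_le hab hM 1 h.acceleration hs ht
    have g3 := (h.value t ht).gridSq_le hab hM 1
    have g4 := (h.velocity t ht).gridSq_le hab hM 1
    simp only [gridSq] at g1 g2 g3 g4 ⊢
    have h1 : ∀ j ∈ Finset.range M,
        ‖(G (u t (grid a b M (j + 1)), ut t (grid a b M (j + 1)))
            - G (u s (grid a b M (j + 1)), ut s (grid a b M (j + 1))))
          - (G (u t (grid a b M j), ut t (grid a b M j))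
            - G (u s (grid a b M j), ut s (grid a b M j)))‖ ^ 2
        ≤ 2 * K ^ 2 * ((‖u t (grid a b M (j + 1)) - u s (grid a b M (j + 1))
              - (u t (grid a b M j) - u s (grid a b M j))‖ ^ 2
            + ‖ut t (grid a b M (j + 1)) - ut s (grid a b M (j + 1))
              - (ut t (grid a b M j) - ut s (grid a b M j))‖ ^ 2)
          + 4 * C ^ 2 * (t - s) ^ 2 * (‖u t (grid a b M (j + 1)) - u t (grid a b M j)‖ ^ 2
            + ‖ut t (grid a b M (j + 1)) - ut t (grid a b M j)‖ ^ 2)) := by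
      intro j hj
      have hj' := Finset.mem_range.1 hj
      have x1 := grid_mem_Icc hab hM (show j + 1 ≤ M by omega)
      have x2 := grid_mem_Icc hab hM (show j ≤ M by omega)
      obtain ⟨k1, d1⟩ := key ε u ut utt h s hs t ht _ x1
      obtain ⟨k2, d2⟩ := key ε u ut utt h s hs t ht _ x2
      obtain ⟨k3, -⟩ := key ε u ut utt h s hs s hs _ x1
      obtain ⟨k4, -⟩ := key ε u ut utt h s hs s hs _ x2
      have hm := hK _ _ _ _ k1 k2 k3 k4
      rw [sub_sub_sub_comm]
      simp only [Prod.mk_sub_mk] at hm d1 d2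
      set m := ‖((u t (grid a b M (j + 1)) - u t (grid a b M j)
          - (u s (grid a b M (j + 1)) - u s (grid a b M j)),
        ut t (grid a b M (j + 1)) - ut t (grid a b M j)
          - (ut s (grid a b M (j + 1)) - ut s (grid a b M j))) : ℂ × ℂ)‖ with hmdef
      set p := ‖((u t (grid a b M (j + 1)) - u t (grid a b M j),
        ut t (grid a b M (j + 1)) - ut t (grid a b M j)) : ℂ × ℂ)‖ with hpdef
      have hp0 : 0 ≤ p := norm_nonneg _
      have hm2 := norm_prod_sq_le (u t (grid a b M (j + 1)) - u t (grid a b M j)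
          - (u s (grid a b M (j + 1)) - u s (grid a b M j)))
        (ut t (grid a b M (j + 1)) - ut t (grid a b M j)
          - (ut s (grid a b M (j + 1)) - ut s (grid a b M j)))
      have hp2 := norm_prod_sq_le (u t (grid a b M (j + 1)) - u t (grid a b M j))
        (ut t (grid a b M (j + 1)) - ut t (grid a b M j))
      rw [← hmdef] at hm2
      rw [← hpdef] at hp2
      rw [sub_sub_sub_comm (u t (grid a b M (j + 1))), sub_sub_sub_comm (ut t (grid a b M (j + 1)))]
      have hm3 := hm.trans (mul_le_mul_of_nonneg_left (add_le_add_right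
        (mul_le_mul_of_nonneg_left (add_le_add d1 d2) hp0) m) hK0)
      refine (pow_le_pow_left₀ (norm_nonneg _) hm3 2).trans ?_
      rw [mul_pow, mul_assoc, mul_left_comm]
      refine mul_le_mul_of_nonneg_left ?_ (sq_nonneg K)
      have e1 : (p * (C * |t - s| + C * |t - s|)) ^ 2 = 4 * C ^ 2 * (t - s) ^ 2 * p ^ 2 := by
        rw [← sq_abs (t - s)]; ring
      have e2 : 4 * C ^ 2 * (t - s) ^ 2 * p ^ 2 ≤ 4 * C ^ 2 * (t - s) ^ 2 *
        (‖u t (grid a b M (j + 1)) - u t (grid a b M j)‖ ^ 2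
            + ‖ut t (grid a b M (j + 1)) - ut t (grid a b M j)‖ ^ 2) := by gcongr
      nlinarith [sq_nonneg (m - p * (C * |t - s| + C * |t - s|))]
    have h2 := mul_le_mul_of_nonneg_left (Finset.sum_le_sum h1) hM'.le
    refine h2.trans ?_
    simp only [← Finset.mul_sum, Finset.sum_add_distrib]
    have h3 : 0 ≤ 2 * K ^ 2 := by positivity
    have h4 : 0 ≤ 4 * C ^ 2 * (t - s) ^ 2 := by positivity
    have h5 := mul_le_mul_of_nonneg_left (add_le_add (add_le_add g1 g2)
      (mul_le_mul_of_nonneg_left (add_le_add g3 g4) h4)) h3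
    refine le_trans (le_of_eq ?_) (h5.trans (le_of_eq ?_)) <;> ring

/-- The linear Taylor polynomial is subtracted in integrated form: r ↦ F(u(r)) − r ∂ₜF(u(t)) has a
derivative of size |r − t|. Both orders of s and t are needed, because the scheme looks back to the
previous time level. -/
theorem exists_gridSq_taylor_le (hab : a < b) (hT : 0 < T)
    (hf : ContDiffOn ℝ (3 : ℕ) f (Ici 0)) {e : ℕ} (he : e ≤ 1) (C : ℝ) :
    ∃ Λ : ℝ, 0 ≤ Λ ∧ ∀ (ε : ℝ) (u ut utt : ℝ → ℝ → ℂ) (M : ℕ), 0 < M →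
      IsRegularWave f a b T ε C u ut utt → ∀ s ∈ Icc 0 T, ∀ t ∈ Icc 0 T,
      gridSq M e (fun j =>
        nonlin f (u s (grid a b M j)) - nonlin f (u t (grid a b M j)) - ((s - t : ℝ) : ℂ) *
          fderiv ℝ (nonlin f) (u t (grid a b M j)) (ut t (grid a b M j)))
        ≤ Λ * (s - t) ^ 4 := by
  obtain ⟨Λ, hΛ0, hΛ⟩ := exists_gridSq_velocity_le hab hT hf he C
  refine ⟨Λ, hΛ0, fun ε u ut utt M hM h s hs t ht => ?_⟩
  have hp : ∀ j ≤ M, IsPrim 0 T (fun r => nonlin f (u r (grid a b M j)) - (r : ℂ)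
        * fderiv ℝ (nonlin f) (u t (grid a b M j)) (ut t (grid a b M j)))
      (fun r => fderiv ℝ (nonlin f) (u r (grid a b M j)) (ut r (grid a b M j))
        - fderiv ℝ (nonlin f) (u t (grid a b M j)) (ut t (grid a b M j))) := fun j hj => by
    have h1 := h.isPrim_nonlin hT (hf.of_le (by norm_num)) (grid_mem_Icc hab hM hj)
    have h2 : IsPrim 0 T (fun r : ℝ => (r : ℂ)) (fun _ => 1) :=
      isPrim_of_hasDerivAt continuous_const (fun r => (hasDerivAt_id r).ofReal_comp) 0 T
    have h3 := h2.const_mul (fderiv ℝ (nonlin f) (u t (grid a b M j)) (ut t (grid a b M j)))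
    refine (h1.sub h3).congr hT.le (fun r _ => by simp only [mul_comm]) ?_
    exact Filter.Eventually.of_forall fun r => by simp only [mul_one]
  rcases le_total t s with hts | hst
  · have h1 := gridSq_sub_le_of_isPrim hM (e := e) (B := Λ * (s - t) ^ 2) hts
      (φ := fun r j => nonlin f (u r (grid a b M j)) - (r : ℂ)
        * fderiv ℝ (nonlin f) (u t (grid a b M j)) (ut t (grid a b M j)))
      (w := fun r j => fderiv ℝ (nonlin f) (u r (grid a b M j)) (ut r (grid a b M j))
        - fderiv ℝ (nonlin f) (u t (grid a b M j)) (ut t (grid a b M j)))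
      (fun j hj => (hp j hj).mono ht hs hts) ?_
    · refine le_trans (le_of_eq (gridSq_congr fun j _ => ?_)) (h1.trans (le_of_eq ?_))
      · push_cast; ring
      · ring
    · filter_upwards [ae_restrict_mem measurableSet_Ioo] with r hr
      refine (hΛ ε u ut utt M hM h t ht r ⟨ht.1.trans hr.1.le, hr.2.le.trans hs.2⟩).trans ?_
      gcongr
      · linarith [hr.1]
      · exact hr.2.le
  · have h1 := gridSq_sub_le_of_isPrim hM (e := e) (B := Λ * (s - t) ^ 2) hst
      (φ := fun r j => nonlin f (u r (grid a b M j)) - (r : ℂ)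
        * fderiv ℝ (nonlin f) (u t (grid a b M j)) (ut t (grid a b M j)))
      (w := fun r j => fderiv ℝ (nonlin f) (u r (grid a b M j)) (ut r (grid a b M j))
        - fderiv ℝ (nonlin f) (u t (grid a b M j)) (ut t (grid a b M j)))
      (fun j hj => (hp j hj).mono hs ht hst) ?_
    · rw [gridSq_sub_comm] at h1
      refine le_trans (le_of_eq (gridSq_congr fun j _ => ?_)) (h1.trans (le_of_eq ?_))
      · push_cast; ring
      · ring
    · filter_upwards [ae_restrict_mem measurableSet_Ioo] with r hr
      refine (hΛ ε u ut utt M hM h t ht r ⟨hs.1.trans hr.1.le, hr.2.le.trans ht.2⟩).trans ?_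
      have : (r - t) ^ 2 ≤ (s - t) ^ 2 := by
        rw [← neg_sq (r - t), ← neg_sq (s - t), neg_sub, neg_sub]
        have h1 := hr.1
        have h2 := hr.2
        exact pow_le_pow_left₀ (by linarith) (by linarith) 2
      gcongr

end

/-! ### Stability and convergence of the numerical method -/

/-- A wave with the regularity in space that the error estimate uses. -/
structure IsSmoothWave (f : ℝ → ℝ) (a b T ε : ℝ) (m : ℕ) (C A R : ℝ) (u ut utt : ℝ → ℝ → ℂ) :
    Prop extends IsRegularWave f a b T ε C u ut utt where
  bound : ∀ t ∈ Icc 0 T, ∀ x ∈ Icc a b, ‖u t x‖ ≤ R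
  lipschitz : ∀ t ∈ Icc 0 T, ∀ x ∈ Icc a b, ∀ y ∈ Icc a b, ‖u t y - u t x‖ ≤ C * |y - x|
  coeff : ∀ t ∈ Icc 0 T, CoeffBound a b m (u t) A
  nonlin_mem : ∀ t ∈ Icc 0 T, HS a b 1 true C (fun x => nonlin f (u t x))
  coeff_nonlin : ∀ t ∈ Icc 0 T, CoeffBound a b m (fun x => nonlin f (u t x)) A
  coeff_zero : CoeffBound a b (m + 1) (u 0) A
  coeff_velocity : CoeffBound a b m (ut 0) A

/-- The discretisation error of the grid values at time `n τ`. -/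
def gridErr (a b τ : ℝ) (M : ℕ) (u : ℝ → ℝ → ℂ) (Ψ : ℕ → ℕ → ℂ) (n j : ℕ) : ℂ :=
  u (n * τ) (grid a b M j) - Ψ n j

section

variable {f : ℝ → ℝ} {a b T ε τ C A R : ℝ} {m M : ℕ} {u ut utt : ℝ → ℝ → ℂ} {Ψ : ℕ → ℕ → ℂ}

theorem IsSmoothWave.boundary (h : IsSmoothWave f a b T ε m C A R u ut utt) {t : ℝ}
    (ht : t ∈ Icc 0 T) : u t a = 0 ∧ u t b = 0 := (h.value t ht).2.1 rfl

theorem IsEWISP.initial_eq (h : IsEWISP f a b ε τ M (u 0) (ut 0) Ψ)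
    (hu : IsSmoothWave f a b T ε m C A R u ut utt) (hT : 0 < T) (hM : 0 < M) :
    ∀ j ≤ M, Ψ 0 j = u 0 (grid a b M j) := by
  intro j hj
  have h0 := hu.boundary ⟨le_rfl, hT.le⟩
  rcases Nat.eq_zero_or_pos j with rfl | hj0
  · rw [(h.boundary 0).1, grid_zero, h0.1]
  rcases hj.eq_or_lt with rfl | hjM
  · rw [(h.boundary 0).2, grid_self a b hM, h0.2]
  exact h.initial j (Finset.mem_Ioo.2 ⟨hj0, hjM⟩)

/-- At n = 0 the data are exact on the grid and only the Taylor remainder is left. Later the defect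
consists of Taylor remainders at tₙ + s and tₙ₋₁ about tₙ and of nonlinear errors at tₙ and tₙ₋₁.
The factor 1/τ of the backward quotient is harmless because it appears as s/τ ≤ 1. -/
theorem exists_gridSq_defect_le (hab : a < b) (hT : 0 < T)
    (hf : ContDiffOn ℝ (3 : ℕ) f (Ici 0)) {e : ℕ} (he : e ≤ 1) (m : ℕ) (C A R : ℝ) :
    ∃ K : ℝ, 0 ≤ K ∧ ∀ (ε τ : ℝ) (u ut utt : ℝ → ℝ → ℂ) (M : ℕ) (Ψ : ℕ → ℕ → ℂ), 0 < M → 0 < τ →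
      IsSmoothWave f a b T ε m C A R u ut utt → IsEWISP f a b ε τ M (u 0) (ut 0) Ψ →
      ∀ n : ℕ, (n + 1 : ℕ) * τ ≤ T → (∀ i ≤ n, ∀ j ≤ M, ‖Ψ i j‖ ≤ R + 1) → ∀ s ∈ Icc 0 τ,
      gridSq M e (fun j => nonlin f (u (n * τ + s) (grid a b M j)) - (nonlin f (Ψ n j)
          + s * nonlinDt f τ (fun j => ut 0 (grid a b M j)) Ψ n j))
        ≤ K * (τ ^ 4 + gridSq M e (gridErr a b τ M u Ψ n)
          + gridSq M e (gridErr a b τ M u Ψ (n - 1))) := by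
  obtain ⟨Λ, hΛ0, hΛ⟩ := exists_gridSq_taylor_le hab hT hf he C
  obtain ⟨K, hK0, hK⟩ := exists_gridSq_nonlin_sub_le (hf.of_le (by norm_num)) he (R + 1)
    (C * (b - a))
  refine ⟨8 * Λ + 16 * K, by positivity, fun ε τ u ut utt M Ψ hM hτ hu hΨ n hn hR s hs => ?_⟩
  have hg0 := gridSq_nonneg M e (gridErr a b τ M u Ψ n)
  have hg1 := gridSq_nonneg M e (gridErr a b τ M u Ψ (n - 1))
  have hs4 : s ^ 4 ≤ τ ^ 4 := pow_le_pow_left₀ hs.1 hs.2 4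
  have hτ4 : 0 ≤ τ ^ 4 := by positivity
  cases n with
  | zero =>
    have h1 := hΛ ε u ut utt M hM hu.toIsRegularWave s ⟨hs.1, by push_cast at hn; linarith [hs.2]⟩ 0
      ⟨le_rfl, hT.le⟩
    rw [sub_zero] at h1
    refine le_trans (le_of_eq (gridSq_congr fun j hj => ?_)) (h1.trans ?_)
    · rw [nonlinDt, hΨ.initial_eq hu hT hM j hj, fderiv_nonlin (hf.of_le (by norm_num))]
      push_cast
      rw [zero_mul, zero_add]
      ring
    · have e1 : Λ * s ^ 4 ≤ Λ * τ ^ 4 := by gcongr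
      have e2 : 0 ≤ Λ * τ ^ 4 := by positivity
      have e3 : 0 ≤ 16 * K * τ ^ 4 := by positivity
      have e4 : 0 ≤ (8 * Λ + 16 * K) * (gridSq M e (gridErr a b τ M u Ψ 0)
          + gridSq M e (gridErr a b τ M u Ψ (0 - 1))) := by positivity
      linarith
  | succ n =>
    have hτ' : (τ : ℂ) ≠ 0 := by exact_mod_cast hτ.ne'
    push_cast at hn
    have hnτ : 0 ≤ n * τ := by positivity
    have t1 : ((n + 1 : ℕ) : ℝ) * τ ∈ Icc 0 T := by push_cast; constructor <;> linarith
    have t0 : (n : ℝ) * τ ∈ Icc 0 T := by constructor <;> linarith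
    have ts : ((n + 1 : ℕ) : ℝ) * τ + s ∈ Icc 0 T := by
      push_cast; constructor <;> linarith [hs.1, hs.2]
    have a1 := hΛ ε u ut utt M hM hu.toIsRegularWave _ ts _ t1
    have a2 := hΛ ε u ut utt M hM hu.toIsRegularWave _ t0 _ t1
    have hstep : ∀ t ∈ Icc 0 T, ∀ j < M,
        ‖u t (grid a b M (j + 1)) - u t (grid a b M j)‖ ≤ C * (b - a) / M := fun t ht j hj => by
      have := hu.lipschitz t ht _ (grid_mem_Icc hab hM hj.le) _
        (grid_mem_Icc hab hM (show j + 1 ≤ M by omega))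
      rw [grid_succ_sub, abs_of_nonneg (div_nonneg (by linarith) (by positivity)),
        ← mul_div_assoc] at this
      exact this
    have hb : ∀ t ∈ Icc 0 T, ∀ j ≤ M, ‖u t (grid a b M j)‖ ≤ R + 1 := fun t ht j hj =>
      (hu.bound t ht _ (grid_mem_Icc hab hM hj)).trans (by linarith)
    have h0 : ∀ t ∈ Icc 0 T, ∀ n, u t (grid a b M 0) = Ψ n 0 := fun t ht n => by
      rw [grid_zero, (hu.boundary ht).1, (hΨ.boundary n).1]
    have b1 := hK M (fun j => u ((n + 1 : ℕ) * τ) (grid a b M j)) (Ψ (n + 1)) hM (hb _ t1)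
      (hR _ le_rfl) (h0 _ t1 _) (hstep _ t1)
    have b2 := hK M (fun j => u (n * τ) (grid a b M j)) (Ψ n) hM (hb _ t0)
      (hR _ (by omega)) (h0 _ t0 _) (hstep _ t0)
    rw [add_sub_cancel_left] at a1
    have e0 : (n : ℝ) * τ - (n + 1 : ℕ) * τ = -τ := by push_cast; ring
    rw [e0] at a2
    set g1 := gridSq M e (gridErr a b τ M u Ψ (n + 1)) with hg1def
    set g0 := gridSq M e (gridErr a b τ M u Ψ n) with hg0def
    set N1 := fun j => nonlin f (u ((n + 1 : ℕ) * τ) (grid a b M j)) - nonlin f (Ψ (n + 1) j)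
    set N0 := fun j => nonlin f (u (n * τ) (grid a b M j)) - nonlin f (Ψ n j)
    set T1 := fun j => nonlin f (u ((n + 1 : ℕ) * τ + s) (grid a b M j))
      - nonlin f (u ((n + 1 : ℕ) * τ) (grid a b M j)) - (s : ℂ) * fderiv ℝ (nonlin f)
        (u ((n + 1 : ℕ) * τ) (grid a b M j)) (ut ((n + 1 : ℕ) * τ) (grid a b M j))
    set T0 := fun j => nonlin f (u (n * τ) (grid a b M j))
      - nonlin f (u ((n + 1 : ℕ) * τ) (grid a b M j)) - ((-τ : ℝ) : ℂ) * fderiv ℝ (nonlin f)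
        (u ((n + 1 : ℕ) * τ) (grid a b M j)) (ut ((n + 1 : ℕ) * τ) (grid a b M j))
    have hθ : ‖((s / τ : ℝ) : ℂ)‖ ≤ 1 := by
      rw [Complex.norm_real, Real.norm_of_nonneg (div_nonneg hs.1 hτ.le), div_le_one hτ]
      exact hs.2
    have hθ2 : ‖((1 + s / τ : ℝ) : ℂ)‖ ≤ 2 := by
      have := div_nonneg hs.1 hτ.le
      rw [Complex.norm_real, Real.norm_of_nonneg this] at hθ
      rw [Complex.norm_real, Real.norm_of_nonneg (by linarith)]
      linarith
    -- The derivative terms of the two Taylor remainders cancel with weights 1 and s/τ, so the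
    -- unknown ∂ₜF(u(tₙ)) disappears. Norms of four terms then yield the constants 8 and 16.
    have hW : (fun j => nonlin f (u ((n + 1 : ℕ) * τ + s) (grid a b M j))
        - (nonlin f (Ψ (n + 1) j)
          + s * nonlinDt f τ (fun j => ut 0 (grid a b M j)) Ψ (n + 1) j))
        = fun j => (T1 j + ((s / τ : ℝ) : ℂ) * T0 j)
          + (((1 + s / τ : ℝ) : ℂ) * N1 j + (-((s / τ : ℝ) : ℂ)) * N0 j) := by
      funext j
      simp only [T1, T0, N1, N0, nonlinDt]
      push_cast
      field_simp
      ring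
    have c1 := gridSq_add_le M e T1 fun j => ((s / τ : ℝ) : ℂ) * T0 j
    have c2 := gridSq_add_le M e (fun j => ((1 + s / τ : ℝ) : ℂ) * N1 j)
      fun j => (-((s / τ : ℝ) : ℂ)) * N0 j
    have c3 := gridSq_add_le M e (fun j => T1 j + ((s / τ : ℝ) : ℂ) * T0 j)
      fun j => ((1 + s / τ : ℝ) : ℂ) * N1 j + (-((s / τ : ℝ) : ℂ)) * N0 j
    rw [gridSq_const_mul] at c1
    rw [gridSq_const_mul, gridSq_const_mul, norm_neg] at c2
    rw [hW]
    have d1 : ‖((s / τ : ℝ) : ℂ)‖ ^ 2 ≤ 1 := pow_le_one₀ (norm_nonneg _) hθ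
    have d2 : ‖((1 + s / τ : ℝ) : ℂ)‖ ^ 2 ≤ 4 := by
      have := pow_le_pow_left₀ (norm_nonneg _) hθ2 2
      linarith
    have f1 := mul_le_mul_of_nonneg_right d1 (gridSq_nonneg M e T0)
    have f2 := mul_le_mul_of_nonneg_right d1 (gridSq_nonneg M e N0)
    have f3 := mul_le_mul_of_nonneg_right d2 (gridSq_nonneg M e N1)
    have a3 : gridSq M e T1 ≤ Λ * τ ^ 4 := a1.trans (by gcongr)
    have a4 : gridSq M e T0 ≤ Λ * τ ^ 4 := a2.trans (le_of_eq (by ring))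
    have b1' : gridSq M e N1 ≤ K * g1 := b1
    have b2' : gridSq M e N0 ≤ K * g0 := b2
    have k1 : 0 ≤ K * τ ^ 4 := by positivity
    have k2 : 0 ≤ Λ * g1 := by positivity
    have k3 : 0 ≤ Λ * g0 := mul_nonneg hΛ0 (gridSq_nonneg _ _ _)
    have k4 : 0 ≤ K * g0 := mul_nonneg hK0 (gridSq_nonneg _ _ _)
    rw [Nat.add_sub_cancel, ← hg0def]
    linarith

/-- A modal defect is the aliasing error of F(u) plus the grid transform of the grid defect. The
latter vanishes at both end points, which the equivalence of modal and grid norms requires. -/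
theorem exists_sum_defect_le (hab : a < b) (hT : 0 < T)
    (hf : ContDiffOn ℝ (3 : ℕ) f (Ici 0)) {e : ℕ} (he : e ≤ 1) {m : ℕ} (hm : 1 ≤ m) (C A R : ℝ) :
    ∃ K : ℝ, 0 ≤ K ∧ ∀ (ε τ : ℝ) (u ut utt : ℝ → ℝ → ℂ) (M : ℕ) (Ψ : ℕ → ℕ → ℂ), 0 < M → 0 < τ →
      IsSmoothWave f a b T ε m C A R u ut utt → IsEWISP f a b ε τ M (u 0) (ut 0) Ψ →
      ∀ n : ℕ, (n + 1 : ℕ) * τ ≤ T → (∀ i ≤ n, ∀ j ≤ M, ‖Ψ i j‖ ≤ R + 1) → ∀ s ∈ Icc 0 τ,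
      ∑ l ∈ Finset.Ioo 0 M, mu a b l ^ (2 * e)
          * ‖defect f a b τ M u (fun j => ut 0 (grid a b M j)) Ψ n s l‖ ^ 2
        ≤ K * (1 / mu a b M ^ (2 * (m - e)) + τ ^ 4 + gridSq M e (gridErr a b τ M u Ψ n)
          + gridSq M e (gridErr a b τ M u Ψ (n - 1))) := by
  obtain ⟨K, hK0, hK⟩ := exists_gridSq_defect_le hab hT hf he m C A R
  have hL : 0 < b - a := by linarith
  set c := 2 + Real.pi ^ 2 / (2 * (b - a) ^ 2) with hc
  have hc0 : 0 ≤ c := by positivity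
  refine ⟨2 * (2 * (1 + Real.pi ^ 2) * |A|) + 2 * c * K, by positivity,
    fun ε τ u ut utt M Ψ hM hτ hu hΨ n hn hR s hs => ?_⟩
  have hnτ : 0 ≤ n * τ := by positivity
  have ht : n * τ + s ∈ Icc 0 T := by
    push_cast at hn
    constructor <;> linarith [hs.1, hs.2]
  have h1 := hK ε τ u ut utt M Ψ hM hτ hu hΨ n hn hR s hs
  set W := fun j => nonlin f (u (n * τ + s) (grid a b M j)) - (nonlin f (Ψ n j)
          + s * nonlinDt f τ (fun j => ut 0 (grid a b M j)) Ψ n j) with hWdef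
  have hu0 := hu.boundary ht
  have hz : ∀ j, j = 0 ∨ j = M → W j = 0 := by
    have hΨ0 : ∀ n j, j = 0 ∨ j = M → Ψ n j = 0 := by
      rintro n j (rfl | rfl)
      exacts [(hΨ.boundary n).1, (hΨ.boundary n).2]
    have hg : ∀ t ∈ Icc 0 T, ∀ v : ℝ → ℝ → ℂ, (v t a = 0 ∧ v t b = 0) → ∀ j, j = 0 ∨ j = M →
        v t (grid a b M j) = 0 := by
      rintro t _ v hv j (rfl | rfl)
      · rw [grid_zero, hv.1]
      · rw [grid_self a b hM, hv.2]
    intro j hj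
    have hD : nonlinDt f τ (fun j => ut 0 (grid a b M j)) Ψ n j = 0 := by
      cases n with
      | zero =>
        have := hg 0 ⟨le_rfl, hT.le⟩ ut ((hu.velocity 0 ⟨le_rfl, hT.le⟩).2.1 rfl) j hj
        simp [nonlinDt, this]
      | succ n => simp [nonlinDt, hΨ0 _ j hj]
    simp only [hWdef]
    rw [hD, hΨ0 _ j hj, hg _ ht u hu0 j hj]
    simp
  have h2 := sum_mu_dst_le_gridSq hab he hM (hz 0 (Or.inl rfl)) (hz M (Or.inr rfl))
  have h3 := sum_mu_aliasing_le hab hM hm (he.trans hm) (hu.nonlin_mem _ ht) (hu.coeff_nonlin _ ht)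
  have hdst : ∀ l, defect f a b τ M u (fun j => ut 0 (grid a b M j)) Ψ n s l
      = (sineCoeff a b (fun x => nonlin f (u (n * τ + s) x)) l
        - dst M (fun j => nonlin f (u (n * τ + s) (grid a b M j))) l) + dst M W l := by
    intro l
    have := dst_sub M (fun j => nonlin f (u (n * τ + s) (grid a b M j)))
      (fun j => nonlin f (Ψ n j) + s * nonlinDt f τ (fun j => ut 0 (grid a b M j)) Ψ n j) l
    rw [hWdef, this, dst_add M (fun j => nonlin f (Ψ n j))
      (fun j => s * nonlinDt f τ (fun j => ut 0 (grid a b M j)) Ψ n j), dst_const_mul, defect]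
    ring
  have h4 : ∑ l ∈ Finset.Ioo 0 M, mu a b l ^ (2 * e)
          * ‖defect f a b τ M u (fun j => ut 0 (grid a b M j)) Ψ n s l‖ ^ 2
      ≤ 2 * (∑ l ∈ Finset.Ioo 0 M, mu a b l ^ (2 * e)
          * ‖sineCoeff a b (fun x => nonlin f (u (n * τ + s) x)) l
            - dst M (fun j => nonlin f (u (n * τ + s) (grid a b M j))) l‖ ^ 2)
        + 2 * ∑ l ∈ Finset.Ioo 0 M, mu a b l ^ (2 * e) * ‖dst M W l‖ ^ 2 := by
    rw [Finset.mul_sum, Finset.mul_sum, ← Finset.sum_add_distrib]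
    refine Finset.sum_le_sum fun l _ => ?_
    rw [hdst]
    have hw : 0 ≤ mu a b l ^ (2 * e) := pow_nonneg (mu_nonneg hab l) _
    refine (mul_le_mul_of_nonneg_left norm_add_sq_le_two hw).trans (le_of_eq ?_)
    ring
  have hmuM := mu_pos_of_pos hab hM
  set P := 1 / mu a b M ^ (2 * (m - e)) with hP
  have hP0 : 0 ≤ P := by positivity
  have h5 : 2 * (1 + Real.pi ^ 2) * A / mu a b M ^ (2 * (m - e))
      ≤ 2 * (1 + Real.pi ^ 2) * |A| * P := by
    rw [hP, mul_one_div]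
    gcongr
    exact le_abs_self A
  have h6 := mul_le_mul_of_nonneg_left h1 hc0
  set g1 := gridSq M e (gridErr a b τ M u Ψ n)
  set g0 := gridSq M e (gridErr a b τ M u Ψ (n - 1))
  have hg1 : 0 ≤ g1 := gridSq_nonneg _ _ _
  have hg0 : 0 ≤ g0 := gridSq_nonneg _ _ _
  have k1 : 0 ≤ 2 * (2 * (1 + Real.pi ^ 2) * |A|) * (τ ^ 4 + g1 + g0) := by positivity
  have k2 : 0 ≤ 2 * c * K * P := by positivity
  linarith

theorem IsSmoothWave.sum_aliasing_le (hu : IsSmoothWave f a b T ε m C A R u ut utt) (hab : a < b)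
    (hM : 0 < M) (hm : 1 ≤ m) {e : ℕ} (he : e ≤ 1) {t : ℝ} (ht : t ∈ Icc 0 T) :
    ∑ l ∈ Finset.Ioo 0 M, mu a b l ^ (2 * e)
        * ‖sineCoeff a b (u t) l - dst M (fun j => u t (grid a b M j)) l‖ ^ 2
      ≤ 2 * (1 + Real.pi ^ 2) * A / mu a b M ^ (2 * (m - e)) :=
  sum_mu_aliasing_le hab hM hm (he.trans hm) (hu.value t ht) (hu.coeff t ht)

/-- Closes the loop: the grid errors in the defect are bounded by the modal energy again, up to the
aliasing of the exact solution. -/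
theorem exists_gridSq_gridErr_le (hab : a < b) {e : ℕ} (he : e ≤ 1) {m : ℕ} (hm : 1 ≤ m)
    (f : ℝ → ℝ) (T C A R : ℝ) :
    ∃ K : ℝ, 0 ≤ K ∧ ∀ (ε τ : ℝ) (u ut utt : ℝ → ℝ → ℂ) (M : ℕ) (Ψ : ℕ → ℕ → ℂ), 0 < M → 0 < τ →
      0 < ε → IsSmoothWave f a b T ε m C A R u ut utt → IsEWISP f a b ε τ M (u 0) (ut 0) Ψ →
      ∀ n : ℕ, n * τ ≤ T → gridSq M e (gridErr a b τ M u Ψ n)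
        ≤ K * (1 / mu a b M ^ (2 * (m - e))
          + modeEnergy f a b ε τ M u ut (fun j => ut 0 (grid a b M j)) Ψ e n) := by
  refine ⟨(1 + (b - a) ^ 2) * (2 * (2 * (1 + Real.pi ^ 2) * |A|) + 4), by positivity,
    fun ε τ u ut utt M Ψ hM hτ hε hu hΨ n hn => ?_⟩
  have ht : n * τ ∈ Icc 0 T := ⟨by positivity, hn⟩
  have h1 := hu.sum_aliasing_le hab hM hm he ht
  have h2 := hΨ.sum_sub_dst_le hab hε u ut e n
  have hb := hu.boundary ht
  have h3 := gridSq_le_sum_mu_dst (v := gridErr a b τ M u Ψ n) hab he hM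
    (by rw [gridErr, grid_zero, hb.1, (hΨ.boundary n).1, sub_zero])
    (by rw [gridErr, grid_self a b hM, hb.2, (hΨ.boundary n).2, sub_zero])
  have h4 : ∑ l ∈ Finset.Ioo 0 M, mu a b l ^ (2 * e) * ‖dst M (gridErr a b τ M u Ψ n) l‖ ^ 2
      ≤ 2 * (∑ l ∈ Finset.Ioo 0 M, mu a b l ^ (2 * e)
          * ‖sineCoeff a b (u (n * τ)) l - dst M (fun j => u (n * τ) (grid a b M j)) l‖ ^ 2)
        + 2 * ∑ l ∈ Finset.Ioo 0 M, mu a b l ^ (2 * e)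
          * ‖sineCoeff a b (u (n * τ)) l - dst M (Ψ n) l‖ ^ 2 := by
    rw [Finset.mul_sum, Finset.mul_sum, ← Finset.sum_add_distrib]
    refine Finset.sum_le_sum fun l _ => ?_
    have hw : 0 ≤ mu a b l ^ (2 * e) := pow_nonneg (mu_nonneg hab l) _
    have e1 : dst M (gridErr a b τ M u Ψ n) l
        = (sineCoeff a b (u (n * τ)) l - dst M (Ψ n) l)
          - (sineCoeff a b (u (n * τ)) l - dst M (fun j => u (n * τ) (grid a b M j)) l) := by
      have := dst_sub M (fun j => u (n * τ) (grid a b M j)) (Ψ n) l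
      rw [show gridErr a b τ M u Ψ n = fun j => u (n * τ) (grid a b M j) - Ψ n j from rfl, this]
      ring
    rw [e1]
    refine (mul_le_mul_of_nonneg_left norm_sub_sq_le_two hw).trans (le_of_eq ?_)
    ring
  have hmuM := mu_pos_of_pos hab hM
  set P := 1 / mu a b M ^ (2 * (m - e)) with hP
  have hP0 : 0 ≤ P := by positivity
  have h5 : 2 * (1 + Real.pi ^ 2) * A / mu a b M ^ (2 * (m - e))
      ≤ 2 * (1 + Real.pi ^ 2) * |A| * P := by
    rw [hP, mul_one_div]
    gcongr
    exact le_abs_self A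
  have hQ : 0 ≤ modeEnergy f a b ε τ M u ut (fun j => ut 0 (grid a b M j)) Ψ e n :=
    Finset.sum_nonneg fun l _ => mul_nonneg (pow_nonneg (mu_nonneg hab l) _) (by positivity)
  set Q := modeEnergy f a b ε τ M u ut (fun j => ut 0 (grid a b M j)) Ψ e n
  refine h3.trans ?_
  rw [mul_assoc]
  refine mul_le_mul_of_nonneg_left ?_ (by positivity)
  have k1 : 0 ≤ 2 * (2 * (1 + Real.pi ^ 2) * |A|) * Q := by positivity
  linarith

/-- Adding `D` to `Q` makes the recursion homogeneous. The induction keeps the last two values below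
the same nondecreasing majorant; at n = 0 they coincide, as n − 1 is truncated to 0. -/
theorem add_le_pow_mul_of_two_step {Q : ℕ → ℝ} {c D : ℝ} (hc : 0 ≤ c) (hD : 0 ≤ D)
    (hQ : ∀ n, 0 ≤ Q n) {N : ℕ}
    (h : ∀ n < N, Q (n + 1) ≤ (1 + c) * Q n + c * Q (n - 1) + c * D) :
    ∀ n ≤ N, Q n + D ≤ (1 + 2 * c) ^ n * (Q 0 + D) := by
  have hX : ∀ n, (1 + 2 * c) ^ n * (Q 0 + D) ≤ (1 + 2 * c) ^ (n + 1) * (Q 0 + D) := fun n => by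
    have := hQ 0
    gcongr
    · linarith
    · omega
  have key : ∀ n ≤ N, Q n + D ≤ (1 + 2 * c) ^ n * (Q 0 + D) ∧
      Q (n - 1) + D ≤ (1 + 2 * c) ^ n * (Q 0 + D) := by
    intro n
    induction n with
    | zero => simp
    | succ n ih =>
      intro hn
      obtain ⟨h1, h2⟩ := ih (by omega)
      have h3 := h n (by omega)
      refine ⟨?_, h1.trans (hX n)⟩
      have h4 := mul_le_mul_of_nonneg_left h1 (show 0 ≤ 1 + c by linarith)
      have h5 := mul_le_mul_of_nonneg_left h2 hc
      have h6 := mul_nonneg hc hD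
      rw [pow_succ]
      linarith
  exact fun n hn => (key n hn).1

theorem exists_modeEnergy_le (hab : a < b) (hT : 0 < T)
    (hf : ContDiffOn ℝ (3 : ℕ) f (Ici 0)) {e : ℕ} (he : e ≤ 1) {m : ℕ} (hm : 1 ≤ m) (C A R : ℝ) :
    ∃ K : ℝ, 0 ≤ K ∧ ∀ (ε τ : ℝ) (u ut utt : ℝ → ℝ → ℂ) (M : ℕ) (Ψ : ℕ → ℕ → ℂ), 0 < M → 0 < τ →
      τ ≤ 1 → 0 < ε → ε ≤ 1 →
      IsSmoothWave f a b T ε m C A R u ut utt → IsEWISP f a b ε τ M (u 0) (ut 0) Ψ →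
      ∀ n : ℕ, n * τ ≤ T → (∀ i < n, ∀ j ≤ M, ‖Ψ i j‖ ≤ R + 1) →
      modeEnergy f a b ε τ M u ut (fun j => ut 0 (grid a b M j)) Ψ e n
        ≤ K * (1 / mu a b M ^ (2 * (m - e)) + τ ^ 4) := by
  obtain ⟨K, hK0, hK⟩ := exists_sum_defect_le hab hT hf he hm C A R
  obtain ⟨K', hK'0, hK'⟩ := exists_gridSq_gridErr_le hab he hm f T C A R
  -- The two grid errors contribute K'(P + Q) each, which gives 4K(1 + 2K') before P; the summand 1
  -- covers the growth factor 1 + τ.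
  set c := 1 + 4 * K * (1 + 2 * K') with hc
  have hc0 : 0 ≤ c := by positivity
  refine ⟨Real.exp (2 * c * T) * (44 * (2 * (1 + Real.pi ^ 2) * |A|) + 1), by positivity,
    fun ε τ u ut utt M Ψ hM hτ hτ1 hε hε1 hu hΨ n hn hR => ?_⟩
  have hmuM := mu_pos_of_pos hab hM
  set P := 1 / mu a b M ^ (2 * (m - e)) with hP
  have hP0 : 0 ≤ P := by positivity
  set Q := modeEnergy f a b ε τ M u ut (fun j => ut 0 (grid a b M j)) Ψ e with hQdef
  have hQ : ∀ n, 0 ≤ Q n := fun n =>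
    Finset.sum_nonneg fun l _ => mul_nonneg (pow_nonneg (mu_nonneg hab l) _) (by positivity)
  have hle : ∀ i ≤ n, (i : ℝ) * τ ≤ T := fun i hi => by
    refine le_trans ?_ hn
    gcongr
  have hstep : ∀ i < n, Q (i + 1)
      ≤ (1 + c * τ) * Q i + c * τ * Q (i - 1) + c * τ * (P + τ ^ 4) := by
    intro i hi
    have g1 := hK' ε τ u ut utt M Ψ hM hτ hε hu hΨ i (hle i hi.le)
    have g0 := hK' ε τ u ut utt M Ψ hM hτ hε hu hΨ (i - 1) (hle (i - 1) (by omega))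
    have h1 := hu.toIsRegularWave.modeEnergy_succ_le (e := e) hab hT (hf.of_le (by norm_num)) hε hτ
      hτ1 (hle (i + 1) hi) (hK ε τ u ut utt M Ψ hM hτ hu hΨ i (hle (i + 1) hi)
        fun k hk => hR k (by omega))
    rw [← hP] at g1 g0 h1
    change gridSq M e _ ≤ K' * (P + Q i) at g1
    change gridSq M e _ ≤ K' * (P + Q (i - 1)) at g0
    change Q (i + 1) ≤ (1 + τ) * Q i + _ at h1
    refine h1.trans ?_
    have h2 := mul_le_mul_of_nonneg_left (add_le_add g1 g0) (show 0 ≤ 4 * τ * K by positivity)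
    have q1 := hQ i
    have q0 := hQ (i - 1)
    have k1 : 0 ≤ τ * Q (i - 1) := by positivity
    have k2 : 0 ≤ τ * (P + τ ^ 4) := by positivity
    have k3 : 0 ≤ τ * K * (1 + K') * Q i := by positivity
    have k4 : 0 ≤ τ * K * (1 + K') * Q (i - 1) := by positivity
    have k5 : 0 ≤ τ * K * K' * τ ^ 4 := by positivity
    rw [hc]
    linarith
  have h1 := add_le_pow_mul_of_two_step (c := c * τ) (D := P + τ ^ 4) (by positivity)
    (by positivity) hQ hstep n le_rfl
  have h2 : (1 + 2 * (c * τ)) ^ n ≤ Real.exp (2 * c * T) := by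
    have h3 : 1 + 2 * (c * τ) ≤ Real.exp (2 * (c * τ)) := by
      linarith [Real.add_one_le_exp (2 * (c * τ))]
    refine (pow_le_pow_left₀ (by positivity) h3 n).trans ?_
    rw [← Real.exp_nat_mul]
    refine Real.exp_le_exp.2 ?_
    calc (n : ℝ) * (2 * (c * τ)) = 2 * c * (n * τ) := by ring
      _ ≤ 2 * c * T := by gcongr
  -- The number 44 is 4 + 8 + 32: the three initial sums obey the same aliasing bound, since (m + 1)
  -- − (e + 1) = m − e in the one with the extra derivative.
  have h0 : Q 0 ≤ 44 * (2 * (1 + Real.pi ^ 2) * |A|) * P := by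
    have e1 := modeEnergy_zero_le (f := f) (τ := τ) (M := M) (v := fun j => ut 0 (grid a b M j))
      (Ψ := Ψ) hab hε hε1 u ut e
    have ht : (0 : ℝ) ∈ Icc 0 T := ⟨le_rfl, hT.le⟩
    have hd : ∀ l, dst M (Ψ 0) l = dst M (fun j => u 0 (grid a b M j)) l := fun l =>
      dst_congr (fun j hj => hΨ.initial j hj) l
    simp only [hd] at e1
    have a1 := hu.sum_aliasing_le hab hM hm he ht
    have a2 := sum_mu_aliasing_le hab hM hm (he.trans hm) (hu.velocity 0 ht) hu.coeff_velocity
    have a3 := sum_mu_aliasing_le hab hM (show 1 ≤ m + 1 by omega) (show e + 1 ≤ m + 1 by omega)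
      (hu.value 0 ht) hu.coeff_zero
    rw [Nat.add_sub_add_right] at a3
    have h5 : 2 * (1 + Real.pi ^ 2) * A / mu a b M ^ (2 * (m - e))
        ≤ 2 * (1 + Real.pi ^ 2) * |A| * P := by
      rw [hP, mul_one_div]
      gcongr
      exact le_abs_self A
    linarith
  have hτ4 : 0 ≤ τ ^ 4 := by positivity
  have h3 : Q n ≤ (1 + 2 * (c * τ)) ^ n * (Q 0 + (P + τ ^ 4)) := by linarith
  refine h3.trans ?_
  rw [mul_assoc]
  refine mul_le_mul h2 ?_ (by have := hQ 0; positivity) (Real.exp_pos _).le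
  have k1 : 0 ≤ 44 * (2 * (1 + Real.pi ^ 2) * |A|) * τ ^ 4 := by positivity
  linarith

end

/-! ### The error bounds -/

section

variable {f : ℝ → ℝ} {a b T ε τ C A R : ℝ} {m M : ℕ} {u ut utt : ℝ → ℝ → ℂ} {Ψ : ℕ → ℕ → ℂ}

/-- Strong induction on the step. The H¹ energy estimate at step n needs the maximum bound at
earlier steps only, and the discrete Sobolev inequality turns it into a grid error of at most 1,
hence into the bound R + 1 at step n. -/
theorem exists_stability (hab : a < b) (hT : 0 < T)
    (hf : ContDiffOn ℝ (3 : ℕ) f (Ici 0)) {m : ℕ} (hm : 1 ≤ m) (C A R : ℝ) :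
    ∃ δ K : ℝ, 0 < δ ∧ 0 ≤ K ∧ ∀ (ε τ : ℝ) (u ut utt : ℝ → ℝ → ℂ) (M : ℕ) (Ψ : ℕ → ℕ → ℂ),
      0 < M → 0 < τ → τ ≤ 1 → 0 < ε → ε ≤ 1 →
      IsSmoothWave f a b T ε m C A R u ut utt → IsEWISP f a b ε τ M (u 0) (ut 0) Ψ →
      1 / mu a b M ^ (2 * (m - 1)) + τ ^ 4 ≤ δ →
      ∀ n : ℕ, n * τ ≤ T → (∀ j ≤ M, ‖Ψ n j‖ ≤ R + 1) ∧ ∀ e ≤ 1,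
        ∑ l ∈ Finset.Ioo 0 M, mu a b l ^ (2 * e)
          * ‖sineCoeff a b (u (n * τ)) l - dst M (Ψ n) l‖ ^ 2
          ≤ K * (1 / mu a b M ^ (2 * (m - e)) + τ ^ 4) := by
  obtain ⟨K₀, hK₀0, hK₀⟩ := exists_modeEnergy_le hab hT hf zero_le_one hm C A R
  obtain ⟨K₁, hK₁0, hK₁⟩ := exists_modeEnergy_le hab hT hf le_rfl hm C A R
  obtain ⟨K', hK'0, hK'⟩ := exists_gridSq_gridErr_le hab le_rfl hm f T C A R
  -- The threshold is chosen so that the squared grid error K'(1 + K₁)δ is at most 1.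
  refine ⟨1 / (1 + K' * (1 + K₁)), 2 * (K₀ + K₁), by positivity, by positivity,
    fun ε τ u ut utt M Ψ hM hτ hτ1 hε hε1 hu hΨ hδ n hn => ?_⟩
  have hτ4 : 0 ≤ τ ^ 4 := by positivity
  have hmuM := mu_pos_of_pos hab hM
  have hb : ∀ n : ℕ, n * τ ≤ T → ∀ j ≤ M, ‖Ψ n j‖ ≤ R + 1 := by
    intro n
    induction n using Nat.strong_induction_on with
    | _ n ih =>
      intro hn j hj
      have hlt : ∀ i < n, ∀ j ≤ M, ‖Ψ i j‖ ≤ R + 1 := fun i hi => by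
        refine ih i hi (le_trans ?_ hn)
        gcongr
      have h1 := hK₁ ε τ u ut utt M Ψ hM hτ hτ1 hε hε1 hu hΨ n hn hlt
      have h2 := hK' ε τ u ut utt M Ψ hM hτ hε hu hΨ n hn
      have ht : n * τ ∈ Icc 0 T := ⟨by positivity, hn⟩
      have h3 := norm_sq_le_gridSq (v := gridErr a b τ M u Ψ n)
        (by rw [gridErr, grid_zero, (hu.boundary ht).1, (hΨ.boundary n).1, sub_zero]) hj
      set P := 1 / mu a b M ^ (2 * (m - 1)) with hP
      have hP0 : 0 ≤ P := by positivity
      have h4 : ‖gridErr a b τ M u Ψ n j‖ ^ 2 ≤ 1 ^ 2 := by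
        refine h3.trans (h2.trans ?_)
        calc _ ≤ K' * ((P + τ ^ 4) + K₁ * (P + τ ^ 4)) := by
              refine mul_le_mul_of_nonneg_left ?_ hK'0
              linarith
          _ = K' * (1 + K₁) * (P + τ ^ 4) := by ring
          _ ≤ K' * (1 + K₁) * (1 / (1 + K' * (1 + K₁))) := by gcongr
          _ ≤ _ := by
              rw [mul_one_div, one_pow, div_le_one (by positivity)]
              linarith
      have h5 := (pow_le_pow_iff_left₀ (norm_nonneg _) zero_le_one two_ne_zero).1 h4
      have h6 := hu.bound _ ht _ (grid_mem_Icc hab hM hj)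
      have h7 : Ψ n j = u (n * τ) (grid a b M j) - gridErr a b τ M u Ψ n j := by
        rw [gridErr]; ring
      rw [h7]
      exact (norm_sub_le _ _).trans (add_le_add h6 h5)
  refine ⟨hb n hn, fun e he => (hΨ.sum_sub_dst_le hab hε u ut e n).trans ?_⟩
  have hlt : ∀ i < n, ∀ j ≤ M, ‖Ψ i j‖ ≤ R + 1 := fun i hi => by
    refine hb i (le_trans ?_ hn)
    gcongr
  have hP0 : 0 ≤ 1 / mu a b M ^ (2 * (m - e)) + τ ^ 4 := by positivity
  obtain rfl | rfl : e = 0 ∨ e = 1 := by omega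
  · have := hK₀ ε τ u ut utt M Ψ hM hτ hτ1 hε hε1 hu hΨ n hn hlt
    have h2 := mul_nonneg hK₁0 hP0
    linarith
  · have := hK₁ ε τ u ut utt M Ψ hM hτ hτ1 hε hε1 hu hΨ n hn hlt
    have h2 := mul_nonneg hK₀0 hP0
    linarith

theorem l2Norm_le (hab : a ≤ b) {w : ℝ → ℂ} (hw : MemLp w 2 (volume.restrict (Ioo a b))) {B : ℝ}
    (hB : 0 ≤ B) (h : ∫ x in a..b, ‖w x‖ ^ 2 ≤ B ^ 2) : l2Norm a b w ≤ ENNReal.ofReal B := by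
  rw [l2Norm, hw.eLpNorm_eq_integral_rpow_norm (by norm_num) (by norm_num)]
  refine ENNReal.ofReal_le_ofReal ?_
  rw [intervalIntegral.integral_of_le hab, ← restrict_Ioo_eq_restrict_Ioc] at h
  simp only [ENNReal.toReal_ofNat, Real.rpow_ofNat]
  rw [← one_div, ← Real.sqrt_eq_rpow]
  exact Real.sqrt_le_iff.2 ⟨hB, h⟩

theorem l2Norm_congr {v w : ℝ → ℂ} (h : ∀ x ∈ Ioo a b, v x = w x) :
    l2Norm a b v = l2Norm a b w :=
  eLpNorm_congr_ae ((ae_restrict_mem measurableSet_Ioo).mono h)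

/-- Indeed 1/μ_M = h/π ≤ h. -/
theorem one_div_mu_pow_le (hab : a < b) (hM : 0 < M) (p : ℕ) :
    1 / mu a b M ^ (2 * p) ≤ (((b - a) / M) ^ p) ^ 2 := by
  have hM' : (0 : ℝ) < M := by exact_mod_cast hM
  have hL : 0 < b - a := by linarith
  have hmu : 1 / mu a b M ≤ (b - a) / M := by
    rw [mu, one_div_div]
    gcongr
    exact le_mul_of_one_le_left hM'.le (by linarith [Real.pi_gt_three])
  have h0 : 0 ≤ 1 / mu a b M := by have := mu_pos_of_pos hab hM; positivity
  rw [← one_div_pow, mul_comm, pow_mul]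
  exact pow_le_pow_left₀ (pow_nonneg h0 _) (pow_le_pow_left₀ h0 hmu _) 2

theorem sq_le_of_le_mul_add {x K p q : ℝ} (hK : 0 ≤ K) (hp : 0 ≤ p) (hq : 0 ≤ q)
    (h : x ≤ K * (p ^ 2 + q ^ 2)) : x ≤ ((1 + K) * (p + q)) ^ 2 := by
  refine h.trans ?_
  rw [mul_pow]
  have h1 : K ≤ (1 + K) ^ 2 := by nlinarith
  have h2 : p ^ 2 + q ^ 2 ≤ (p + q) ^ 2 := by nlinarith [mul_nonneg hp hq]
  gcongr

/-- Low modes are controlled by the stability estimate, modes from M on by the decay of the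
coefficients. Order 2 of `w` makes its first derivative continuous, so that `deriv` is the classical
derivative at every interior point. -/
theorem exists_l2Norm_le (hab : a < b) (K A : ℝ) (hK : 0 ≤ K) :
    ∃ B : ℝ, 0 < B ∧ ∀ (w : ℝ → ℂ) (m M : ℕ) (c : ℕ → ℂ) (C τ : ℝ), 0 < M → 1 ≤ m →
      HS a b 2 true C w → CoeffBound a b m w A →
      (∀ e ≤ 1, ∑ l ∈ Finset.Ioo 0 M, mu a b l ^ (2 * e) * ‖sineCoeff a b w l - c l‖ ^ 2
          ≤ K * (1 / mu a b M ^ (2 * (m - e)) + τ ^ 4)) →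
      l2Norm a b (fun x => w x - sinePoly a b M c x)
        ≤ ENNReal.ofReal (B * (((b - a) / M) ^ m + τ ^ 2)) ∧
      l2Norm a b (deriv fun x => w x - sinePoly a b M c x)
        ≤ ENNReal.ofReal (B * (((b - a) / M) ^ (m - 1) + τ ^ 2)) := by
  have hL : 0 < b - a := by linarith
  refine ⟨1 + (b - a) / 2 * (K + |A|), by positivity, fun w m M c C τ hM hm hw hA h => ?_⟩
  have hM' : (0 : ℝ) < M := by exact_mod_cast hM
  have hmuM := mu_pos_of_pos hab hM
  have hw1 := hw.lower hab.le
  have hwc := hw.continuousOn hab.le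
  obtain ⟨-, -, v, hv, hp⟩ := hw
  have hs := isPrim_sinePoly a b M c
  have hr := hp.sub hs
  have hrc : ContinuousOn (fun x => v x
      - ∑ l ∈ Finset.Ioo 0 M, c l * (mu a b l * (Real.cos (mu a b l * (x - a)) : ℂ))) (Icc a b) :=
    (hv.continuousOn hab.le).sub (by fun_prop)
  have key : ∀ e ≤ 1, ∀ x : ℝ, x ≤ (b - a) / 2 * (∑ l ∈ Finset.Ioo 0 M,
      mu a b l ^ (2 * e) * ‖sineCoeff a b w l - c l‖ ^ 2 + A / mu a b M ^ (2 * (m - e))) →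
      x ≤ ((1 + (b - a) / 2 * (K + |A|)) * (((b - a) / M) ^ (m - e) + τ ^ 2)) ^ 2 := by
    intro e he x hx
    refine sq_le_of_le_mul_add (by positivity) (by positivity) (by positivity) (hx.trans ?_)
    have h1 := h e he
    have h2 := one_div_mu_pow_le hab hM (m - e)
    have h3 : A / mu a b M ^ (2 * (m - e)) ≤ |A| * (1 / mu a b M ^ (2 * (m - e))) := by
      rw [mul_one_div]
      gcongr
      exact le_abs_self A
    rw [mul_assoc]
    refine mul_le_mul_of_nonneg_left ?_ (by positivity)
    have h4 := mul_le_mul_of_nonneg_left h2 (show 0 ≤ K + |A| by positivity)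
    have h5 : 0 ≤ |A| * τ ^ 4 := by positivity
    have h6 : (τ ^ 2) ^ 2 = τ ^ 4 := by ring
    rw [h6]
    linarith
  constructor
  · refine l2Norm_le hab.le (memLp_of_continuousOn (hr.continuousOn hab.le)) (by positivity) ?_
    refine key 0 zero_le_one _ ?_
    have := integral_remainder_sq_le hab hM hw1 hA c
    simpa using this
  · rw [l2Norm_congr fun x hx => (hr.hasDerivAt_of_continuousAt hx hrc).deriv]
    refine l2Norm_le hab.le (memLp_of_continuousOn hrc) (by positivity) ?_
    exact key 1 le_rfl _ (integral_remainder_deriv_sq_le hab hM hm hw1 hA c hr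
      (memLp_of_continuousOn hrc))

end

/-! ### Verification of the hypotheses of the stability estimate. -/

theorem HS.norm_sub_le {a b : ℝ} {s : Bool} {C : ℝ} {w : ℝ → ℂ} (h : HS a b 2 s C w) {x y : ℝ}
    (hx : x ∈ Icc a b) (hy : y ∈ Icc a b) : ‖w y - w x‖ ≤ C * |y - x| := by
  obtain ⟨-, -, v, hv, hp⟩ := h
  rw [hp.sub_eq hx hy]
  refine intervalIntegral.norm_integral_le_of_norm_le_const fun r hr => hv.1 r ?_
  exact (ordConnected_Icc.uIcc_subset hx hy) (uIoc_subset_uIcc hr)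

theorem CoeffBound.mono {a b : ℝ} {m : ℕ} {w : ℝ → ℂ} {A A' : ℝ} (h : CoeffBound a b m w A)
    (hA : A ≤ A') : CoeffBound a b m w A' := fun N => (h N).trans hA

theorem IsRegularWave.mono {f : ℝ → ℝ} {a b T ε C C' : ℝ} {u ut utt : ℝ → ℝ → ℂ}
    (h : IsRegularWave f a b T ε C u ut utt) (hC : C ≤ C') :
    IsRegularWave f a b T ε C' u ut utt :=
  ⟨h.deriv_one, h.deriv_two, fun t ht => (h.value t ht).mono hC,
    fun t ht => (h.velocity t ht).mono hC, h.acceleration.mono fun _ ht => ht.mono hC, h.equation⟩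

/-- The method samples its data at interior grid points only. This allows the traces at time 0 of
the solution and of its velocity to replace the prescribed data. -/
theorem IsEWISP.congr {f : ℝ → ℝ} {a b ε τ : ℝ} {M : ℕ} {u₀ u₁ v₀ v₁ : ℝ → ℂ} {Ψ : ℕ → ℕ → ℂ}
    (h : IsEWISP f a b ε τ M u₀ u₁ Ψ) (hab : a < b) (h0 : ∀ x ∈ Ioo a b, v₀ x = u₀ x)
    (h1 : ∀ x ∈ Ioo a b, v₁ x = u₁ x) : IsEWISP f a b ε τ M v₀ v₁ Ψ := by
  have e1 : ∀ l, dst M (fun i => u₁ (grid a b M i)) l = dst M (fun i => v₁ (grid a b M i)) l :=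
    fun l => dst_congr (fun j hj => (h1 _ (grid_mem_Ioo hab hj)).symm) l
  have e2 : ∀ n l, dst M (nonlinDt f τ (fun i => u₁ (grid a b M i)) Ψ n) l
      = dst M (nonlinDt f τ (fun i => v₁ (grid a b M i)) Ψ n) l := fun n l => by
    refine dst_congr (fun j hj => ?_) l
    cases n with
    | zero => simp only [nonlinDt, h1 _ (grid_mem_Ioo hab hj)]
    | succ n => rfl
  obtain ⟨hb, hi, hf, hs⟩ := h
  simp only [e1, e2] at hf hs
  exact ⟨hb, fun j hj => (hi j hj).trans (h0 _ (grid_mem_Ioo hab hj)).symm, hf, hs⟩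

/-- The supremum in `M₁` runs over the open interval, so the end points are covered by the Dirichlet
condition. The common bound `C` makes the suprema genuine. -/
theorem norm_le_M₁ {a b T C : ℝ} (hab : a < b) {ψ : ℝ → ℝ → ℝ → ℂ} {ψs : ℝ → ℝ → ℂ}
    (hC : ∀ ε ∈ Ioc (0 : ℝ) 1, ∀ t ∈ Icc 0 T, ∀ x ∈ Icc a b, ‖ψ ε t x‖ ≤ C)
    (h0 : ∀ ε ∈ Ioc (0 : ℝ) 1, ∀ t ∈ Icc 0 T, ψ ε t a = 0 ∧ ψ ε t b = 0)
    {ε : ℝ} (hε : ε ∈ Ioc (0 : ℝ) 1) {t : ℝ} (ht : t ∈ Icc 0 T) {x : ℝ} (hx : x ∈ Icc a b) :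
    ‖ψ ε t x‖ ≤ M₁ a b T ψ ψs := by
  have hc : (a + b) / 2 ∈ Ioo a b := ⟨by linarith, by linarith⟩
  have hub : ∀ ε ∈ Ioc (0 : ℝ) 1,
      C ∈ upperBounds ((fun p : ℝ × ℝ => ‖ψ ε p.1 p.2‖) '' (Icc 0 T ×ˢ Ioo a b)) := by
    rintro ε hε _ ⟨p, hp, rfl⟩
    exact hC ε hε _ hp.1 _ (Ioo_subset_Icc_self hp.2)
  have hbdd : BddAbove (range fun ε : Ioc (0 : ℝ) 1 => supNorm a b T (ψ ε)) := by
    refine ⟨C, ?_⟩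
    rintro _ ⟨ε', rfl⟩
    refine csSup_le ?_ (hub ε' ε'.2)
    exact ⟨_, (t, (a + b) / 2), ⟨ht, hc⟩, rfl⟩
  have key : ∀ x ∈ Ioo a b, ‖ψ ε t x‖ ≤ M₁ a b T ψ ψs := fun x hx =>
    (le_csSup ⟨C, hub ε hε⟩ ⟨(t, x), ⟨ht, hx⟩, rfl⟩).trans
      ((le_ciSup hbdd ⟨ε, hε⟩).trans (le_max_left _ _))
  have hnn : 0 ≤ M₁ a b T ψ ψs := (norm_nonneg _).trans (key _ hc)
  rcases eq_or_ne x a with rfl | hxa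
  · rwa [(h0 ε hε t ht).1, norm_zero]
  rcases eq_or_ne x b with rfl | hxb
  · rwa [(h0 ε hε t ht).2, norm_zero]
  exact key x ⟨lt_of_le_of_ne hx.1 hxa.symm, lt_of_le_of_ne hx.2 hxb⟩

theorem linfNorm_le {M : ℕ} {v : ℕ → ℂ} {B : ℝ} (hB : 0 ≤ B) (h : ∀ j ≤ M, ‖v j‖ ≤ B) :
    linfNorm M v ≤ B := by
  lift B to NNReal using hB
  rw [linfNorm, NNReal.coe_le_coe]
  exact Finset.sup_le fun j hj => h j (Finset.mem_Ioo.1 hj).2.le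

/-- The solutions are smooth waves, uniformly in `ε`. -/
theorem exists_isSmoothWave {a b T α : ℝ} (hab : a < b) (hT : 0 < T) (hα : 2 ≤ α) {m₀ k : ℕ}
    (hm₀ : 2 ≤ m₀) (hk : 3 ≤ k) {f : ℝ → ℝ} (hf : ContDiffOn ℝ k f (Ici 0)) {ψ₀ : ℝ → ℂ}
    {ω : ℝ → ℝ → ℂ} {ψ ψt ψtt : ℝ → ℝ → ℝ → ℂ} {ψs ψst ψstt : ℝ → ℝ → ℂ}
    (hψ : ∀ ε ∈ Ioc (0 : ℝ) 1, IsNLSWSolution f a b T ε ψ₀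
      (initialVelocity f α ψ₀ ω ε) (ψ ε) (ψt ε) (ψtt ε))
    (hA : AssumptionA a b m₀ ψ₀ ω)
    (hB : AssumptionB a b T α m₀ ψ ψt ψtt ψs ψst ψstt) :
    ∃ C A : ℝ, ∀ ε ∈ Ioc (0 : ℝ) 1,
      IsSmoothWave f a b T ε (min m₀ k) C A (M₁ a b T ψ ψs) (ψ ε) (ψt ε) (ψtt ε) ∧
      ∀ t ∈ Icc 0 T, HS a b 2 true C (ψ ε t) := by
  obtain ⟨C₁, hC₁⟩ := hB.wave
  obtain ⟨C₂, hC₂⟩ := hB.wave_tt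
  set m := min m₀ k with hm
  have hmm₀ : m ≤ m₀ := min_le_left _ _
  have hmk : m ≤ k := min_le_right _ _
  have hm2 : 2 ≤ m := le_min hm₀ (by omega)
  obtain ⟨A₁, hA₁⟩ := hA.exists_initialVelocity hab hmm₀ hmk (by omega) hf (by linarith)
  obtain ⟨C₀, hC₀⟩ := hA.value.exists_hs hab
  obtain ⟨C₀', hC₀'⟩ := hC₀.exists_of_le hab.le (show m + 1 ≤ m₀ + 2 by omega)
  set E := embConst a b
  have hE : 0 ≤ E := zero_le_one.trans (one_le_embConst hab)
  obtain ⟨K₁, hK₁⟩ := HS.exists_nonlin hab.le (n := 0) (hf.of_le (by exact_mod_cast (by omega)))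
    (E * max C₁ C₂)
  obtain ⟨K₂, hK₂⟩ := HS.exists_nonlin hab.le (n := m - 1)
    (hf.of_le (by exact_mod_cast (by omega : m - 1 + 1 ≤ k))) (E * C₁)
  rw [Nat.sub_add_cancel (by omega)] at hK₂
  have hL : 0 < b - a := by linarith
  refine ⟨max (E * max C₁ C₂) K₁, max (max (2 / (b - a) * (E * C₁) ^ 2) (2 / (b - a) * K₂ ^ 2))
    (max (2 / (b - a) * C₀' ^ 2) A₁), fun ε hε => ?_⟩
  have hsol := hψ ε hε
  have hreg : IsRegularWave f a b T ε (E * max C₁ C₂) (ψ ε) (ψt ε) (ψtt ε) := by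
    refine hsol.isRegularWave hab hT (contDiff_nonlin hf).continuous (C := C₁)
      (fun t ht => (hC₁ ε hε t ht).2.1.of_le hab (by omega))
      (fun t ht => (hC₁ ε hε t ht).2.2.2) ?_ (le_max_left _ _)
    filter_upwards [hC₂ ε hε] with t ht
    obtain ⟨g, hg, h⟩ := ht
    -- Here the well-prepared data enter: for α ≥ 2 the bound on the second time derivative carries
    -- the power ε⁰.
    rw [min_eq_right hα, sub_self, Real.rpow_zero, div_one] at h
    exact ⟨g, hg, h.trans (le_max_right _ _)⟩
  have h0T : (0 : ℝ) ∈ Icc 0 T := ⟨le_rfl, hT.le⟩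
  have hv0 := (hreg.velocity 0 h0T).2.1 rfl
  obtain ⟨⟨Cv, hCv⟩, hAv⟩ := hA₁ ε hε (ψt ε 0) hv0.1 hv0.2 hsol.initial_velocity
  have hu0 : EqOn ψ₀ (ψ ε 0) (Icc a b) := by
    intro x hx
    rcases eq_or_ne x a with rfl | hxa
    · rw [(hC₀'.2.1 rfl).1, (hsol.dirichlet 0 h0T).1]
    rcases eq_or_ne x b with rfl | hxb
    · rw [(hC₀'.2.1 rfl).2, (hsol.dirichlet 0 h0T).2]
    exact (hsol.initial_value x ⟨lt_of_le_of_ne hx.1 hxa.symm, lt_of_le_of_ne hx.2 hxb⟩).symm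
  have hinit := hC₀'.congr hab.le hu0
  -- The order n = 2 serves the Lipschitz bound in space and the classical derivative, the order n =
  -- m the convergence rate.
  have hsm : ∀ n, 2 ≤ n → n ≤ m → ∀ t ∈ Icc 0 T, HS a b n true (E * C₁) (ψ ε t) := by
    intro n hn hnm
    obtain ⟨c₀, hc₀⟩ := hinit.exists_of_le hab.le (show n ≤ m + 1 by omega)
    obtain ⟨c₁, hc₁⟩ := hCv.exists_of_le hab.le hnm
    exact hreg.hs_of_hNormLe hab hT hε.1 hε.2 (by omega)
      (hf.of_le (by exact_mod_cast hnm.trans hmk))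
      (fun t ht => (hC₁ ε hε t ht).2.1.of_le hab (hnm.trans hmm₀)) hc₀ hc₁
  have hEC : E * C₁ ≤ max (E * max C₁ C₂) K₁ :=
    (mul_le_mul_of_nonneg_left (le_max_left _ _) hE).trans (le_max_left _ _)
  have h2 : ∀ t ∈ Icc 0 T, HS a b 2 true (max (E * max C₁ C₂) K₁) (ψ ε t) := fun t ht =>
    (hsm 2 le_rfl hm2 t ht).mono hEC
  refine ⟨{
    toIsRegularWave := hreg.mono (le_max_left _ _)
    bound := fun t ht x hx => norm_le_M₁ hab (fun ε hε t ht => (hC₁ ε hε t ht).1)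
      (fun ε hε t ht => (hC₁ ε hε t ht).2.2.1) hε ht hx
    lipschitz := fun t ht x hx y hy => (h2 t ht).norm_sub_le hx hy
    coeff := fun t ht => ((hsm m hm2 le_rfl t ht).coeffBound hab).mono
      ((le_max_left _ _).trans (le_max_left _ _))
    nonlin_mem := fun t ht => (hK₁ _ (hreg.value t ht)).mono (le_max_right _ _)
    coeff_nonlin := fun t ht => ((hK₂ _ (hsm m hm2 le_rfl t ht)).coeffBound hab).mono
      ((le_max_right _ _).trans (le_max_left _ _))
    coeff_zero := (hinit.coeffBound hab).mono ((le_max_left _ _).trans (le_max_right _ _))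
    coeff_velocity := hAv.mono ((le_max_right _ _).trans (le_max_right _ _)) }, h2⟩

end NLSW

end

theorem theorem1 (a b T α : ℝ) (hab : a < b) (hT : 0 < T) (hα : 2 ≤ α)
    (m₀ k : ℕ) (hm₀ : 2 ≤ m₀) (hk : 3 ≤ k)
    (f : ℝ → ℝ) (hf : ContDiffOn ℝ k f (Set.Ici 0))
    (ψ₀ : ℝ → ℂ) (ω : ℝ → ℝ → ℂ)
    (ψ ψt ψtt : ℝ → ℝ → ℝ → ℂ) (ψs ψst ψstt : ℝ → ℝ → ℂ)
    (hψ : ∀ ε ∈ Set.Ioc (0 : ℝ) 1, NLSW.IsNLSWSolution f a b T ε ψ₀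
      (NLSW.initialVelocity f α ψ₀ ω ε) (ψ ε) (ψt ε) (ψtt ε))
    (hψs : NLSW.IsNLSSolution f a b T ψ₀ ψs ψst ψstt)
    (hA : NLSW.AssumptionA a b m₀ ψ₀ ω)
    (hB : NLSW.AssumptionB a b T α m₀ ψ ψt ψtt ψs ψst ψstt) :
    ∃ τ₀ h₀ C : ℝ, (0 < τ₀ ∧ τ₀ ≤ 1) ∧ (0 < h₀ / Real.pi ∧ h₀ / Real.pi ≤ 1) ∧ 0 < C ∧
      ∀ ε ∈ Set.Ioc (0 : ℝ) 1, ∀ (M : ℕ) (h τ : ℝ), 0 < M → h = (b - a) / M → h ≤ h₀ →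
        0 < τ → τ ≤ τ₀ → ∀ Ψ : ℕ → ℕ → ℂ,
        NLSW.IsEWISP f a b ε τ M ψ₀ (NLSW.initialVelocity f α ψ₀ ω ε) Ψ →
        ∀ n : ℕ, (n : ℝ) ≤ T / τ →
          NLSW.l2Norm a b (fun x => ψ ε (n * τ) x - NLSW.interp a b M (Ψ n) x)
              ≤ ENNReal.ofReal (C * (h ^ min m₀ k + τ ^ 2)) ∧
          NLSW.l2Norm a b (deriv fun x => ψ ε (n * τ) x - NLSW.interp a b M (Ψ n) x)
              ≤ ENNReal.ofReal (C * (h ^ (min m₀ k - 1) + τ ^ 2)) ∧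
          NLSW.linfNorm M (Ψ n) ≤ NLSW.M₁ a b T ψ ψs + 1 := by
  obtain ⟨C, A, hS⟩ := NLSW.exists_isSmoothWave hab hT hα hm₀ hk hf hψ hA hB
  have hf3 : ContDiffOn ℝ (3 : ℕ) f (Set.Ici 0) := hf.of_le (by exact_mod_cast hk)
  have hm2 : 2 ≤ min m₀ k := le_min hm₀ (by omega)
  obtain ⟨δ, K, hδ, hK0, hK⟩ := NLSW.exists_stability hab hT hf3
    (show 1 ≤ min m₀ k by omega) C A (NLSW.M₁ a b T ψ ψs)
  obtain ⟨B, hB0, hBd⟩ := NLSW.exists_l2Norm_le hab K A hK0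
  have hL : 0 < b - a := by linarith
  have hπ := Real.pi_gt_three
  -- As m ≥ 2, both h^{2(m−1)} ≤ h and τ⁴ ≤ τ hold for h, τ ≤ 1, so each takes up at most half of
  -- the threshold δ.
  refine ⟨min 1 (δ / 2), min 1 (δ / 2), B, ⟨by positivity, min_le_left _ _⟩,
    ⟨by positivity, ?_⟩, hB0, fun ε hε M h τ hM hh hh₀ hτ hττ₀ Ψ hΨ n hn => ?_⟩
  · rw [div_le_one Real.pi_pos]
    exact (min_le_left _ _).trans (by linarith)
  obtain ⟨hsm, h2⟩ := hS ε hε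
  have hM' : (0 : ℝ) < M := by exact_mod_cast hM
  have hτ1 : τ ≤ 1 := hττ₀.trans (min_le_left _ _)
  have hh1 : h ≤ 1 := hh₀.trans (min_le_left _ _)
  have hh0 : 0 < h := by rw [hh]; positivity
  have hnT : (n : ℝ) * τ ≤ T := (le_div_iff₀ hτ).1 hn
  have ht : (n : ℝ) * τ ∈ Set.Icc 0 T := ⟨by positivity, hnT⟩
  have hδ' : 1 / NLSW.mu a b M ^ (2 * (min m₀ k - 1)) + τ ^ 4 ≤ δ := by
    have h1 := NLSW.one_div_mu_pow_le hab hM (min m₀ k - 1)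
    rw [← hh] at h1
    have h3 : (h ^ (min m₀ k - 1)) ^ 2 ≤ h := by
      rw [← pow_mul]
      exact pow_le_of_le_one hh0.le hh1 (by omega)
    have h4 : τ ^ 4 ≤ τ := pow_le_of_le_one hτ.le hτ1 (by norm_num)
    have h5 := hh₀.trans (min_le_right _ _)
    have h6 := hττ₀.trans (min_le_right _ _)
    linarith
  have hΨ' := hΨ.congr hab (hψ ε hε).initial_value (hψ ε hε).initial_velocity
  obtain ⟨hb, he⟩ := hK ε τ (ψ ε) (ψt ε) (ψtt ε) M Ψ hM hτ hτ1 hε.1 hε.2 hsm hΨ' hδ' n hnT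
  -- The interpolant `interp` is by definition the sine polynomial with coefficients `dst M (Ψ n)`.
  obtain ⟨e0, e1⟩ := hBd (ψ ε (n * τ)) (min m₀ k) M (NLSW.dst M (Ψ n)) C τ hM (by omega)
    (h2 _ ht) (hsm.coeff _ ht) he
  rw [← hh] at e0 e1
  exact ⟨e0, e1, NLSW.linfNorm_le ((norm_nonneg _).trans (hb 0 (Nat.zero_le _))) hb⟩
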